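/- **Setting.** Let $K$ be a number field and $S$ a finite set of places of $K$ containing the archimedean ones. A Campana orbifold $(X,D)$ over $K$ is a smooth proper (geometrically integral) variety $X$ over $K$ with a $\mathbb{Q}$-divisor $D=\sum_{\alpha\in\mathscr A}(1-\frac1{m_\alpha})D_\alpha$, where the $D_\alpha$ are finitely many distinct prime divisors and the weights satisfy $m_\alpha\in\mathbb{Z}_{\ge1}\cup\{\infty\}$; put $D_{\mathrm{red}}=\bigcup_{m_\alpha\ne1}D_\alpha$. A prime divisor which is not among the $D_\alpha$ has weight $1$ in $D$; components of weight $1$ have coefficient $0$ and are disregarded when components of $D$ are considered. An $\mathcal{O}_S$-model $(\mathcal X,\mathcal D)$ of $(X,D)$ is a proper flat $\mathcal{O}_S$-scheme $\mathcal X$ with an identification of its generic fibre with $X$, together with the Zariski closures $\mathcal D_\alpha$ of the $D_\alpha$ in $\mathcal X$; $\mathcal D_{\mathrm{red}}$ is the closure of $D_{\mathrm{red}}$. For $v\notin S$ and $P\in X(K_v)$, let $\mathcal P\in\mathcal X(\mathcal O_v)$ be the point extending $P$, and write $\mathcal P\cap\mathcal D_\alpha\cong\operatorname{Spec}\mathcal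 O_v/I$ for the scheme-theoretic intersection. Put $n_v(\mathcal D_\alpha,P)=n$ if $I=(\pi_v^n)$, where $\pi_v$ is a uniformiser, and $n_v(\mathcal D_\alpha,P)=\infty$ if $I=0$. The point $P$ is a $v$-adic Campana (respectively Darmon) point if $n_v(\mathcal D_\alpha,P)=0$ whenever $m_\alpha=\infty$, and $n_v(\mathcal D_\alpha,P)\in\mathbb{Z}_{\ge m_\alpha}\cup\{0,\infty\}$ (respectively $m_\alpha\mid n_v(\mathcal D_\alpha,P)$, where every $m_\alpha$ divides $\infty$) whenever $m_\alpha<\infty$. For a finite set of places $T\supseteq S$, let $(\mathcal X,\mathcal D)^{*}(\mathcal O_T)$, with $*=\mathbf C$ (respectively $*=\mathbf D$), be the set of $P\in X(K)$ that are $v$-adic Campana (respectively Darmon) points for all $v\notin T$. Let $(\mathcal X\setminus\mathcal D_{\mathrm{red}})(\mathcal O_T)$ be the set of $P\in X(K)$ which for every $v\notin T$ extend to an $\mathcal O_v$-point of $\mathcal X\setminus\mathcal D_{\mathrm{red}}$. An orbifold morphism $f:(Y,F)\to(X,D)$ is a $K$-morphism $f:Y\to X$ with $f(Y)\not\subset D_{\mathrm{red}}$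 such that, for every prime divisor $G\subset Y$, of weight $n$ in $F$, and every $\alpha$ with $f(G)\subset D_\alpha$, one has $t\,n\ge m_\alpha$, where $t$ is the multiplicity of $G$ in $f^*D_\alpha$. It is divisible if moreover $m_\alpha\mid t\,n$ in all these cases (every $m_\alpha$ divides $\infty$, and $\infty$ divides only $\infty$). It is an elementary birational orbifold morphism (EBOM) if $f$ is birational and $f_*(F)=D$ at the level of components: up to components of weight $1$, $F=\sum_\alpha(1-\frac1{m'_\alpha})\widetilde{D_\alpha}+\sum_i(1-\frac1{n_i})E_i$, where $\widetilde{D_\alpha}$ is the strict transform of $D_\alpha$ and the $E_i$ are contracted by $f$ (necessarily $m'_\alpha\ge m_\alpha$). The centre $Z\subset X$ of $f$ is the complement of the largest open subset of $X$ over which $f$ is an isomorphism, and the exceptional divisor $E\subset Y$ is the union of the prime divisors of $Y$ contracted by $f$. **Proposition 4.4.** Let $f:(Y,F)\to(X,D)$ be an EBOM of Campana orbifolds over $K$, with centre $Z$ and exceptional divisor $E$, and let $(\mathcal Y,\mathcal F)$ and $(\mathcal X,\mathcal D)$ be $\mathcal O_S$-models of $(Y,F)$ and $(X,D)$. Then there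 exists a finite set of places $T\supseteq S$ such that the following hold. (i) Let $\mathcal Z$ be the closure of $Z$ in $\mathcal X$. Suppose that the weights of $F$ are minimal: for every component $F_\beta$ of $F$ not contracted by $f$, the weight of $F_\beta$ equals that of the component $D_\alpha$ with $f(F_\beta)=D_\alpha$. Then, for each $*\in\{\mathbf C,\mathbf D\}$, every point of $(\mathcal X,\mathcal D)^{*}(\mathcal O_T)$ whose closure in $\mathcal X_{\mathcal O_T}$ does not meet $\mathcal Z$ lies in $f\big((\mathcal Y,\mathcal F)^{*}(\mathcal O_T)\big)$. (ii) If $f$ is divisible and $Z\cap D_{\mathrm{red}}=\emptyset$, then $f\big((\mathcal Y,\mathcal F)^{*}(\mathcal O_T)\big)\subset(\mathcal X,\mathcal D)^{*}(\mathcal O_T)$ for each $*\in\{\mathbf C,\mathbf D\}$, and $f\big((\mathcal Y\setminus\mathcal F_{\mathrm{red}})(\mathcal O_T)\big)\subset(\mathcal X\setminus\mathcal D_{\mathrm{red}})(\mathcal O_T)$. (iii) If for every irreducible component $E_j$ of $E$ and every component $D_\alpha$ of $D$ either $f(E_j)\cap D_\alpha=\emptyset$ or $f(E_j)\subset D_\alpha$,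 then $f\big((\mathcal Y,\mathcal F)^{\mathbf C}(\mathcal O_T)\big)\subset(\mathcal X,\mathcal D)^{\mathbf C}(\mathcal O_T)$. -/

import Mathlib

open CategoryTheory CategoryTheory.Limits AlgebraicGeometry TopologicalSpace
open IsDedekindDomain NumberField

universe u

noncomputable section

namespace SemiIntegral

/-! ### Multiplicities -/

/-- The order, at a point `w` of a scheme `W`, of the closed subscheme cut out by the ideal sheaf
`J`: the supremum of all `n` such that the stalk of `J` at `w` is contained in the `n`-th power of
the maximal ideal of the local ring `𝒪_{W,w}`.  If `𝒪_{W,w}` is a discrete valuation ring, it is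
the `n` with `J_w = 𝔪ⁿ`, and it is `∞` if `J_w = 0`. -/
def orderAt {W : Scheme.{u}} (J : W.IdealSheafData) (w : W) : ℕ∞ :=
  ⨆ n ∈ {n : ℕ | ∀ (U : W.affineOpens) (hw : w ∈ U.1), ∀ s ∈ J.ideal U,
      W.presheaf.germ U.1 w hw s ∈
        IsLocalRing.maximalIdeal (W.presheaf.stalk w) ^ n}, (n : ℕ∞)

/-- The order at `w` of the scheme-theoretic inverse image, under `g : W ⟶ X`, of the closed
subset `Z` of `X` with its reduced structure (`comap` is the ideal sheaf of the fibre product of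
`W` and `Z` over `X`). -/
def pullbackOrder {W X : Scheme.{u}} (g : W ⟶ X) (Z : Closeds X) (w : W) : ℕ∞ :=
  orderAt ((Scheme.IdealSheafData.vanishingIdeal Z).comap g) w

/-! ### Campana orbifolds -/

/-- A Campana orbifold `(X, D)` over a field `k`: a smooth proper variety `X` over `k` and a
`ℚ`-divisor `D = ∑ (1 - 1 / m_α) D_α`, given by finitely many distinct prime divisors `D_α` with
weights `m_α ∈ {1, 2, …} ∪ {∞}`.  A prime divisor is given by its generic point, a point of
codimension one; on a smooth variety every prime divisor is Cartier. -/
structure Orbifold (k : Type u) [Field k] where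
  X : Scheme.{u}
  str : X ⟶ Spec (.of k)
  isProper : IsProper str
  smooth : Smooth str
  geometricallyIntegral : GeometricallyIntegral str
  index : Type
  finite_index : Finite index
  /-- the generic point of `D_α` -/
  pt : index → X
  pt_injective : Function.Injective pt
  coheight_pt : ∀ α, Order.coheight (pt α) = 1
  weight : index → ℕ∞
  one_le_weight : ∀ α, 1 ≤ weight α

attribute [instance] Orbifold.isProper Orbifold.smooth Orbifold.geometricallyIntegral
  Orbifold.finite_index

namespace Orbifold

variable {k : Type u} [Field k] (D : Orbifold k)

/-- The prime divisor `D_α` as a closed subset of `X`. -/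
def component (α : D.index) : Closeds D.X := Closeds.closure {D.pt α}

/-- The support `D_red`: the union of the `D_α` of weight different from `1`. -/
def red : Set D.X := ⋃ α ∈ {α | D.weight α ≠ 1}, (D.component α : Set D.X)

open Classical in
/-- The weight in `D` of the prime divisor with generic point `η`: a prime divisor which is not
among the `D_α` has weight `1`, that is, coefficient `0`. -/
def weightAt (η : D.X) : ℕ∞ :=
  if h : ∃ α, D.pt α = η then D.weight h.choose else 1

end Orbifold

/-! ### Orbifold morphisms -/

section Morphisms

variable {k : Type u} [Field k]

/-- `f` is a morphism of orbifolds `(Y, F) ⟶ (X, D)`: it is a `k`-morphism, `f(Y) ⊄ D_red`, and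
`m_α ≤ t n` for every prime divisor `G` of `Y`, of weight `n` in `F`, with `f(G) ⊆ D_α`, where `t`
is the multiplicity of `G` in the pullback of `D_α`. -/
structure IsOrbifoldMorphism (F D : Orbifold k) (f : F.X ⟶ D.X) : Prop where
  comp_str : f ≫ D.str = F.str
  range_not_subset : ¬ Set.range f ⊆ D.red
  weight_le : ∀ η : F.X, Order.coheight η = 1 → ∀ α, f η ∈ D.component α →
    D.weight α ≤ pullbackOrder f (D.component α) η * F.weightAt η

/-- Divisibility of an orbifold morphism: the inequality `m_α ≤ t n` holds in the form
`m_α ∣ t n`.  (In `ℕ∞`, every non-zero element divides `∞`, and `∞` divides only `0` and `∞`.) -/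
def IsDivisible (F D : Orbifold k) (f : F.X ⟶ D.X) : Prop :=
  ∀ η : F.X, Order.coheight η = 1 → ∀ α, f η ∈ D.component α →
    D.weight α ∣ pullbackOrder f (D.component α) η * F.weightAt η

/-- `f` is a birational morphism: it restricts to an isomorphism between dense open subschemes. -/
def IsBirationalMorphism {Y X : Scheme.{u}} (f : Y ⟶ X) : Prop :=
  ∃ φ : Y.PartialIso X, φ.iso.hom ≫ φ.target.ι = φ.source.ι ≫ f

/-- The prime divisor with generic point `η` is contracted by `f`: the closure of its image is not
a divisor. -/
def IsContracted {Y X : Scheme.{u}} (f : Y ⟶ X) (η : Y) : Prop :=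
  Order.coheight (f η) ≠ 1

/-- The centre of a birational morphism `f : Y ⟶ X`: the complement of the largest open subset of
`X` over which `f` is an isomorphism. -/
def centre {Y X : Scheme.{u}} (f : Y ⟶ X) : Set X :=
  {x | ¬ ∃ U : X.Opens, x ∈ U ∧ IsIso (f ∣_ U)}

/-- The generic points of the irreducible components of the exceptional divisor of a birational
morphism: the prime divisors contracted by it. -/
def exceptionalPts {Y X : Scheme.{u}} (f : Y ⟶ X) : Set Y :=
  {η | Order.coheight η = 1 ∧ IsContracted f η}

/-- Elementary birational orbifold morphisms.  The last two fields say that `f_* F` and `D` have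
the same components (components of weight `1` have coefficient `0` and may be omitted), so that
`F = ∑ (1 - 1 / m'_α) D̃_α + ∑ (1 - 1 / n_i) E_i` with `D̃_α` the strict transform of `D_α` and the
`E_i` contracted by `f`; the inequality `m_α ≤ m'_α` is part of being an orbifold morphism. -/
structure IsEBOM (F D : Orbifold k) (f : F.X ⟶ D.X) : Prop extends IsOrbifoldMorphism F D f where
  birational : IsBirationalMorphism f
  map_component : ∀ β, F.weight β ≠ 1 → ¬ IsContracted f (F.pt β) → ∃ α, f (F.pt β) = D.pt α
  exists_component : ∀ α, D.weight α ≠ 1 → ∃ β, f (F.pt β) = D.pt α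

end Morphisms

/-! ### Points and integral models -/

section Models

/-- The set `X(L)` of `L`-points of a `k`-scheme `X`, for a field extension `L` of `k`. -/
def Point {k : Type u} [Field k] {X : Scheme.{u}} (str : X ⟶ Spec (.of k))
    (L : Type u) [Field L] [Algebra k L] :=
  {P : Spec (.of L) ⟶ X // P ≫ str = Spec.map (CommRingCat.ofHom (algebraMap k L))}

/-- The image of a point under a morphism of `k`-schemes. -/
def Point.map {k : Type u} [Field k] {Y X : Scheme.{u}} {strY : Y ⟶ Spec (.of k)}
    {strX : X ⟶ Spec (.of k)} {L : Type u} [Field L] [Algebra k L] (f : Y ⟶ X)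
    (hf : f ≫ strX = strY) (P : Point strY L) : Point strX L :=
  ⟨P.1 ≫ f, by rw [Category.assoc, hf, P.2]⟩

/-- A `k`-point, viewed as an `L`-point. -/
def Point.extend {k : Type u} [Field k] {X : Scheme.{u}} {str : X ⟶ Spec (.of k)}
    (L : Type u) [Field L] [Algebra k L] (P : Point str k) : Point str L :=
  ⟨Spec.map (CommRingCat.ofHom (algebraMap k L)) ≫ P.1, by
    rw [Category.assoc, P.2, ← Spec.map_comp]; rfl⟩

variable {K : Type u} [Field K] [NumberField K]

/-- A proper `𝒪_S`-model of a `K`-scheme `X`: a proper flat scheme (in particular of finite type)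
over the ring `𝒪_S` of `S`-integers, with an identification of `X` with its generic fibre.  A
finite set of places containing the archimedean ones is given by its set `S` of finite places. -/
structure Model (S : Set (HeightOneSpectrum (𝓞 K))) {X : Scheme.{u}}
    (strX : X ⟶ Spec (.of K)) where
  total : Scheme.{u}
  str : total ⟶ Spec (.of (S.integer K))
  isProper : IsProper str
  flat : Flat str
  /-- the inclusion of the generic fibre -/
  gen : X ⟶ total
  isPullback : IsPullback gen strX str
    (Spec.map (CommRingCat.ofHom (algebraMap (S.integer K) K)))

attribute [instance] Model.isProper Model.flat

/-- The canonical map `𝒪_S → 𝒪_v` for a finite place `v ∉ S`. -/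
def toLocal {S : Set (HeightOneSpectrum (𝓞 K))} {v : HeightOneSpectrum (𝓞 K)} (hv : v ∉ S) :
    S.integer K →+* v.adicCompletionIntegers K :=
  RingHom.codRestrict ((algebraMap K (v.adicCompletion K)).comp (S.integer K).val.toRingHom)
    (v.adicCompletionIntegers K) (fun x => by
      rw [HeightOneSpectrum.mem_adicCompletionIntegers]
      exact (HeightOneSpectrum.valuedAdicCompletion_eq_valuation' v (x : K)).trans_le (x.2 v hv))

namespace Model

variable {S : Set (HeightOneSpectrum (𝓞 K))} {X : Scheme.{u}} {strX : X ⟶ Spec (.of K)}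
  (M : Model S strX)

/-- The Zariski closure in the model of a subset of the generic fibre. -/
def closure (Z : Set X) : Closeds M.total := Closeds.closure (M.gen '' Z)

/-- By properness, every `K_v`-point extends uniquely to an `𝒪_v`-point of the model. -/
theorem existsUnique_localPoint {v : HeightOneSpectrum (𝓞 K)} (hv : v ∉ S)
    (P : Point strX (v.adicCompletion K)) :
    ∃! Q : Spec (.of (v.adicCompletionIntegers K)) ⟶ M.total,
      Spec.map (CommRingCat.ofHom
        (algebraMap (v.adicCompletionIntegers K) (v.adicCompletion K))) ≫ Q = P.1 ≫ M.gen ∧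
      Q ≫ M.str = Spec.map (CommRingCat.ofHom (toLocal hv)) := by
  have hc : CommSq (P.1 ≫ M.gen) (Spec.map (CommRingCat.ofHom
      (algebraMap (v.adicCompletionIntegers K) (v.adicCompletion K)))) M.str
      (Spec.map (CommRingCat.ofHom (toLocal hv))) := by
    constructor
    rw [Category.assoc, M.isPullback.w, ← Category.assoc, P.2, ← Spec.map_comp, ← Spec.map_comp]
    rfl
  have h : ValuativeCriterion M.str := by
    have := M.isProper
    rw [IsProper.eq_valuativeCriterion] at this
    exact this.1.1.1
  obtain ⟨⟨⟨l⟩, hl⟩⟩ := h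
    { R := v.adicCompletionIntegers K, K := v.adicCompletion K, i₁ := _, i₂ := _, commSq := hc }
  refine ⟨l.l, ⟨l.fac_left, l.fac_right⟩, fun Q hQ => ?_⟩
  exact congrArg CommSq.LiftStruct.l (hl ⟨Q, hQ.1, hQ.2⟩)

/-- The `𝒪_v`-point of the model extending a given `K_v`-point. -/
def localPoint {v : HeightOneSpectrum (𝓞 K)} (hv : v ∉ S) (P : Point strX (v.adicCompletion K)) :
    Spec (.of (v.adicCompletionIntegers K)) ⟶ M.total :=
  (M.existsUnique_localPoint hv P).choose

/-- The intersection multiplicity `n_v(𝒵, P)`: if `Spec (𝒪_v / I)` is the scheme-theoretic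
intersection of `𝒵` with the `𝒪_v`-point extending `P`, it is the `n` with `I = 𝔪ⁿ`, and `∞` if
`I = 0`. -/
def multiplicity {v : HeightOneSpectrum (𝓞 K)} (hv : v ∉ S) (Z : Closeds M.total)
    (P : Point strX (v.adicCompletion K)) : ℕ∞ :=
  pullbackOrder (M.localPoint hv P) Z (IsLocalRing.closedPoint (v.adicCompletionIntegers K))

/-- The part of the model over `Spec 𝒪_T ⊆ Spec 𝒪_S`, for `S ⊆ T`. -/
def partOver {T : Set (HeightOneSpectrum (𝓞 K))} (hST : S ⊆ T) : Set M.total :=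
  M.str ⁻¹' Set.range (Spec.map (CommRingCat.ofHom
    (Subalgebra.inclusion
      (show S.integer K ≤ T.integer K from fun _ hx v hv => hx v fun h => hv (hST h))).toRingHom))

/-- Over `𝒪_T`, the closure of the rational point `P` does not meet the closure of `Z ⊆ X`. -/
def ClosureAvoids {T : Set (HeightOneSpectrum (𝓞 K))} (hST : S ⊆ T) (P : Point strX K)
    (Z : Set X) : Prop :=
  (M.closure (Set.range P.1) : Set M.total) ∩ M.closure Z ∩ M.partOver hST = ∅

end Model

/-! ### Semi-integral and integral points -/

/-- The two kinds of semi-integral points. -/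
inductive Kind
  | campana
  | darmon

variable {S : Set (HeightOneSpectrum (𝓞 K))} {D : Orbifold K}

/-- The condition on an intersection multiplicity `n ∈ {0, 1, …} ∪ {∞}` with a divisor of finite
weight `m`: either `n ∈ ℤ_{≥ m} ∪ {0, ∞}` (Campana) or `m ∣ n` (Darmon). -/
def Kind.cond : Kind → ℕ∞ → ℕ∞ → Prop
  | .campana, m, n => n = 0 ∨ n = ⊤ ∨ m ≤ n
  | .darmon, m, n => m ∣ n

/-- Local (`v`-adic) Campana, respectively Darmon, points. -/
def IsLocalSemiIntegral (star : Kind) (M : Model S D.str) {v : HeightOneSpectrum (𝓞 K)}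
    (hv : v ∉ S) (P : Point D.str (v.adicCompletion K)) : Prop :=
  (∀ α, D.weight α = ⊤ → M.multiplicity hv (M.closure (D.component α)) P = 0) ∧
  (∀ α, D.weight α ≠ ⊤ → star.cond (D.weight α) (M.multiplicity hv (M.closure (D.component α)) P))

/-- The set `(𝒳, 𝒟)*(𝒪_T)` of Campana, respectively Darmon, points over `𝒪_T`, for `S ⊆ T`. -/
def semiIntegralPoints (star : Kind) (M : Model S D.str) {T : Set (HeightOneSpectrum (𝓞 K))}
    (hST : S ⊆ T) : Set (Point D.str K) :=
  {P | ∀ (v : HeightOneSpectrum (𝓞 K)) (hv : v ∉ T),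
    IsLocalSemiIntegral star M (fun h => hv (hST h)) (P.extend (v.adicCompletion K))}

/-- The set `(𝒳 ∖ 𝒟_red)(𝒪_T)` of integral points of the complement of `𝒟_red`: for every finite
`v ∉ T`, the `𝒪_v`-point extending `P` lies in the complement of `𝒟_red`. -/
def integralPoints (M : Model S D.str) {T : Set (HeightOneSpectrum (𝓞 K))}
    (hST : S ⊆ T) : Set (Point D.str K) :=
  {P | ∀ (v : HeightOneSpectrum (𝓞 K)) (hv : v ∉ T),
    Disjoint
      (Set.range (M.localPoint (fun h => hv (hST h)) (P.extend (v.adicCompletion K))))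
      (M.closure D.red : Set M.total)}

end Models

end SemiIntegral

end

/-! All claims reduce to comparing, for almost all `v`, the multiplicity of `f(Q)` along the closure
of some `D_α` with the multiplicities of `Q` along closures of prime divisors of `Y`. Such
comparisons are consequences of inclusions of ideals on the generic fibres. Suppose that, locally on
`Y ∖ N`, the ideal of `f⁻¹(Z)` lies in the `t`-th power of the ideal of `g⁻¹(W)`. On affine charts
of the models this inclusion concerns finitely many generators, so only finitely many denominators
occur, and these are units at almost all `v`. Hence the multiplicity of `Z` at `f(Q)` is at least
`t` times that of `W` at `g(Q)`, uniformly in the local points `Q` that do not meet the closure of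
`N`: see `exists_eventually_mul_multiplicity_le` near one point, `eventually_of_forall_exists` for
the quasi-compactness argument, and `eventually_mul_multiplicity_le` for the outcome. The morphism
`f` is never extended to the models; at almost all places it is enough that it respects given charts
(`eventually_closedPt_map_mem`).

Off the inverse image of the centre, `f` is a local isomorphism, so `D_α` and its strict transform
have equal multiplicities there. A rational point off the centre lifts to `Y`. If its closure avoids
that of the centre, the lift meets no component of `F` lying over the centre, and at minimal weights
the conditions upstairs are among those downstairs. If the centre misses `D_red`, the multiplicities
agree without restriction on the point, and divisibility at the strict transform, which has
multiplicity one in the pullback, says that `m_α` divides `m'_α`.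

For Campana points, `f⁻¹(D_α)` is a finite union of prime divisors `G`, of finite multiplicities `t`
in the pullback. A point meeting `D_α` meets some `G`, of weight `n`, and then its multiplicity
along `D_α` is at least `t` times that along `G`, hence at least `t n ≥ m_α`
(`eventually_eq_zero_or_exists_component`).

Passing from order `t` at the generic point of `G` to an inclusion in the `t`-th power of its ideal,
and finding the components of `f⁻¹(D_α)`, requires prime divisors to be locally principal. This is
the factoriality of regular local rings (`IsRegularRing.isPrincipal_of_height_eq_one`), obtained
here from finite free resolutions and Nagata's criterion. -/

namespace IsRegularLocalRing

/-! ### Regular local rings are domains. -/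

open IsLocalRing

theorem _root_.WithBot.exists_natCast_eq_of_le {a : WithBot ℕ∞} {n : ℕ} (h0 : a ≠ ⊥)
    (h : a ≤ n) : ∃ m : ℕ, a = m := by
  lift a to ℕ∞ using h0
  have h' : a ≤ n := by exact_mod_cast h
  lift a to ℕ using (h'.trans_lt (ENat.natCast_lt_top n)).ne
  exact ⟨a, rfl⟩

section

variable {A : Type*} [CommRing A] [IsLocalRing A] [IsNoetherianRing A]

/-- An element of `𝔪 ∖ 𝔪²` is part of a minimal system of generators of `𝔪`. -/
theorem exists_minimal_generators_insert {x : A} (hx : x ∈ maximalIdeal A)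
    (hx2 : x ∉ maximalIdeal A ^ 2) :
    ∃ s : Finset A, Ideal.span (insert x (s : Set A)) = maximalIdeal A ∧
      s.card + 1 ≤ (maximalIdeal A).spanFinrank := by
  classical
  let c := (maximalIdeal A).toCotangent
  have hc : Function.Surjective c := Ideal.toCotangent_surjective _
  set v : CotangentSpace A := c ⟨x, hx⟩ with hv
  have hv0 : v ≠ 0 := fun h => hx2 ((Ideal.toCotangent_eq_zero _ _).1 h)
  have hli : LinearIndepOn (ResidueField A) id ({v} : Set (CotangentSpace A)) :=
    LinearIndepOn.singleton (v := id) hv0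
  -- The class of `x` is completed to a basis of the cotangent space; lifts of the other basis
  -- vectors form `s`, and Nakayama's lemma shows that they generate together with `x`.
  obtain ⟨t, hvt, hspan, hlit⟩ : ∃ t : Set (CotangentSpace A), v ∈ t ∧
      Submodule.span (ResidueField A) t = ⊤ ∧ LinearIndepOn (ResidueField A) id t := by
    refine ⟨hli.extend (Set.subset_univ _), hli.subset_extend _ rfl, ?_, hli.linearIndepOn_extend _⟩
    have := hli.span_extend_eq_span (Set.subset_univ _)
    simpa using this
  have htfin : t.Finite := by
    have : Finite t := hlit.linearIndependent.finite
    exact Set.toFinite t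
  have htcard : t.ncard ≤ (maximalIdeal A).spanFinrank := by
    rw [spanFinrank_maximalIdeal_eq_finrank_cotangentSpace]
    have : Fintype t := htfin.fintype
    have := hlit.linearIndependent.fintype_card_le_finrank
    rwa [Set.ncard_eq_toFinset_card', Set.toFinset_card]
  choose σ hσ using hc
  let s : Finset A := (htfin.toFinset.erase v).image (fun w => (σ w : A))
  refine ⟨s, ?_, ?_⟩
  · have hle : Ideal.span (insert x (s : Set A)) ≤ maximalIdeal A := by
      rw [Ideal.span_le, Set.insert_subset_iff]
      refine ⟨hx, ?_⟩
      intro y hy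
      simp only [s, Finset.coe_image, Set.mem_image] at hy
      obtain ⟨w, -, rfl⟩ := hy
      exact (σ w).2
    refine le_antisymm hle ?_
    have key : maximalIdeal A ≤ Ideal.span (insert x (s : Set A)) ⊔
        maximalIdeal A • maximalIdeal A := by
      have hmem : ∀ w ∈ t, ∃ y : maximalIdeal A,
          (y : A) ∈ Ideal.span (insert x (s : Set A)) ∧ c y = w := by
        intro w hw
        by_cases hwv : w = v
        · exact ⟨⟨x, hx⟩, Ideal.subset_span (Set.mem_insert _ _), hwv.symm⟩
        · refine ⟨σ w, Ideal.subset_span (Set.mem_insert_of_mem _ ?_), hσ w⟩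
          simp only [s, Finset.coe_image, Set.mem_image]
          exact ⟨w, by simp [hwv, hw], rfl⟩
      let N : Submodule A (maximalIdeal A) :=
        Submodule.comap (Submodule.subtype (maximalIdeal A)) (Ideal.span (insert x (s : Set A)))
      have hN : N.map c = ⊤ := by
        have h1 : Submodule.span A t ≤ N.map c := by
          rw [Submodule.span_le]
          intro w hw
          obtain ⟨y, hy, hyw⟩ := hmem w hw
          exact ⟨y, hy, hyw⟩
        rw [eq_top_iff]
        refine le_trans ?_ h1
        intro w _
        have : w ∈ (Submodule.span (ResidueField A) t) := hspan ▸ Submodule.mem_top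
        rwa [← Submodule.restrictScalars_mem A, Submodule.restrictScalars_span] at this
        exact residue_surjective
      intro y hy
      have : c ⟨y, hy⟩ ∈ N.map c := hN ▸ Submodule.mem_top
      obtain ⟨z, hz, hzy⟩ := this
      have h2 := (Ideal.toCotangent_eq _).1 hzy
      rw [smul_eq_mul, ← pow_two, show y = z + -((z : A) - y) by ring]
      exact Submodule.add_mem_sup hz (neg_mem h2)
    exact Submodule.le_of_le_smul_of_le_jacobson_bot (IsNoetherian.noetherian _)
      (IsLocalRing.jacobson_eq_maximalIdeal _ bot_ne_top).ge key
  · refine le_trans (Nat.add_le_add_right Finset.card_image_le 1) ?_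
    rw [Finset.card_erase_add_one (by simpa using hvt), ← Set.ncard_eq_toFinset_card t htfin]
    exact htcard

end

variable {A : Type*} [CommRing A] [IsRegularLocalRing A]


/-- The quotient of a regular local ring by an element of `𝔪 ∖ 𝔪²` is regular, of dimension one
less. -/
theorem quotient_span_singleton {x : A} (hx : x ∈ maximalIdeal A) (hx2 : x ∉ maximalIdeal A ^ 2) :
    IsRegularLocalRing (A ⧸ Ideal.span {x}) ∧
      ringKrullDim (A ⧸ Ideal.span {x}) + 1 = ringKrullDim A := by
  classical
  have hne : Ideal.span {x} ≠ ⊤ := Ideal.span_singleton_ne_top hx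
  have : Nontrivial (A ⧸ Ideal.span {x}) := Ideal.Quotient.nontrivial_iff.2 hne
  have : IsLocalRing (A ⧸ Ideal.span {x}) :=
    .of_surjective' (Ideal.Quotient.mk _) Ideal.Quotient.mk_surjective
  obtain ⟨s, hs, hcard⟩ := exists_minimal_generators_insert hx hx2
  have hmax : maximalIdeal (A ⧸ Ideal.span {x}) =
      Ideal.span (s.image (Ideal.Quotient.mk (Ideal.span {x})) : Set _) := by
    have h1 : (maximalIdeal A).map (Ideal.Quotient.mk (Ideal.span {x})) =
        maximalIdeal (A ⧸ Ideal.span {x}) :=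
      map_maximalIdeal_of_surjective _ Ideal.Quotient.mk_surjective
    rw [← h1, ← hs, Ideal.map_span, Set.image_insert_eq, Finset.coe_image,
      Ideal.Quotient.eq_zero_iff_mem.2 (Ideal.mem_span_singleton_self x)]
    simp
  -- The embedding dimension drops by at least one and the Krull dimension by at most one. As the
  -- former bounds the latter in the quotient, and both agree in `A`, all inequalities are
  -- equalities.
  have hle : (maximalIdeal (A ⧸ Ideal.span {x})).spanFinrank + 1 ≤ (maximalIdeal A).spanFinrank := by
    refine le_trans (Nat.add_le_add_right ?_ 1) hcard
    rw [hmax]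
    refine (Submodule.spanFinrank_span_le_ncard_of_finite (Finset.finite_toSet _)).trans ?_
    rw [Set.ncard_coe_finset]
    exact Finset.card_image_le
  have hdim := spanFinrank_maximalIdeal (R := A)
  have h1 : ringKrullDim A ≤ ringKrullDim (A ⧸ Ideal.span {x}) + 1 := by
    have := Ideal.height_le_ringKrullDim_quotient_add_one hx
    rwa [maximalIdeal_height_eq_ringKrullDim] at this
  have h2 := ringKrullDim_le_spanFinrank_maximalIdeal (A ⧸ Ideal.span {x})
  have h3 : ringKrullDim (A ⧸ Ideal.span {x}) ≠ ⊥ := ringKrullDim_ne_bot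
  obtain ⟨n, hn⟩ : ∃ n : ℕ, ringKrullDim (A ⧸ Ideal.span {x}) = n :=
    WithBot.exists_natCast_eq_of_le (n := (maximalIdeal (A ⧸ Ideal.span {x})).spanFinrank) h3 h2
  rw [hn] at h1 h2 ⊢
  rw [← hdim] at h1 ⊢
  norm_cast at h1 h2 ⊢
  refine ⟨of_spanFinrank_maximalIdeal_le _ ?_, by omega⟩
  rw [hn]
  norm_cast
  omega

/-- Prime avoidance, which tolerates the non-prime ideal `𝔪²`: otherwise `𝔪 ⊆ 𝔪²`, and `𝔪 = 0` by
Nakayama, or `𝔪` is a minimal prime. Both contradict positive dimension. -/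
theorem exists_mem_maximalIdeal_notMem {n : ℕ} (hn : ringKrullDim A = n + 1) :
    ∃ x ∈ maximalIdeal A, x ∉ maximalIdeal A ^ 2 ∧ ∀ p ∈ minimalPrimes A, x ∉ p := by
  classical
  by_contra! H
  have hm : maximalIdeal A ≠ ⊥ := by
    intro h
    have := (isField_iff_maximalIdeal_eq).2 h
    have := ringKrullDim_eq_zero_of_isField this
    rw [this] at hn
    norm_cast at hn
  have hsub : (maximalIdeal A : Set A) ⊆
      ⋃ p ∈ insert (maximalIdeal A ^ 2) (minimalPrimes A), (p : Set A) := by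
    intro x hx
    simp only [Set.mem_iUnion]
    by_cases h2 : x ∈ maximalIdeal A ^ 2
    · exact ⟨_, Set.mem_insert _ _, h2⟩
    · obtain ⟨p, hp, hxp⟩ := H x hx h2
      exact ⟨p, Set.mem_insert_of_mem _ hp, hxp⟩
  rw [Ideal.subset_union_prime_finite ((minimalPrimes.finite_of_isNoetherianRing A).insert _)
    (maximalIdeal A ^ 2) (maximalIdeal A ^ 2)] at hsub
  · obtain ⟨p, hp, hle⟩ := hsub
    rcases hp with rfl | hp
    · refine hm (Submodule.eq_bot_of_le_smul_of_le_jacobson_bot (maximalIdeal A) _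
        (IsNoetherian.noetherian _) (by rwa [smul_eq_mul, ← pow_two])
        (IsLocalRing.jacobson_eq_maximalIdeal _ bot_ne_top).ge)
    · have hpp : p.IsPrime := hp.1.1
      have hpm : p = maximalIdeal A := le_antisymm (le_maximalIdeal hpp.ne_top) hle
      have h0 : p.height = 0 := Ideal.height_eq_zero_iff.2 hp
      have := maximalIdeal_height_eq_ringKrullDim (R := A)
      rw [← hpm, h0, hn] at this
      norm_cast at this
  · intro i hi h1 h2
    rcases hi with rfl | hi
    · exact absurd rfl h1
    · exact hi.1.1

/-- A regular local ring is a domain. -/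
theorem isDomain : IsDomain A := by
  obtain ⟨n, hn⟩ : ∃ n : ℕ, ringKrullDim A = n := ⟨_, (spanFinrank_maximalIdeal (R := A)).symm⟩
  induction n generalizing A with
  | zero =>
    have h := spanFinrank_maximalIdeal (R := A)
    rw [hn] at h
    norm_cast at h
    have h2 : maximalIdeal A = ⊥ := by
      rwa [Submodule.spanFinrank_eq_zero_iff_eq_bot (IsNoetherian.noetherian _)] at h
    exact (isField_iff_maximalIdeal_eq.2 h2).isDomain
  | succ n ih =>
    obtain ⟨x, hx, hx2, hxp⟩ := exists_mem_maximalIdeal_notMem hn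
    obtain ⟨hreg, hdim⟩ := quotient_span_singleton hx hx2
    have hdom : IsDomain (A ⧸ Ideal.span {x}) := ih (by
      rw [hn, Nat.cast_succ] at hdim
      exact ENat.WithBot.add_natCast_cancel.mp hdim)
    have hprime : (Ideal.span {x}).IsPrime := (Ideal.Quotient.isDomain_iff_prime _).1 hdom
    obtain ⟨q, hq, hqx⟩ := Ideal.exists_minimalPrimes_le (I := ⊥) (J := Ideal.span {x}) bot_le
    have hqp : q.IsPrime := hq.1.1
    -- An element of `q` has the form `a x` with `x ∉ q`, so `a ∈ q`. Thus `q ⊆ 𝔪 q`, and `q`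
    -- vanishes by Nakayama.
    have hq0 : q = ⊥ := by
      refine Submodule.eq_bot_of_le_smul_of_le_jacobson_bot (maximalIdeal A) _
        (IsNoetherian.noetherian _) ?_ (IsLocalRing.jacobson_eq_maximalIdeal _ bot_ne_top).ge
      intro y hy
      obtain ⟨a, rfl⟩ := Ideal.mem_span_singleton'.1 (hqx hy)
      have : a ∈ q := (hqp.mem_or_mem hy).resolve_right (hxp q hq)
      rw [mul_comm]
      exact Submodule.smul_mem_smul hx this
    have hbot : (⊥ : Ideal A).IsPrime := hq0 ▸ hqp
    exact IsDomain.of_bot_isPrime A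

end IsRegularLocalRing

/-! ### Finite free resolutions. -/

/-- Modules with a finite resolution by finite free modules. -/
inductive HasFiniteFreeResolution (R : Type u) [CommRing R] :
    ∀ (M : Type u) [AddCommGroup M] [Module R M], Prop
  | free (M : Type u) [AddCommGroup M] [Module R M] [Module.Free R M] [Module.Finite R M] :
      HasFiniteFreeResolution R M
  | step (N F M : Type u) [AddCommGroup N] [Module R N] [AddCommGroup F] [Module R F]
      [AddCommGroup M] [Module R M] [Module.Free R F] [Module.Finite R F] (i : N →ₗ[R] F)
      (p : F →ₗ[R] M) (hi : Function.Injective i) (hip : Function.Exact i p)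
      (hp : Function.Surjective p) (h : HasFiniteFreeResolution R N) :
      HasFiniteFreeResolution R M

namespace HasFiniteFreeResolution

section

variable {R : Type u} [CommRing R]

theorem of_linearMap {F M : Type u} [AddCommGroup F] [Module R F]
    [AddCommGroup M] [Module R M] [Module.Free R F] [Module.Finite R F]
    (p : F →ₗ[R] M) (hp : Function.Surjective p)
    (h : HasFiniteFreeResolution R (LinearMap.ker p)) : HasFiniteFreeResolution R M :=
  step _ F M (LinearMap.ker p).subtype p Subtype.val_injective
    (LinearMap.exact_subtype_ker_map p) hp h

/-- Localization is exact and keeps finite free modules finite free. It turns a resolution of a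
prime of a local ring `A` into one of its extension to `A_x`, which need not be local. -/
theorem localizedModule (S : Submonoid R) {M : Type u} [AddCommGroup M] [Module R M]
    (h : HasFiniteFreeResolution R M) :
    HasFiniteFreeResolution (Localization S) (LocalizedModule S M) := by
  induction h with
  | free M =>
    have : Module.Free (Localization S) (LocalizedModule S M) :=
      Module.free_of_isLocalizedModule S (LocalizedModule.mkLinearMap S M)
    exact free _
  | step N F M i p hi hip hp h ih =>
    have : Module.Free (Localization S) (LocalizedModule S F) :=
      Module.free_of_isLocalizedModule S (LocalizedModule.mkLinearMap S F)
    exact step _ _ _ (LocalizedModule.map S i) (LocalizedModule.map S p)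
      (LocalizedModule.map_injective S i hi) (LocalizedModule.map_exact S i p hip)
      (LocalizedModule.map_surjective S p hp) ih

theorem congr {M M' : Type u} [AddCommGroup M] [Module R M] [AddCommGroup M'] [Module R M']
    (e : M ≃ₗ[R] M') (h : HasFiniteFreeResolution R M) : HasFiniteFreeResolution R M' := by
  cases h with
  | free =>
    have := Module.Free.of_equiv e
    have := Module.Finite.equiv e
    exact free _
  | step N F M i p hi hip hp h =>
    exact step N F M' i (e.toLinearMap ∘ₗ p) hi
      (hip.comp_injective (e : M → M') e.injective (map_zero e)) (e.surjective.comp hp) h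

theorem _root_.Module.Free.exists_linearEquiv_fin (R F : Type*) [CommRing R] [AddCommGroup F]
    [Module R F] [Module.Free R F] [Module.Finite R F] :
    ∃ k : ℕ, Nonempty (F ≃ₗ[R] (Fin k → R)) :=
  ⟨_, ⟨(Module.Free.chooseBasis R F).equivFun.trans
    (LinearEquiv.funCongrLeft R R (Fintype.equivFin _).symm)⟩⟩

/-- A projective module with a finite free resolution is stably free. -/
theorem exists_prod_equiv {M : Type u} [AddCommGroup M] [Module R M]
    (h : HasFiniteFreeResolution R M) (hM : Module.Projective R M) :
    ∃ m n : ℕ, Nonempty ((M × (Fin m → R)) ≃ₗ[R] (Fin n → R)) := by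
  induction h with
  | free M =>
    obtain ⟨k, ⟨e⟩⟩ := Module.Free.exists_linearEquiv_fin R M
    exact ⟨0, k, ⟨LinearEquiv.prodUnique.trans e⟩⟩
  | step N F M i p hi hip hp h ih =>
    obtain ⟨s, hs⟩ := Module.projective_lifting_property p LinearMap.id hp
    have hs' : ∀ m, p (s m) = m := fun m => LinearMap.congr_fun hs m
    obtain ⟨e⟩ : Nonempty ((M × N) ≃ₗ[R] F) := by
      refine ⟨LinearEquiv.ofBijective (s.coprod i) ⟨?_, ?_⟩⟩
      · rw [← LinearMap.ker_eq_bot, LinearMap.ker_eq_bot']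
        rintro ⟨a, b⟩ hab
        rw [LinearMap.coprod_apply] at hab
        have h1 := congrArg p hab
        rw [map_add, hs', hip.apply_apply_eq_zero, add_zero, map_zero] at h1
        subst h1
        rw [map_zero, zero_add] at hab
        obtain rfl : b = 0 := (map_eq_zero_iff i hi).1 hab
        rfl
      · intro f
        obtain ⟨b, hb⟩ := (hip (f - s (p f))).1 (by rw [map_sub, hs', sub_self])
        exact ⟨(p f, b), by rw [LinearMap.coprod_apply, hb]; abel⟩
    have hN : Module.Projective R N := by
      have : Module.Projective R (M × N) := Module.Projective.of_equiv e.symm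
      exact Module.Projective.of_split (LinearMap.inr R M N) (LinearMap.snd R M N)
        (LinearMap.snd_comp_inr R M N)
    obtain ⟨m, n, ⟨e'⟩⟩ := ih hN
    obtain ⟨k, ⟨eF⟩⟩ := Module.Free.exists_linearEquiv_fin R F
    -- `M ⊕ Rⁿ ≅ M ⊕ N ⊕ Rᵐ ≅ F ⊕ Rᵐ ≅ Rᵏ⁺ᵐ`.
    refine ⟨n, k + m, ⟨?_⟩⟩
    exact (((LinearEquiv.refl R M).prodCongr e'.symm).trans
      (LinearEquiv.prodAssoc R M N (Fin m → R)).symm).trans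
      (((e.trans eF).prodCongr (LinearEquiv.refl R _)).trans
        ((LinearEquiv.sumArrowLequivProdArrow _ _ R R).symm.trans
          (LinearEquiv.funCongrLeft R R finSumFinEquiv.symm)))

end

section

variable {A : Type u} [CommRing A] [IsLocalRing A] [IsNoetherianRing A]

-- One step of lifting a resolution from `A/x` to `A`. The semilinear map `r` identifies `M'` with
-- `N/xN`. Lifting the images of a basis of `F'` gives a map onto `N` by Nakayama, and the
-- regularity of `x` on `N` makes its kernel reduce modulo `x` exactly to the kernel of `p`.
omit [IsNoetherianRing A] in
theorem exists_lift_of_quotient {x : A} (hx : x ∈ IsLocalRing.maximalIdeal A)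
    {N F' M' : Type u} [AddCommGroup N] [Module A N] [Module.Finite A N]
    [AddCommGroup F'] [Module (A ⧸ Ideal.span {x}) F'] [Module.Free (A ⧸ Ideal.span {x}) F']
    [Module.Finite (A ⧸ Ideal.span {x}) F'] [AddCommGroup M'] [Module (A ⧸ Ideal.span {x}) M']
    (hN : IsSMulRegular N x) (r : N →ₛₗ[Ideal.Quotient.mk (Ideal.span {x})] M')
    (hr : Function.Surjective r) (hr0 : ∀ n, r n = 0 → ∃ n', n = x • n')
    (p : F' →ₗ[A ⧸ Ideal.span {x}] M') (hp : Function.Surjective p) :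
    ∃ (k : ℕ) (π : (Fin k → A) →ₗ[A] N), Function.Surjective π ∧
      ∃ r' : LinearMap.ker π →ₛₗ[Ideal.Quotient.mk (Ideal.span {x})] LinearMap.ker p,
        Function.Surjective r' ∧ ∀ n, r' n = 0 → ∃ n', n = x • n' := by
  have : Nontrivial (A ⧸ Ideal.span {x}) :=
    Ideal.Quotient.nontrivial_iff.2 (Ideal.span_singleton_ne_top hx)
  let k := Module.finrank (A ⧸ Ideal.span {x}) F'
  let b := Module.finBasis (A ⧸ Ideal.span {x}) F'
  choose n hn using fun i => hr (p (b i))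
  let q : (Fin k → A) →ₛₗ[Ideal.Quotient.mk (Ideal.span {x})] F' :=
    { toFun v := ∑ i, Ideal.Quotient.mk (Ideal.span {x}) (v i) • b i
      map_add' v w := by simp [add_smul, Finset.sum_add_distrib]
      map_smul' a v := by simp [mul_smul, Finset.smul_sum] }
  let π : (Fin k → A) →ₗ[A] N := Fintype.linearCombination A n
  have hπ : ∀ v, r (π v) = p (q v) := by
    intro v
    simp [π, q, Fintype.linearCombination_apply, hn]
  have hqs : Function.Surjective q := by
    intro f
    choose v hv using fun i => Ideal.Quotient.mk_surjective (I := Ideal.span {x}) (b.repr f i)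
    refine ⟨v, ?_⟩
    simp only [q, LinearMap.coe_mk, AddHom.coe_mk, hv]
    exact b.sum_repr f
  have hq0 : ∀ v, q v = 0 → ∃ v', v = x • v' := by
    intro v hv
    have h1 := Fintype.linearIndependent_iff.1 b.linearIndependent _ hv
    choose w hw using fun i => Ideal.mem_span_singleton'.1 (Ideal.Quotient.eq_zero_iff_mem.1 (h1 i))
    exact ⟨w, funext fun i => by rw [← hw i, Pi.smul_apply, smul_eq_mul, mul_comm]⟩
  have hsurj : Function.Surjective π := by
    rw [← LinearMap.range_eq_top, eq_top_iff]
    refine Submodule.le_of_le_smul_of_le_jacobson_bot (I := Ideal.span {x})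
      (Module.finite_def.1 inferInstance) ?_ ?_
    · rw [IsLocalRing.jacobson_eq_maximalIdeal _ bot_ne_top, Ideal.span_le]
      simpa using hx
    · intro y _
      obtain ⟨f, hf⟩ := hp (r y)
      obtain ⟨v, rfl⟩ := hqs f
      obtain ⟨y', hy'⟩ := hr0 (y - π v) (by rw [map_sub, hπ, hf, sub_self])
      rw [show y = π v + x • y' by rw [← hy']; abel]
      exact Submodule.add_mem_sup ⟨v, rfl⟩
        (Submodule.smul_mem_smul (Ideal.mem_span_singleton_self x) trivial)
  refine ⟨k, π, hsurj, ?_⟩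
  refine ⟨{ toFun := fun v => ⟨q v, by
              rw [LinearMap.mem_ker, ← hπ, LinearMap.mem_ker.1 v.2, map_zero]⟩
            map_add' := fun v w => by ext; simp
            map_smul' := fun a v => by ext; simp }, ?_, ?_⟩
  · rintro ⟨f, hf⟩
    obtain ⟨v, rfl⟩ := hqs f
    obtain ⟨y, hy⟩ := hr0 (π v) (by rw [hπ, LinearMap.mem_ker.1 hf])
    obtain ⟨w, rfl⟩ := hsurj y
    refine ⟨⟨v - x • w, by rw [LinearMap.mem_ker, map_sub, hy, map_smul, sub_self]⟩, ?_⟩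
    ext
    have : Ideal.Quotient.mk (Ideal.span {x}) x = 0 :=
      Ideal.Quotient.eq_zero_iff_mem.2 (Ideal.mem_span_singleton_self x)
    simp [this]
  · rintro ⟨v, hv⟩ h0
    obtain ⟨w, rfl⟩ := hq0 v (congrArg Subtype.val h0)
    refine ⟨⟨w, ?_⟩, rfl⟩
    rw [LinearMap.mem_ker, map_smul] at hv
    exact hN (by simpa using hv)

/-- A resolution of `N/xN` over `A/x` lifts to one of `N`, step by step. After the first step, the
modules concerned are submodules of free modules, so `x` remains regular on them. -/
theorem of_quotient_span_singleton {x : A} (hx : x ∈ IsLocalRing.maximalIdeal A)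
    (hxA : IsSMulRegular A x)
    {M' : Type u} [AddCommGroup M'] [Module (A ⧸ Ideal.span {x}) M']
    (h : HasFiniteFreeResolution (A ⧸ Ideal.span {x}) M') (N : Type u) [AddCommGroup N]
    [Module A N] [Module.Finite A N]
    (hN : IsSMulRegular N x) (r : N →ₛₗ[Ideal.Quotient.mk (Ideal.span {x})] M')
    (hr : Function.Surjective r) (hr0 : ∀ n, r n = 0 → ∃ n', n = x • n') :
    HasFiniteFreeResolution A N := by
  have hker : ∀ {k : ℕ} (π : (Fin k → A) →ₗ[A] N), IsSMulRegular (LinearMap.ker π) x := by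
    intro k π v w hvw
    ext i
    exact hxA (congrFun (congrArg Subtype.val hvw) i)
  induction h generalizing N with
  | free M' =>
    obtain ⟨k, π, hπ, r', hr', hr0'⟩ := exists_lift_of_quotient hx hN r hr hr0 LinearMap.id
      Function.surjective_id
    refine of_linearMap π hπ ?_
    -- The kernel `C` of `π` reduces to the kernel of the identity, so `C = x C`, and Nakayama gives
    -- `C = 0`: here `N` is free itself.
    have hbot : (⊤ : Submodule A (LinearMap.ker π)) = ⊥ := by
      refine Submodule.eq_bot_of_le_smul_of_le_jacobson_bot (Ideal.span {x}) _
        (Module.finite_def.1 inferInstance) ?_ ?_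
      · intro v _
        have hz : r' v = 0 := Subtype.ext (r' v).2
        obtain ⟨w, rfl⟩ := hr0' v hz
        exact Submodule.smul_mem_smul (Ideal.mem_span_singleton_self x) trivial
      · rw [IsLocalRing.jacobson_eq_maximalIdeal _ bot_ne_top, Ideal.span_le]
        simpa using hx
    have : Subsingleton (LinearMap.ker π) := by
      rw [← Submodule.subsingleton_iff A]
      exact subsingleton_of_bot_eq_top hbot.symm
    exact free _
  | step N' F' M' i p hi hip hp h ih =>
    obtain ⟨k, π, hπ, r', hr', hr0'⟩ := exists_lift_of_quotient hx hN r hr hr0 p hp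
    let e : LinearMap.ker p ≃ₗ[A ⧸ Ideal.span {x}] N' :=
      (LinearEquiv.ofEq _ _ (LinearMap.exact_iff.1 hip)).trans (LinearEquiv.ofInjective i hi).symm
    refine of_linearMap π hπ (ih (LinearMap.ker π) (hker π) (e.toLinearMap.comp r')
      (e.surjective.comp hr') (fun v hv => hr0' v (e.injective (by simpa using hv))) ?_)
    intro k π' v w hvw
    ext i
    exact hxA (congrFun (congrArg Subtype.val hvw) i)

end

/-- Finite modules over regular local rings have finite free resolutions. -/
theorem of_isRegularLocalRing {A : Type u} [CommRing A] [IsRegularLocalRing A] (M : Type u)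
    [AddCommGroup M] [Module A M] [Module.Finite A M] : HasFiniteFreeResolution A M := by
  revert M
  obtain ⟨n, hn⟩ : ∃ n : ℕ, ringKrullDim A = n :=
    ⟨_, (IsRegularLocalRing.spanFinrank_maximalIdeal (R := A)).symm⟩
  induction n generalizing A with
  | zero =>
    intro M _ _ _
    have h := IsRegularLocalRing.spanFinrank_maximalIdeal (R := A)
    rw [hn] at h
    norm_cast at h
    have h2 : IsLocalRing.maximalIdeal A = ⊥ := by
      rwa [Submodule.spanFinrank_eq_zero_iff_eq_bot (IsNoetherian.noetherian _)] at h
    have : Module.Free A M :=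
      let := (IsLocalRing.isField_iff_maximalIdeal_eq.2 h2).toField
      Module.Free.of_divisionRing A M
    exact free M
  | succ n ih =>
    intro M _ _ _
    have := IsRegularLocalRing.isDomain (A := A)
    obtain ⟨x, hx, hx2, hxp⟩ := IsRegularLocalRing.exists_mem_maximalIdeal_notMem hn
    obtain ⟨hreg, hdim⟩ := IsRegularLocalRing.quotient_span_singleton hx hx2
    have hdim' : ringKrullDim (A ⧸ Ideal.span {x}) = n := by
      rw [hn, Nat.cast_succ] at hdim
      exact ENat.WithBot.add_natCast_cancel.mp hdim
    have hx0 : x ≠ 0 := fun h => hx2 (h ▸ zero_mem _)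
    have hxA : IsSMulRegular A x := fun a b hab => mul_left_cancel₀ hx0 hab
    obtain ⟨k, p, hp⟩ := Module.Finite.exists_fin' A M
    -- `M` may have `x`-torsion, but its first syzygy lies in a free module over a domain, so the
    -- lifting result applies to the syzygy.
    refine of_linearMap p hp ?_
    have hreg : IsSMulRegular (LinearMap.ker p) x := by
      intro v w hvw
      ext i
      exact hxA (congrFun (congrArg Subtype.val hvw) i)
    have : Module.Finite (A ⧸ Ideal.span {x}) (QuotSMulTop x (LinearMap.ker p)) :=
      Module.Finite.of_restrictScalars_finite A _ _
    refine of_quotient_span_singleton hx hxA (ih hdim' (QuotSMulTop x (LinearMap.ker p))) _ hreg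
      { toFun := Submodule.mkQ _
        map_add' := map_add _
        map_smul' := fun a v => rfl } (Submodule.mkQ_surjective _) ?_
    intro v hv
    have : v ∈ _ := (Submodule.Quotient.mk_eq_zero _).1 hv
    obtain ⟨w, -, hw⟩ := (Submodule.mem_smul_pointwise_iff_exists _ _ _).1 this
    exact ⟨w, hw.symm⟩

end HasFiniteFreeResolution

/-! ### Factoriality of regular local rings. -/

theorem Ideal.projective_of_isPrincipal {R : Type*} [CommRing R] [IsDomain R] (I : Ideal R)
    [hI : I.IsPrincipal] : Module.Projective R I := by
  obtain ⟨a, rfl⟩ := hI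
  by_cases ha : a = 0
  · subst ha
    have : Subsingleton (Submodule.span R {(0 : R)}) := by simp; infer_instance
    infer_instance
  · exact Module.Projective.of_equiv (LinearEquiv.toSpanNonzeroSingleton R R a ha)

/-- A stably free ideal of a domain is principal. -/
theorem Ideal.isPrincipal_of_prod_equiv {R : Type*} [CommRing R] [IsDomain R] (P : Ideal R)
    {m n : ℕ} (e : (P × (Fin m → R)) ≃ₗ[R] (Fin n → R)) : P.IsPrincipal := by
  classical
  by_cases hP : P = ⊥
  · exact hP ▸ bot_isPrincipal
  obtain ⟨p₀, hp₀, hp₀0⟩ := Submodule.exists_mem_ne_zero_of_ne_bot hP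
  let ι : (P × (Fin m → R)) →ₗ[R] (R × (Fin m → R)) :=
    P.subtype.prodMap LinearMap.id
  have hι : Function.Injective ι := Function.Injective.prodMap Subtype.val_injective
    Function.injective_id
  let c : (R × (Fin m → R)) ≃ₗ[R] (Fin (m + 1) → R) := Fin.consLinearEquiv R (fun _ => R)
  let μ (p : P) : (R × (Fin m → R)) →ₗ[R] (P × (Fin m → R)) :=
    (LinearMap.toSpanSingleton R P p).prodMap LinearMap.id
  -- A non-zero ideal has rank one: it embeds in `R`, and multiplication by a non-zero `p₀ ∈ P`
  -- embeds `R` in it.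
  have hn : n = m + 1 := by
    apply le_antisymm
    · have := (c.toLinearMap ∘ₗ ι ∘ₗ e.symm.toLinearMap).finrank_le_finrank_of_injective
        (c.injective.comp (hι.comp e.symm.injective))
      simpa using this
    · have hμ : Function.Injective (μ ⟨p₀, hp₀⟩) := by
        have h1 : Function.Injective (LinearMap.toSpanSingleton R P ⟨p₀, hp₀⟩) := by
          intro a b hab
          simpa [hp₀0] using congrArg Subtype.val hab
        exact Function.Injective.prodMap h1 Function.injective_id
      have := (e.toLinearMap ∘ₗ μ ⟨p₀, hp₀⟩ ∘ₗ c.symm.toLinearMap).finrank_le_finrank_of_injective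
        (e.injective.comp (hμ.comp c.symm.injective))
      simpa using this
  subst hn
  -- `φ` is the composite `Rᵐ⁺¹ ≅ P ⊕ Rᵐ ⊆ R ⊕ Rᵐ = Rᵐ⁺¹`, and its determinant generates `P`. For `p
  -- ∈ P`, the matrix `diag(p, 1, …, 1)` factors through `φ`, so `det φ` divides `p`.
  let φ : (Fin (m + 1) → R) →ₗ[R] (Fin (m + 1) → R) :=
    c.toLinearMap ∘ₗ ι ∘ₗ e.symm.toLinearMap
  refine ⟨LinearMap.det φ, le_antisymm ?_ ?_⟩
  · intro p hp
    let u : (Fin (m + 1) → R) →ₗ[R] (Fin (m + 1) → R) :=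
      e.toLinearMap ∘ₗ μ ⟨p, hp⟩ ∘ₗ c.symm.toLinearMap
    have h1 : φ ∘ₗ u = Matrix.toLin' (Matrix.diagonal (Fin.cons p fun _ => 1)) := by
      have hc : ∀ v : Fin (m + 1) → R, φ (u v) = Fin.cons (v 0 * p) (Fin.tail v) := by
        intro v
        simp [φ, u, ι, μ, c, Fin.tail_def]
        rfl
      refine LinearMap.ext fun v => ?_
      rw [LinearMap.comp_apply, hc]
      ext i
      refine Fin.cases ?_ (fun i => ?_) i
      · simp [Matrix.mulVec_diagonal, mul_comm]
      · simp [Matrix.mulVec_diagonal, Fin.tail_def]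
    have h2 := congrArg LinearMap.det h1
    rw [LinearMap.det_comp, LinearMap.det_toLin', Matrix.det_diagonal, Fin.prod_univ_succ] at h2
    simp only [Fin.cons_zero, Fin.cons_succ, Finset.prod_const_one, mul_one] at h2
    exact Ideal.mem_span_singleton.2 ⟨_, h2.symm⟩
  -- Conversely, `φ ∘ adj φ = det φ` puts `det φ` times the first basis vector in the image of `φ`,
  -- whose first coordinates lie in `P`.
  · refine (Ideal.span_singleton_le_iff_mem _).2 ?_
    let A := LinearMap.toMatrix' φ
    have h1 : φ (Matrix.toLin' A.adjugate (Pi.single 0 1)) = Pi.single 0 (LinearMap.det φ) := by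
      have : φ = Matrix.toLin' A := (Matrix.toLin'_toMatrix' φ).symm
      rw [← LinearMap.det_toMatrix']
      conv_lhs => rw [this]
      rw [← LinearMap.comp_apply, ← Matrix.toLin'_mul, Matrix.mul_adjugate]
      ext i
      simp [A, Pi.single_apply]
    have h2 : φ (Matrix.toLin' A.adjugate (Pi.single 0 1)) 0 ∈ P :=
      (e.symm _).1.2
    rw [h1] at h2
    simpa using h2

theorem IsRegularRing.of_isLocalization {A : Type u} [CommRing A] [IsRegularRing A]
    (M : Submonoid A) (S : Type u) [CommRing S] [Algebra A S] [IsLocalization M S] :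
    IsRegularRing S := by
  have := IsLocalization.isNoetherianRing M S inferInstance
  refine isRegularRing_iff.2 fun P hP => ?_
  have : IsLocalization.AtPrime (Localization.AtPrime P) (P.under A) :=
    IsLocalization.isLocalization_isLocalization_atPrime_isLocalization M _ P
  exact IsRegularLocalRing.of_ringEquiv (IsLocalization.algEquiv (P.under A).primeCompl
    (Localization.AtPrime (P.under A)) (Localization.AtPrime P)).toRingEquiv

open IsLocalRing in
/-- A regular local ring (all of whose localizations are regular) is factorial. -/
theorem IsRegularRing.isPrincipal_of_height_eq_one {A : Type u} [CommRing A] [IsRegularRing A]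
    [IsLocalRing A] (p : Ideal A) [p.IsPrime] (hp : p.height = 1) : p.IsPrincipal := by
  have := IsRegularLocalRing.of_isRegularRing_of_isLocalRing A
  obtain ⟨n, hn⟩ : ∃ n : ℕ, ringKrullDim A ≤ n :=
    ⟨_, (IsRegularLocalRing.spanFinrank_maximalIdeal (R := A)).ge⟩
  induction n using Nat.strong_induction_on generalizing A with
  | _ n ih =>
  have := IsRegularLocalRing.isDomain (A := A)
  obtain ⟨d, hd⟩ : ∃ d : ℕ, ringKrullDim A = d + 1 := by
    have h := IsRegularLocalRing.spanFinrank_maximalIdeal (R := A)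
    have hpos : (1 : WithBot ℕ∞) ≤ ringKrullDim A := by
      have := Ideal.height_le_ringKrullDim_of_ne_top (I := p) ‹p.IsPrime›.ne_top
      rwa [hp] at this
    rw [← h] at hpos
    have hpos' : 1 ≤ (maximalIdeal A).spanFinrank := by exact_mod_cast hpos
    refine ⟨(maximalIdeal A).spanFinrank - 1, ?_⟩
    rw [← h]
    norm_cast
    omega
  obtain ⟨x, hx, hx2, -⟩ := IsRegularLocalRing.exists_mem_maximalIdeal_notMem hd
  obtain ⟨hreg, -⟩ := IsRegularLocalRing.quotient_span_singleton hx hx2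
  have hdom := IsRegularLocalRing.isDomain (A := A ⧸ Ideal.span {x})
  have hx0 : x ≠ 0 := fun h => hx2 (h ▸ zero_mem _)
  have hprime : Prime x :=
    (Ideal.span_singleton_prime hx0).1 ((Ideal.Quotient.isDomain_iff_prime _).1 hdom)
  by_cases hxp : x ∈ p
  · exact ⟨x, p.eq_span_singleton_of_height_eq_one hp hxp hprime⟩
  -- Nagata's criterion: as `x` is prime and not in `p`, it suffices to treat `P = p A_x`. This
  -- ideal is principal in every local ring of `A_x` by induction, hence projective; it has a finite
  -- free resolution, hence is stably free; and stably free ideals of a domain are principal.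
  refine p.isPrincipal_of_isPrincipal_localizationAway_of_prime hprime hxp ?_
  let S := Localization.Away x
  let P : Ideal S := p.map (algebraMap A S)
  have hSdom : IsDomain S := IsLocalization.Away.isDomain S hx0
  have hSreg : IsRegularRing S := IsRegularRing.of_isLocalization (Submonoid.powers x) S
  have hfp : Module.FinitePresentation S P := by
    have : IsNoetherianRing S := inferInstance
    exact Module.finitePresentation_of_finite S P
  have hproj : Module.Projective S P := by
    refine Module.projective_of_localization_maximal'
      (fun I _ => Localization.AtPrime I) (fun I _ => P.map (algebraMap S (Localization.AtPrime I)))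
      (fun I _ => Algebra.idealMap (Localization.AtPrime I) P) ?_
    intro I hI
    have hIreg : IsRegularRing (Localization.AtPrime I) :=
      IsRegularRing.of_isLocalization I.primeCompl _
    have hprin : (P.map (algebraMap S (Localization.AtPrime I))).IsPrincipal := by
      have hdisj := (Ideal.disjoint_powers_iff_notMem_of_isPrime x).2 hxp
      have hPprime : P.IsPrime :=
        IsLocalization.isPrime_of_isPrime_disjoint (Submonoid.powers x) S p ‹_› hdisj
      have hPheight : P.height = 1 := by
        rw [← IsLocalization.height_under (Submonoid.powers x),
          IsLocalization.under_map_of_isPrime_disjoint (Submonoid.powers x) S ‹_› hdisj, hp]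
      by_cases hPI : P ≤ I
      · have hdisj' : Disjoint (I.primeCompl : Set S) P :=
          Set.disjoint_left.2 fun a ha haP => ha (hPI haP)
        have hprime' := IsLocalization.isPrime_of_isPrime_disjoint I.primeCompl
          (Localization.AtPrime I) P hPprime hdisj'
        have hheight' : (P.map (algebraMap S (Localization.AtPrime I))).height = 1 := by
          rw [← IsLocalization.height_under I.primeCompl,
            IsLocalization.under_map_of_isPrime_disjoint I.primeCompl _ hPprime hdisj', hPheight]
        -- Primes of `A_x` contract to primes not containing `x`, which are strictly smaller than
        -- `𝔪`. This is why the dimension drops and the induction applies.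
        have hlt : I.under A < maximalIdeal A := by
          refine lt_of_le_of_ne (le_maximalIdeal Ideal.IsPrime.ne_top') fun h => ?_
          have hxI : algebraMap A S x ∈ I := Ideal.mem_comap.1 (h.ge hx)
          exact hI.ne_top (Ideal.eq_top_of_isUnit_mem _ hxI
            (IsLocalization.Away.algebraMap_isUnit x))
        have hdim : ringKrullDim (Localization.AtPrime I) < ringKrullDim A := by
          rw [IsLocalization.AtPrime.ringKrullDim_eq_height I,
            ← IsLocalization.height_under (Submonoid.powers x) I,
            ← maximalIdeal_height_eq_ringKrullDim]
          exact_mod_cast Ideal.height_strict_mono_of_isPrime hlt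
        have hreg' := IsRegularLocalRing.of_isRegularRing_of_isLocalRing (Localization.AtPrime I)
        have hk := IsRegularLocalRing.spanFinrank_maximalIdeal (R := Localization.AtPrime I)
        rw [← hk] at hdim
        have hlt' : (maximalIdeal (Localization.AtPrime I)).spanFinrank < n := by
          exact_mod_cast hdim.trans_le hn
        exact ih _ hlt' _ hheight' hreg' hk.ge
      · have : P.map (algebraMap S (Localization.AtPrime I)) = ⊤ := by
          obtain ⟨a, haP, haI⟩ := Set.not_subset.1 hPI
          exact Ideal.eq_top_of_isUnit_mem _ (Ideal.mem_map_of_mem _ haP)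
            (IsLocalization.map_units _ (⟨a, haI⟩ : I.primeCompl))
        rw [this]
        exact top_isPrincipal
    exact Ideal.projective_of_isPrincipal _
  obtain ⟨m, k, ⟨e⟩⟩ := HasFiniteFreeResolution.exists_prod_equiv (R := S) (M := P)
    (((HasFiniteFreeResolution.of_isRegularLocalRing p).localizedModule
      (Submonoid.powers x)).congr (LinearEquiv.extendScalarsOfIsLocalization (Submonoid.powers x) S
        (IsLocalizedModule.iso (Submonoid.powers x) (Algebra.idealMap S p)))) hproj
  exact P.isPrincipal_of_prod_equiv e

/-! ### Regularity of smooth algebras over a field. -/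

/-- An étale algebra over a regular ring is regular. -/
theorem IsRegularRing.of_etale (A B : Type u) [CommRing A] [CommRing B] [Algebra A B]
    [Algebra.Etale A B] [IsRegularRing A] : IsRegularRing B := by
  have hB : IsNoetherianRing B := Algebra.FiniteType.isNoetherianRing A B
  refine isRegularRing_iff.2 fun q hq => ?_
  apply IsRegularLocalRing.of_spanFinrank_maximalIdeal_le
  let p := q.under A
  have hlies : q.LiesOver p := inferInstance
  have hreg : IsRegularLocalRing (Localization.AtPrime p) := inferInstance
  let := Localization.AtPrime.algebraOfLiesOver p q
  -- Being unramified, `B` needs no more generators for the maximal ideal at `q` than `A` does at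
  -- `p`; by going down, the height of `q` is at least that of `p`. So the number of generators at
  -- `q` is at most the dimension.
  have hmax : (IsLocalRing.maximalIdeal (Localization.AtPrime p)).map
      (algebraMap (Localization.AtPrime p) (Localization.AtPrime q)) =
      IsLocalRing.maximalIdeal (Localization.AtPrime q) := by
    have hunr : Algebra.IsUnramifiedAt A q := inferInstance
    rw [← ((Algebra.isUnramifiedAt_iff_map_eq A p q).1 hunr).2,
      ← Localization.AtPrime.map_eq_maximalIdeal, Ideal.map_map, ← IsScalarTower.algebraMap_eq]
  have hht : p.height ≤ q.height := by
    rw [Ideal.height_eq_height_add_of_liesOver_of_hasGoingDown p q]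
    exact le_self_add
  have h1 : (IsLocalRing.maximalIdeal (Localization.AtPrime q)).spanFinrank ≤
      (IsLocalRing.maximalIdeal (Localization.AtPrime p)).spanFinrank := by
    rw [← hmax]
    exact Ideal.spanFinrank_map_le_of_fg _ (IsNoetherian.noetherian _)
  have h2 := IsRegularLocalRing.spanFinrank_maximalIdeal (R := Localization.AtPrime p)
  rw [IsLocalization.AtPrime.ringKrullDim_eq_height q]
  rw [IsLocalization.AtPrime.ringKrullDim_eq_height p] at h2
  calc _ ≤ (((IsLocalRing.maximalIdeal (Localization.AtPrime p)).spanFinrank : ℕ) :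
        WithBot ℕ∞) := by exact_mod_cast h1
    _ = _ := h2
    _ ≤ _ := by exact_mod_cast hht

/-- A standard smooth algebra over a field is a regular ring. -/
theorem RingHom.IsStandardSmooth.isRegularRing {k B : Type u} [Field k] [CommRing B] {φ : k →+* B}
    (h : φ.IsStandardSmooth) : IsRegularRing B := by
  obtain ⟨n, g, -, hg⟩ := h.exists_etale_mvPolynomial
  let := g.toAlgebra
  have : Algebra.Etale (MvPolynomial (Fin n) k) B := hg
  exact IsRegularRing.of_etale (MvPolynomial (Fin n) k) B

/-! ### Inverse images of ideal sheaves. -/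

namespace AlgebraicGeometry.Scheme.IdealSheafData

variable {W X : Scheme.{u}}

/-- Both sides have the same universal property: `comap` is left adjoint to `map`, extension of
ideals is left adjoint to contraction, and on an affine scheme an ideal sheaf is determined by its
global sections. -/
theorem ideal_comap_top_of_isAffine [IsAffine W] [IsAffine X] (g : W ⟶ X) (J : X.IdealSheafData) :
    (J.comap g).ideal ⟨⊤, isAffineOpen_top W⟩ =
      (J.ideal ⟨⊤, isAffineOpen_top X⟩).map g.appTop.hom := by
  have key : ∀ K : W.IdealSheafData, J.comap g ≤ K ↔
      (J.ideal ⟨⊤, isAffineOpen_top X⟩).map g.appTop.hom ≤ K.ideal ⟨⊤, isAffineOpen_top W⟩ := by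
    intro K
    rw [← le_map_iff_comap_le, Ideal.map_le_iff_le_comap]
    have h := ideal_map K g ⟨⊤, isAffineOpen_top X⟩ (isAffineOpen_top W)
    constructor
    · intro H
      exact (H ⟨⊤, isAffineOpen_top X⟩).trans h.le
    · intro H
      exact le_of_isAffine (H.trans h.ge)
  refine le_antisymm ?_ ((key _).1 le_rfl)
  have := (key (ofIdealTop ((J.ideal ⟨⊤, isAffineOpen_top X⟩).map g.appTop.hom))).2 (by simp)
  simpa using this ⟨⊤, isAffineOpen_top W⟩

/-- The ideal of the inverse image of a closed subscheme on affine open subsets. -/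
theorem ideal_comap (g : W ⟶ X) (J : X.IdealSheafData) (U : W.affineOpens) (V : X.affineOpens)
    (h : U.1 ≤ g ⁻¹ᵁ V.1) :
    (J.comap g).ideal U = (J.ideal V).map (g.appLE V.1 U.1 h).hom := by
  have : IsAffine U.1 := U.2
  have : IsAffine V.1 := V.2
  let tU : U.1.toScheme.affineOpens := ⟨⊤, isAffineOpen_top _⟩
  let tV : V.1.toScheme.affineOpens := ⟨⊤, isAffineOpen_top _⟩
  have h1 : (((J.comap V.1.ι).comap (g.resLE V.1 U.1 h)).ideal tU) =
      ((J.comap V.1.ι).ideal tV).map (g.resLE V.1 U.1 h).appTop.hom :=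
    ideal_comap_top_of_isAffine (g.resLE V.1 U.1 h) (J.comap V.1.ι)
  have h2 : (J.comap V.1.ι).comap (g.resLE V.1 U.1 h) = (J.comap g).comap U.1.ι := by
    rw [← comap_comp, Scheme.Hom.resLE_comp_ι, comap_comp]
  have h3 := ideal_comap_of_isOpenImmersion (J.comap g) U.1.ι tU
  have h4 := ideal_comap_of_isOpenImmersion J V.1.ι tV
  rw [h2, h3, h4, Scheme.Opens.ι_appIso, Scheme.Opens.ι_appIso] at h1
  have key : ∀ (U' : W.affineOpens) (V' : X.affineOpens) (hU : U' = U) (hV : V' = V)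
      (h' : U'.1 ≤ g ⁻¹ᵁ V'.1), (J.comap g).ideal U' = (J.ideal V').map (g.appLE V'.1 U'.1 h').hom →
      (J.comap g).ideal U = (J.ideal V).map (g.appLE V.1 U.1 h).hom := by
    rintro U' V' rfl rfl h' h
    exact h
  refine key ⟨U.1.ι ''ᵁ ⊤, (isAffineOpen_top _).image_of_isOpenImmersion _⟩
    ⟨V.1.ι ''ᵁ ⊤, (isAffineOpen_top _).image_of_isOpenImmersion _⟩ (Subtype.ext U.1.ι_image_top)
    (Subtype.ext V.1.ι_image_top) (by simpa using h) ?_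
  have h5 : (g.resLE V.1 U.1 h).appTop = g.appLE (V.1.ι ''ᵁ ⊤) (U.1.ι ''ᵁ ⊤) (by simpa using h) := by
    rw [← Scheme.Hom.resLE_appLE g h ⊤ ⊤ le_top]
    exact (Scheme.Hom.appLE_eq_app _).symm
  rw [h5] at h1
  exact h1

/-- The stalk of the inverse image of a closed subscheme is generated by the stalk of its ideal. -/
theorem germ_comap_mem_iff (g : W ⟶ X) (J : X.IdealSheafData) (w : W) (V : X.affineOpens)
    (hV : g w ∈ V.1) (I : Ideal (W.presheaf.stalk w)) :
    (∀ (U : W.affineOpens) (hw : w ∈ U.1), ∀ s ∈ (J.comap g).ideal U,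
      W.presheaf.germ U.1 w hw s ∈ I) ↔
    ∀ c ∈ J.ideal V, (g.stalkMap w).hom (X.presheaf.germ V.1 (g w) hV c) ∈ I := by
  have key : ∀ (V' : X.affineOpens) (U : W.affineOpens) (h : U.1 ≤ g ⁻¹ᵁ V'.1) (hw : w ∈ U.1)
      (c : Γ(X, V'.1)), W.presheaf.germ U.1 w hw (g.appLE V'.1 U.1 h c) =
        (g.stalkMap w).hom (X.presheaf.germ V'.1 (g w) (h hw) c) := by
    intro V' U h hw c
    refine Eq.trans ?_ (Scheme.Hom.germ_stalkMap_apply g V'.1 w (h hw) c).symm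
    rw [Scheme.Hom.appLE, CommRingCat.comp_apply]
    exact TopCat.Presheaf.germ_res_apply W.presheaf (homOfLE h) w hw _
  have step : ∀ (V' : X.affineOpens) (U : W.affineOpens) (h : U.1 ≤ g ⁻¹ᵁ V'.1) (hw : w ∈ U.1),
      (∀ s ∈ (J.comap g).ideal U, W.presheaf.germ U.1 w hw s ∈ I) ↔
      ∀ c ∈ J.ideal V', (g.stalkMap w).hom (X.presheaf.germ V'.1 (g w) (h hw) c) ∈ I := by
    intro V' U h hw
    rw [ideal_comap g J U V' h]
    constructor
    · intro H c hc
      rw [← key V' U h hw]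
      exact H _ (Ideal.mem_map_of_mem _ hc)
    · intro H s hs
      have : (J.ideal V').map (g.appLE V'.1 U.1 h).hom ≤
          I.comap (W.presheaf.germ U.1 w hw).hom := by
        rw [Ideal.map_le_iff_le_comap]
        intro c hc
        simp only [Ideal.mem_comap]
        rw [key V' U h hw]
        exact H c hc
      exact this hs
  constructor
  · intro H
    obtain ⟨U, hU, hwU, hUV⟩ := exists_isAffineOpen_mem_and_subset (x := w) (U := g ⁻¹ᵁ V.1) hV
    exact (step V ⟨U, hU⟩ hUV hwU).1 (H ⟨U, hU⟩ hwU)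
  · intro H U hw
    obtain ⟨U', hU', hwU', hUV⟩ := exists_isAffineOpen_mem_and_subset (x := w)
      (U := g ⁻¹ᵁ V.1 ⊓ U.1) ⟨hV, hw⟩
    have h1 := (step V ⟨U', hU'⟩ (hUV.trans inf_le_left) hwU').2 H
    intro s hs
    have hle : (⟨U', hU'⟩ : W.affineOpens) ≤ U := hUV.trans inf_le_right
    have h2 := h1 _ (Ideal.mem_comap.1 (ideal_le_comap_ideal _ hle hs))
    exact (TopCat.Presheaf.germ_res_apply W.presheaf (homOfLE hle) w hwU' s) ▸ h2

/-- The reduced structure makes membership a pointwise condition. Vanishing ideals in a model and in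
its generic fibre are compared through this criterion. -/
theorem mem_vanishingIdeal_iff (Z : Closeds X) (V : X.affineOpens) (c : Γ(X, V.1)) :
    c ∈ (vanishingIdeal Z).ideal V ↔ ∀ x ∈ Z, x ∈ V.1 → x ∉ X.basicOpen c := by
  rw [vanishingIdeal_ideal, PrimeSpectrum.mem_vanishingIdeal]
  constructor
  · intro H x hx hxV hxc
    obtain ⟨p, rfl⟩ : x ∈ Set.range V.2.fromSpec := by rwa [V.2.range_fromSpec]
    have h1 := H p hx
    have h2 : p ∈ V.2.fromSpec ⁻¹ᵁ X.basicOpen c := hxc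
    rw [V.2.fromSpec_preimage_basicOpen] at h2
    exact h2 h1
  · intro H p hp
    by_contra hc
    have h2 : p ∈ V.2.fromSpec ⁻¹ᵁ X.basicOpen c := by
      rw [V.2.fromSpec_preimage_basicOpen]
      exact hc
    exact H _ hp (X.basicOpen_le c h2) h2

end AlgebraicGeometry.Scheme.IdealSheafData

/-! ### Orders in terms of local rings. -/

namespace SemiIntegral

open Scheme.IdealSheafData

theorem _root_.ENat.le_iSup_iff_of_antitone {S : Set ℕ} (hS : ∀ n ∈ S, ∀ m ≤ n, m ∈ S) (n : ℕ)
    (h0 : 0 ∈ S) : (n : ℕ∞) ≤ ⨆ n ∈ S, (n : ℕ∞) ↔ n ∈ S := by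
  refine ⟨fun h => ?_, fun h => le_iSup₂_of_le n h le_rfl⟩
  by_contra hn
  rcases n with _ | n
  · exact hn h0
  · have : (⨆ n ∈ S, (n : ℕ∞)) ≤ n := by
      refine iSup₂_le fun m hm => ?_
      have : m ≤ n := by
        by_contra hlt
        exact hn (hS m hm _ (by omega))
      exact_mod_cast this
    have := h.trans this
    norm_cast at this
    omega

/-- The set of exponents in the definition of the order contains `0` and is closed downwards, so a
finite lower bound for its supremum is one of its members. -/
theorem natCast_le_orderAt {W : Scheme.{u}} (J : W.IdealSheafData) (w : W) (n : ℕ) :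
    (n : ℕ∞) ≤ orderAt J w ↔ ∀ (U : W.affineOpens) (hw : w ∈ U.1), ∀ s ∈ J.ideal U,
      W.presheaf.germ U.1 w hw s ∈
        IsLocalRing.maximalIdeal (W.presheaf.stalk w) ^ n := by
  unfold orderAt
  rw [ENat.le_iSup_iff_of_antitone]
  · rfl
  · intro n hn m hm U hw s hs
    exact Ideal.pow_le_pow_right hm (hn U hw s hs)
  · intro U hw s hs
    simp

/-- The order of a pulled back closed subset, in terms of the local ring. -/
theorem natCast_le_pullbackOrder {W X : Scheme.{u}} (g : W ⟶ X) (Z : Closeds X) (w : W)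
    (V : X.affineOpens) (hV : g w ∈ V.1) (n : ℕ) :
    (n : ℕ∞) ≤ pullbackOrder g Z w ↔ ∀ c ∈ (vanishingIdeal Z).ideal V,
      (g.stalkMap w).hom (X.presheaf.germ V.1 (g w) hV c) ∈
        IsLocalRing.maximalIdeal (W.presheaf.stalk w) ^ n := by
  rw [pullbackOrder, natCast_le_orderAt, germ_comap_mem_iff g _ w V hV]

end SemiIntegral

/-! ### Arithmetic of `S`-integers. -/

namespace IsDedekindDomain.HeightOneSpectrum

variable {K : Type u} [Field K] [NumberField K]

theorem eventually_valuation_eq_one {R : Type*} [CommRing R] [IsDedekindDomain R] {L : Type*}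
    [Field L] [Algebra R L] [IsFractionRing R L] {x : L} (hx : x ≠ 0) :
    ∀ᶠ v : HeightOneSpectrum R in Filter.cofinite, v.valuation L x = 1 := by
  have h1 := Support.finite (R := R) (K := L) x
  have h2 := Support.finite (R := R) (K := L) x⁻¹
  filter_upwards [h1.compl_mem_cofinite, h2.compl_mem_cofinite] with v hv1 hv2
  simp only [Support, Set.mem_compl_iff, Set.mem_ofPred_eq, not_lt, map_inv₀] at hv1 hv2
  refine le_antisymm hv1 ?_
  exact (inv_le_one₀ (by simpa [zero_lt_iff] using hx)).1 hv2

/-- Some power of a prime of a number field is principal. -/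
theorem exists_valuation_lt_one_iff_eq (v : HeightOneSpectrum (𝓞 K)) :
    ∃ a : 𝓞 K, a ≠ 0 ∧ a ∈ v.asIdeal ∧ ∀ w : HeightOneSpectrum (𝓞 K), w ≠ v → a ∉ w.asIdeal := by
  obtain ⟨n, hn, h⟩ : ∃ n, 0 < n ∧ (v.asIdeal ^ n).IsPrincipal := by
    let c : ClassGroup (𝓞 K) := ClassGroup.mk0 ⟨v.asIdeal, mem_nonZeroDivisors_of_ne_zero v.ne_bot⟩
    -- The order is positive because the class group is finite.
    refine ⟨orderOf c, orderOf_pos c, ?_⟩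
    have h1 : c ^ orderOf c = 1 := pow_orderOf_eq_one c
    rw [← map_pow, ClassGroup.mk0_eq_one_iff] at h1
    exact h1
  obtain ⟨a, ha⟩ := h
  have hav : ∀ w : HeightOneSpectrum (𝓞 K), a ∈ w.asIdeal ↔ v.asIdeal ^ n ≤ w.asIdeal := by
    intro w
    rw [ha]
    exact (Ideal.span_singleton_le_iff_mem _).symm
  refine ⟨a, ?_, (hav v).2 (Ideal.pow_le_self hn.ne'), ?_⟩
  · rintro rfl
    have : v.asIdeal ^ n ≠ 0 := pow_ne_zero _ v.ne_bot
    apply this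
    rw [ha]
    simp
  · intro w hw haw
    have h1 := Ideal.IsPrime.le_of_pow_le ((hav w).1 haw)
    exact hw (HeightOneSpectrum.ext (v.isMaximal.eq_of_le w.isPrime.ne_top h1).symm)

end IsDedekindDomain.HeightOneSpectrum

namespace Set

variable {K : Type u} [Field K] [NumberField K] {S : Set (HeightOneSpectrum (𝓞 K))}

open HeightOneSpectrum

theorem exists_mem_asIdeal_iff (hS : S.Finite) :
    ∃ a : 𝓞 K, a ≠ 0 ∧ ∀ w : HeightOneSpectrum (𝓞 K), a ∈ w.asIdeal ↔ w ∈ S := by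
  choose g h0 h1 h2 using fun v : HeightOneSpectrum (𝓞 K) => v.exists_valuation_lt_one_iff_eq
  refine ⟨∏ v ∈ hS.toFinset, g v, Finset.prod_ne_zero_iff.2 fun v _ => h0 v, fun w => ?_⟩
  rw [Ideal.IsPrime.prod_mem_iff]
  constructor
  · rintro ⟨v, hv, hw⟩
    by_cases hwv : w = v
    · subst hwv
      simpa using hv
    · exact absurd hw (h2 v w hwv)
  · intro hw
    exact ⟨w, by simpa using hw, h1 w⟩

/-- Take `a` contained in exactly the primes of `S`. It is an `S`-unit, and a sufficiently high
power of it cancels the poles of a given `S`-integer, so `𝒪_S = 𝒪_K[1/a]`. The purpose is that `𝒪_S`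
is Noetherian. -/
theorem exists_integer_isLocalization_away (hS : S.Finite) :
    ∃ a : 𝓞 K, IsLocalization.Away a (S.integer K) := by
  obtain ⟨a, ha0, ha⟩ := exists_mem_asIdeal_iff hS
  have haK : algebraMap (𝓞 K) K a ≠ 0 := by simpa using ha0
  have hval : ∀ w ∉ S, w.valuation K (algebraMap (𝓞 K) K a) = 1 := by
    intro w hw
    refine le_antisymm (w.valuation_le_one a) (not_lt.1 fun h => hw ?_)
    rw [valuation_lt_one_iff_mem] at h
    exact (ha w).1 h
  refine ⟨a, ?_⟩
  refine IsLocalization.Away.mk a (S := S.integer K) ?_ ?_ ?_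
  · refine IsUnit.of_mul_eq_one (⟨(algebraMap (𝓞 K) K a)⁻¹, fun w hw => ?_⟩ : S.integer K) ?_
    · rw [map_inv₀, hval w hw, inv_one]
    · exact Subtype.ext (mul_inv_cancel₀ haK)
  · intro x
    obtain ⟨n, hn⟩ : ∃ n : ℕ, ∀ w ∈ S,
        w.valuation K (x * (algebraMap (𝓞 K) K a) ^ n) ≤ 1 := by
      have h1 : ∀ w ∈ S, ∃ n : ℕ, ∀ m ≥ n, w.valuation K (x * (algebraMap (𝓞 K) K a) ^ m) ≤ 1 := by
        intro w hw
        have hlt : w.valuation K (algebraMap (𝓞 K) K a) < 1 := by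
          rw [valuation_lt_one_iff_mem]
          exact (ha w).2 hw
        have hne : w.valuation K (algebraMap (𝓞 K) K a) ≠ 0 := by simpa using haK
        obtain ⟨n, hn⟩ := MulArchimedean.arch (w.valuation K (x : K))
          ((one_lt_inv₀ (zero_lt_iff.2 hne)).2 hlt)
        refine ⟨n, fun m hm => ?_⟩
        rw [map_mul, map_pow]
        calc _ ≤ (w.valuation K (algebraMap (𝓞 K) K a))⁻¹ ^ n *
              w.valuation K (algebraMap (𝓞 K) K a) ^ n :=
              mul_le_mul' hn (pow_le_pow_right_of_le_one' hlt.le hm)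
          _ = 1 := by rw [← mul_pow, inv_mul_cancel₀ hne, one_pow]
      choose! g hg using h1
      refine ⟨hS.toFinset.sup g, fun w hw => hg w hw _ (Finset.le_sup (by simpa using hw))⟩
    obtain ⟨y, hy⟩ := mem_integers_of_valuation_le_one K (x * (algebraMap (𝓞 K) K a) ^ n) (by
      intro w
      by_cases hw : w ∈ S
      · exact hn w hw
      · rw [map_mul, map_pow, hval w hw, one_pow, mul_one]
        exact x.2 w hw)
    exact ⟨n, y, Subtype.ext hy.symm⟩
  · intro x y hxy
    refine ⟨0, ?_⟩
    have h := congrArg Subtype.val hxy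
    have := NumberField.RingOfIntegers.coe_injective (K := K) h
    simp [this]

theorem isNoetherianRing_integer (hS : S.Finite) : IsNoetherianRing (S.integer K) := by
  obtain ⟨a, ha⟩ := exists_integer_isLocalization_away hS
  exact IsLocalization.isNoetherianRing (Submonoid.powers a) _ inferInstance

end Set

/-! ### Values of sections at points with values in a ring. -/

namespace AlgebraicGeometry.Scheme

noncomputable section

/-- The structure map `R → Γ(X, U)` of a scheme over `R`. -/
def scalar {R : Type u} [CommRing R] {X : Scheme.{u}} (a : X ⟶ Spec (.of R)) (U : X.Opens) :
    R →+* Γ(X, U) :=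
  ((Scheme.ΓSpecIso (.of R)).inv ≫ a.appLE ⊤ U (show U ≤ a ⁻¹ᵁ ⊤ from le_top)).hom

/-- The value of a section at an `A`-point. -/
def eval {A : Type u} [CommRing A] {X : Scheme.{u}} (q : Spec (.of A) ⟶ X) {U : X.Opens}
    (h : ⊤ ≤ q ⁻¹ᵁ U) : Γ(X, U) →+* A :=
  (q.appLE U ⊤ h ≫ (Scheme.ΓSpecIso (.of A)).hom).hom

end

variable {X Y : Scheme.{u}} {R A B : Type u} [CommRing R] [CommRing A] [CommRing B]

theorem appLE_scalar (g : Y ⟶ X) (a : X ⟶ Spec (.of R)) {U : X.Opens} {V : Y.Opens}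
    (h : V ≤ g ⁻¹ᵁ U) (r : R) :
    (g.appLE U V h).hom (scalar a U r) = scalar (g ≫ a) V r := by
  rw [scalar, scalar, ← CommRingCat.comp_apply, Category.assoc, Scheme.Hom.appLE_comp_appLE]

theorem scalar_comp (a : X ⟶ Spec (.of A)) (φ : R →+* A) (U : X.Opens) (r : R) :
    scalar (a ≫ Spec.map (CommRingCat.ofHom φ)) U r = scalar a U (φ r) := by
  have h : (Scheme.ΓSpecIso (.of R)).inv ≫ (Spec.map (CommRingCat.ofHom φ)).appTop =
      CommRingCat.ofHom φ ≫ (Scheme.ΓSpecIso (.of A)).inv :=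
    Scheme.ΓSpecIso_inv_naturality (CommRingCat.ofHom φ) |>.symm
  have h2 : (a ≫ Spec.map (CommRingCat.ofHom φ)).appLE ⊤ U le_top =
      (Spec.map (CommRingCat.ofHom φ)).appTop ≫ a.appLE ⊤ U le_top := by
    rw [Scheme.Hom.appTop, Scheme.Hom.app_eq_appLE]
    exact (Scheme.Hom.appLE_comp_appLE a (Spec.map (CommRingCat.ofHom φ)) ⊤ ⊤ U _ _).symm
  rw [scalar, h2, ← Category.assoc, h]
  rfl

theorem eval_comp (q : Spec (.of A) ⟶ Y) (g : Y ⟶ X) {U : X.Opens} {V : Y.Opens}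
    (h : V ≤ g ⁻¹ᵁ U) (hV : ⊤ ≤ q ⁻¹ᵁ V) (hU : ⊤ ≤ (q ≫ g) ⁻¹ᵁ U) (s : Γ(X, U)) :
    eval (q ≫ g) hU s = eval q hV ((g.appLE U V h).hom s) := by
  rw [eval, eval, ← CommRingCat.comp_apply, ← Category.assoc, Scheme.Hom.appLE_comp_appLE]

theorem eval_SpecMap_comp (φ : A →+* B) (q : Spec (.of A) ⟶ X) {U : X.Opens}
    (h : ⊤ ≤ q ⁻¹ᵁ U) (h' : ⊤ ≤ (Spec.map (CommRingCat.ofHom φ) ≫ q) ⁻¹ᵁ U) (s : Γ(X, U)) :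
    eval (Spec.map (CommRingCat.ofHom φ) ≫ q) h' s = φ (eval q h s) := by
  have h1 : (Spec.map (CommRingCat.ofHom φ)).appTop ≫ (Scheme.ΓSpecIso (.of B)).hom =
      (Scheme.ΓSpecIso (.of A)).hom ≫ CommRingCat.ofHom φ :=
    Scheme.ΓSpecIso_naturality (CommRingCat.ofHom φ)
  have h2 : (Spec.map (CommRingCat.ofHom φ) ≫ q).appLE U ⊤ h' =
      q.appLE U ⊤ h ≫ (Spec.map (CommRingCat.ofHom φ)).appTop := by
    rw [Scheme.Hom.appTop, Scheme.Hom.app_eq_appLE]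
    exact (Scheme.Hom.appLE_comp_appLE (Spec.map (CommRingCat.ofHom φ)) q U ⊤ ⊤ _ _).symm
  rw [eval, h2, Category.assoc, h1]
  rfl

theorem eval_scalar (q : Spec (.of A) ⟶ X) (a : X ⟶ Spec (.of R)) (φ : R →+* A)
    (hq : q ≫ a = Spec.map (CommRingCat.ofHom φ)) {U : X.Opens} (h : ⊤ ≤ q ⁻¹ᵁ U) (r : R) :
    eval q h (scalar a U r) = φ r := by
  have h1 := appLE_scalar q a h r
  have h2 := scalar_comp (𝟙 (Spec (.of A))) φ ⊤ r
  rw [hq, ← Category.id_comp (Spec.map (CommRingCat.ofHom φ)), h2] at h1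
  rw [eval, CommRingCat.comp_apply]
  refine (congrArg (Scheme.ΓSpecIso (.of A)).hom.hom h1).trans ?_
  have h3 : Scheme.Hom.appLE (𝟙 (Spec (.of A))) ⊤ ⊤ le_top = 𝟙 _ :=
    (Scheme.Hom.appLE_eq_app (𝟙 (Spec (.of A)))).trans (Scheme.Hom.id_app _)
  have h4 : scalar (𝟙 (Spec (.of A))) ⊤ = (Scheme.ΓSpecIso (.of A)).inv.hom :=
    congrArg (fun g => ((Scheme.ΓSpecIso (.of A)).inv ≫ g).hom) h3 |>.trans (by simp)
  rw [h4]
  exact congr($((Scheme.ΓSpecIso (.of A)).inv_hom_id) (φ r))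

theorem top_le_preimage_of_closedPoint_mem [IsLocalRing A] (q : Spec (.of A) ⟶ X) {U : X.Opens}
    (h : q (IsLocalRing.closedPoint A) ∈ U) : ⊤ ≤ q ⁻¹ᵁ U := by
  intro x _
  have : x ⤳ IsLocalRing.closedPoint A := IsLocalRing.specializes_closedPoint x
  exact (this.map q.continuous).mem_open U.2 h

theorem closedPoint_mem_basicOpen_iff [IsLocalRing A] (q : Spec (.of A) ⟶ X) {U : X.Opens}
    (h : ⊤ ≤ q ⁻¹ᵁ U) (s : Γ(X, U)) :
    q (IsLocalRing.closedPoint A) ∈ X.basicOpen s ↔ IsUnit (eval q h s) := by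
  have h1 : ∀ t : Γ(Spec (.of A), ⊤), IsLocalRing.closedPoint A ∈ (Spec (.of A)).basicOpen t ↔
      IsUnit ((Scheme.ΓSpecIso (.of A)).hom.hom t) := by
    intro t
    rw [basicOpen_eq_of_affine']
    exact (IsLocalRing.notMem_maximalIdeal (x := (Scheme.ΓSpecIso (.of A)).hom.hom t))
  have h2 : IsLocalRing.closedPoint A ∈ q ⁻¹ᵁ X.basicOpen s ↔
      IsLocalRing.closedPoint A ∈ (Spec (.of A)).basicOpen ((q.appLE U ⊤ h).hom s) := by
    have := Scheme.basicOpen_appLE q ⊤ U h s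
    rw [show (Spec (.of A)).basicOpen ((q.appLE U ⊤ h).hom s) = _ from this]
    simp
  exact h2.trans (h1 _)

end AlgebraicGeometry.Scheme

namespace SemiIntegral

open Scheme Scheme.IdealSheafData

/-- The stalk at the closed point is the localization of `A` at its own maximal ideal, where powers
of the maximal ideal contract to powers. Orders can therefore be tested on the values in `A` of the
sections of a single chart. -/
theorem natCast_le_pullbackOrder_closedPoint {A : Type u} [CommRing A] [IsLocalRing A]
    {X : Scheme.{u}} (q : Spec (.of A) ⟶ X) (Z : Closeds X) (V : X.affineOpens)
    (hV : ⊤ ≤ q ⁻¹ᵁ V.1) (n : ℕ) :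
    (n : ℕ∞) ≤ pullbackOrder q Z (IsLocalRing.closedPoint A) ↔
      ∀ c ∈ (vanishingIdeal Z).ideal V, eval q hV c ∈ IsLocalRing.maximalIdeal A ^ n := by
  have hm : q (IsLocalRing.closedPoint A) ∈ V.1 := hV (Set.mem_univ _)
  rw [natCast_le_pullbackOrder q Z _ V hm]
  let x : Spec (.of A) := IsLocalRing.closedPoint A
  let _ : Algebra A ((Spec (.of A)).presheaf.stalk x) := StructureSheaf.stalkAlgebra A x
  have : IsLocalization.AtPrime ((Spec (.of A)).presheaf.stalk x) (IsLocalRing.maximalIdeal A) :=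
    StructureSheaf.IsLocalization.to_stalk A x
  have key : ∀ c : Γ(X, V.1), (q.stalkMap x).hom (X.presheaf.germ V.1 (q x) hm c) =
      algebraMap A ((Spec (.of A)).presheaf.stalk x) (eval q hV c) := by
    intro c
    have h1 : ∀ t : Γ(Spec (.of A), ⊤), (Spec (.of A)).presheaf.germ ⊤ x (Set.mem_univ _) t =
        algebraMap A ((Spec (.of A)).presheaf.stalk x)
          ((Scheme.ΓSpecIso (.of A)).hom.hom t) := by
      intro t
      obtain ⟨a, rfl⟩ : ∃ a, t = (Scheme.ΓSpecIso (.of A)).inv.hom a :=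
        ⟨(Scheme.ΓSpecIso (.of A)).hom.hom t, by simp⟩
      refine Eq.trans ?_ (congrArg (algebraMap A ((Spec (.of A)).presheaf.stalk x))
        congr($((Scheme.ΓSpecIso (.of A)).inv_hom_id) a)).symm
      exact congr($(StructureSheaf.algebraMap_germ (R := A) ⊤ x trivial) a)
    refine (Scheme.Hom.germ_stalkMap_apply q V.1 x hm c).trans (Eq.trans ?_ (h1 _))
    exact (TopCat.Presheaf.germ_res_apply (Spec (.of A)).presheaf (homOfLE hV) x trivial _).symm
  have hmem : ∀ a : A, algebraMap A ((Spec (.of A)).presheaf.stalk x) a ∈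
      IsLocalRing.maximalIdeal ((Spec (.of A)).presheaf.stalk x) ^ n ↔
        a ∈ IsLocalRing.maximalIdeal A ^ n := by
    intro a
    rw [← IsLocalization.AtPrime.under_maximalIdeal_pow (IsLocalRing.maximalIdeal A)
      ((Spec (.of A)).presheaf.stalk x) n]
    rfl
  refine forall₂_congr fun c _ => ?_
  rw [key, hmem]

end SemiIntegral

/-! ### The generic fibre of a model and its local points. -/

theorem CommRingCat.isLocalization_of_isPushout {R A T B : Type u} [CommRing R] [CommRing A]
    [CommRing T] [CommRing B] [Algebra R A] (N : Submonoid R) [IsLocalization N A] (α : R →+* T)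
    (β : T →+* B) (γ : A →+* B)
    (h : IsPushout (CommRingCat.ofHom α) (CommRingCat.ofHom (algebraMap R A))
      (CommRingCat.ofHom β) (CommRingCat.ofHom γ)) :
    @IsLocalization T _ (N.map α) B _ β.toAlgebra := by
  have hcomm : β.comp α = γ.comp (algebraMap R A) :=
    congrArg CommRingCat.Hom.hom h.w
  let _ : Algebra R T := α.toAlgebra
  let _ : Algebra A B := γ.toAlgebra
  let _ : Algebra T B := β.toAlgebra
  let _ : Algebra R B := (β.comp α).toAlgebra
  have : IsScalarTower R T B := IsScalarTower.of_algebraMap_eq' rfl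
  have : IsScalarTower R A B := IsScalarTower.of_algebraMap_eq' hcomm
  change IsLocalization (Algebra.algebraMapSubmonoid T N) B
  rw [Algebra.isLocalization_iff_isPushout N A, ← CommRingCat.isPushout_iff_isPushout]
  exact h

namespace SemiIntegral

open Scheme Scheme.IdealSheafData

variable {K : Type u} [Field K] [NumberField K]

/-- A non-zero number is a unit outside finitely many places. This is the arithmetic source of
exceptional places: denominators are made harmless through it. -/
theorem eventually_isUnit_toLocal {S : Set (HeightOneSpectrum (𝓞 K))} {a : S.integer K}
    (ha : a ≠ 0) : ∀ᶠ v : HeightOneSpectrum (𝓞 K) in Filter.cofinite, ∀ hv : v ∉ S,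
      IsUnit (toLocal hv a) := by
  have ha' : (a : K) ≠ 0 := by simpa using ha
  filter_upwards [HeightOneSpectrum.eventually_valuation_eq_one (R := 𝓞 K) ha'] with v hv hvS
  have h := HeightOneSpectrum.valuedAdicCompletion_eq_valuation' v (a : K)
  rw [hv] at h
  exact (Valuation.integer.integers (Valued.v (R := v.adicCompletion K))).isUnit_iff_valuation_eq_one.2 h

namespace Model

variable {S : Set (HeightOneSpectrum (𝓞 K))} {X : Scheme.{u}} {strX : X ⟶ Spec (.of K)}
  (M : Model S strX)

instance isPreimmersion_gen : IsPreimmersion M.gen := by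
  have : IsPreimmersion (Spec.map (CommRingCat.ofHom (algebraMap (S.integer K) K))) :=
    IsPreimmersion.of_isLocalization (nonZeroDivisors (S.integer K))
  exact MorphismProperty.of_isPullback M.isPullback.flip this

instance isAffineHom_gen : IsAffineHom M.gen :=
  MorphismProperty.of_isPullback (P := @IsAffineHom) M.isPullback.flip inferInstance

/-- The generic fibre is the base change along `𝒪_S → K`, which inverts the non-zero scalars, and
localization commutes with base change. -/
theorem isLocalization_app {U : M.total.Opens} (hU : IsAffineOpen U) :
    @IsLocalization Γ(M.total, U) _ ((nonZeroDivisors (S.integer K)).map (scalar M.str U))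
      Γ(X, M.gen ⁻¹ᵁ U) _ (M.gen.app U).hom.toAlgebra := by
  have h1 := (isIso_pushoutSection_iff M.isPullback (US := ⊤) (UT := ⊤) (UX := U) le_top le_top
    (UY := M.gen ⁻¹ᵁ U) (by simp)).1 (isIso_pushoutSection_of_isAffineOpen _ _ _ _
      (isAffineOpen_top _) (isAffineOpen_top _) hU)
  refine CommRingCat.isLocalization_of_isPushout (A := K) (nonZeroDivisors (S.integer K))
    (scalar M.str U) (M.gen.app U).hom (scalar strX (M.gen ⁻¹ᵁ U)) ?_
  refine IsPushout.of_iso h1 (ΓSpecIso (.of (S.integer K))) (Iso.refl _) (ΓSpecIso (.of K))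
    (Iso.refl _) ?_ ?_ ?_ ?_
  · simp [scalar]
  · rw [← ΓSpecIso_naturality]
    exact congrArg (· ≫ _) (Scheme.Hom.appLE_eq_app _)
  · simp [Scheme.Hom.app_eq_appLE]
  · simp [scalar]

theorem app_scalar (U : M.total.Opens) (a : S.integer K) :
    (M.gen.app U).hom (scalar M.str U a) = scalar strX (M.gen ⁻¹ᵁ U) (a : K) := by
  rw [Scheme.Hom.app_eq_appLE, appLE_scalar, M.isPullback.w, scalar_comp]
  rfl

/-- Clearing denominators in a section over the generic fibre. -/
theorem exists_scalar_mul_eq {U : M.total.Opens} (hU : IsAffineOpen U)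
    (s : Γ(X, M.gen ⁻¹ᵁ U)) : ∃ a : S.integer K, a ≠ 0 ∧ ∃ b : Γ(M.total, U),
      (M.gen.app U).hom b = scalar strX (M.gen ⁻¹ᵁ U) (a : K) * s := by
  let _ := (M.gen.app U).hom.toAlgebra
  have := M.isLocalization_app hU
  obtain ⟨⟨b, _, a, ha, rfl⟩, h⟩ := IsLocalization.surj
    ((nonZeroDivisors (S.integer K)).map (scalar M.str U)) s
  refine ⟨a, nonZeroDivisors.ne_zero ha, b, ?_⟩
  rw [← app_scalar, mul_comm]
  exact h.symm

/-- The closed point of the `𝒪_v`-point of the model extending `Q`. -/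
noncomputable def closedPt {v : HeightOneSpectrum (𝓞 K)} (hv : v ∉ S)
    (Q : Point strX (v.adicCompletion K)) : M.total :=
  M.localPoint hv Q (IsLocalRing.closedPoint (v.adicCompletionIntegers K))

variable {M}

theorem localPoint_fac {v : HeightOneSpectrum (𝓞 K)} (hv : v ∉ S)
    (Q : Point strX (v.adicCompletion K)) : Spec.map (CommRingCat.ofHom
      (algebraMap (v.adicCompletionIntegers K) (v.adicCompletion K))) ≫ M.localPoint hv Q =
        Q.1 ≫ M.gen :=
  (M.existsUnique_localPoint hv Q).choose_spec.1.1

theorem localPoint_str {v : HeightOneSpectrum (𝓞 K)} (hv : v ∉ S)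
    (Q : Point strX (v.adicCompletion K)) :
    M.localPoint hv Q ≫ M.str = Spec.map (CommRingCat.ofHom (toLocal hv)) :=
  (M.existsUnique_localPoint hv Q).choose_spec.1.2

theorem eq_localPoint {v : HeightOneSpectrum (𝓞 K)} (hv : v ∉ S)
    (Q : Point strX (v.adicCompletion K)) {q : Spec (.of (v.adicCompletionIntegers K)) ⟶ M.total}
    (h1 : Spec.map (CommRingCat.ofHom
      (algebraMap (v.adicCompletionIntegers K) (v.adicCompletion K))) ≫ q = Q.1 ≫ M.gen)
    (h2 : q ≫ M.str = Spec.map (CommRingCat.ofHom (toLocal hv))) : q = M.localPoint hv Q :=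
  (M.existsUnique_localPoint hv Q).unique ⟨h1, h2⟩ ⟨localPoint_fac hv Q, localPoint_str hv Q⟩

theorem top_le_preimage_of_closedPt_mem {v : HeightOneSpectrum (𝓞 K)} {hv : v ∉ S}
    {Q : Point strX (v.adicCompletion K)} {U : M.total.Opens} (h : M.closedPt hv Q ∈ U) :
    ⊤ ≤ Q.1 ⁻¹ᵁ (M.gen ⁻¹ᵁ U) := by
  have h1 := top_le_preimage_of_closedPoint_mem (M.localPoint hv Q) h
  intro x hx
  have h2 := h1 (Set.mem_univ (Spec.map (CommRingCat.ofHom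
      (algebraMap (v.adicCompletionIntegers K) (v.adicCompletion K))) x))
  change (Spec.map (CommRingCat.ofHom (algebraMap (v.adicCompletionIntegers K)
    (v.adicCompletion K))) ≫ M.localPoint hv Q) x ∈ U at h2
  rwa [localPoint_fac] at h2

/-- The integral point restricts to the given `K_v`-point. Hence values of sections of the model at
a `K_v`-point are integral wherever the closed point stays in the chart. -/
theorem algebraMap_eval_localPoint {v : HeightOneSpectrum (𝓞 K)} {hv : v ∉ S}
    {Q : Point strX (v.adicCompletion K)} {U : M.total.Opens} (h : M.closedPt hv Q ∈ U)
    (b : Γ(M.total, U)) :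
    algebraMap (v.adicCompletionIntegers K) (v.adicCompletion K)
      (eval (M.localPoint hv Q) (top_le_preimage_of_closedPoint_mem _ h) b) =
        eval Q.1 (top_le_preimage_of_closedPt_mem h) ((M.gen.app U).hom b) := by
  have h0 : ⊤ ≤ (Q.1 ≫ M.gen) ⁻¹ᵁ U := by
    rw [Scheme.Hom.comp_preimage]
    exact top_le_preimage_of_closedPt_mem h
  have h1 := eval_comp Q.1 M.gen le_rfl (top_le_preimage_of_closedPt_mem h) h0 b
  rw [← Scheme.Hom.app_eq_appLE] at h1
  rw [← h1]
  have key : ∀ (p : Spec (.of (v.adicCompletion K)) ⟶ M.total) (hp : ⊤ ≤ p ⁻¹ᵁ U)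
      (hp' : Spec.map (CommRingCat.ofHom (algebraMap (v.adicCompletionIntegers K)
        (v.adicCompletion K))) ≫ M.localPoint hv Q = p),
      algebraMap (v.adicCompletionIntegers K) (v.adicCompletion K)
      (eval (M.localPoint hv Q) (top_le_preimage_of_closedPoint_mem _ h) b) = eval p hp b := by
    rintro p hp rfl
    exact (eval_SpecMap_comp _ _ _ hp b).symm
  exact key _ h0 (localPoint_fac hv Q)

theorem eval_scalar_eq {v : HeightOneSpectrum (𝓞 K)} (hv : v ∉ S)
    (Q : Point strX (v.adicCompletion K)) {U : X.Opens} (h : ⊤ ≤ Q.1 ⁻¹ᵁ U) (a : S.integer K) :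
    eval Q.1 h (scalar strX U (a : K)) =
      algebraMap (v.adicCompletionIntegers K) (v.adicCompletion K) (toLocal hv a) :=
  (eval_scalar Q.1 strX _ Q.2 h (a : K)).trans rfl

end Model

end SemiIntegral

/-! ### Compatibility of a morphism with charts at almost all places. -/

namespace AlgebraicGeometry.Scheme

theorem eq_SpecMap_eval_comp_fromSpec {A : Type u} [CommRing A] {X : Scheme.{u}}
    (q : Spec (.of A) ⟶ X) {V : X.Opens} (hV : IsAffineOpen V) (h : ⊤ ≤ q ⁻¹ᵁ V) :
    Spec.map (CommRingCat.ofHom (eval q h)) ≫ hV.fromSpec = q := by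
  have h1 := hV.SpecMap_appLE_fromSpec q (isAffineOpen_top (Spec (.of A))) h
  have h2 : Spec.map (CommRingCat.ofHom (eval q h)) =
    Spec.map (ΓSpecIso (.of A)).hom ≫ Spec.map (q.appLE V ⊤ h) := by
    rw [← Spec.map_comp]; rfl
  rw [h2, Category.assoc, h1, IsAffineOpen.fromSpec_top, ← Category.assoc]
  simp [Scheme.isoSpec_Spec_inv]

end AlgebraicGeometry.Scheme

namespace SemiIntegral

open Scheme Scheme.IdealSheafData

variable {K : Type u} [Field K] [NumberField K]

namespace Model

variable {S : Set (HeightOneSpectrum (𝓞 K))} {Y X : Scheme.{u}} {strY : Y ⟶ Spec (.of K)}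
  {strX : X ⟶ Spec (.of K)} {MY : Model S strY} {MX : Model S strX}

/-- A section over the generic fibre is integral at almost all places. -/
theorem eventually_eval_mem {U : MX.total.Opens} (hU : IsAffineOpen U)
    (s : Γ(X, MX.gen ⁻¹ᵁ U)) : ∀ᶠ v : HeightOneSpectrum (𝓞 K) in Filter.cofinite,
      ∀ (hv : v ∉ S) (Q : Point strX (v.adicCompletion K)) (h : MX.closedPt hv Q ∈ U),
        eval Q.1 (top_le_preimage_of_closedPt_mem h) s ∈ v.adicCompletionIntegers K := by
  obtain ⟨a, ha, b, hb⟩ := MX.exists_scalar_mul_eq hU s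
  filter_upwards [eventually_isUnit_toLocal ha] with v hva hv Q h
  obtain ⟨w, hw⟩ := hva hv
  have h1 := algebraMap_eval_localPoint h b
  rw [hb, map_mul, eval_scalar_eq hv, ← hw] at h1
  set B := eval (MX.localPoint hv Q) (top_le_preimage_of_closedPoint_mem _ h) b
  have h2 : algebraMap (v.adicCompletionIntegers K) (v.adicCompletion K) (↑w⁻¹ * B) =
      eval Q.1 (top_le_preimage_of_closedPt_mem h) s := by
    rw [map_mul, h1, ← mul_assoc, ← map_mul, Units.inv_mul, map_one, one_mul]
  rw [← h2]
  exact Subtype.prop ((↑w⁻¹ : v.adicCompletionIntegers K) * B)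

theorem finiteType_scalar {V : MX.total.Opens} (hV : IsAffineOpen V) :
    (scalar MX.str V).FiniteType := by
  have h := MX.str.finiteType_appLE (isAffineOpen_top (Spec (.of (S.integer K)))) hV
    (show V ≤ MX.str ⁻¹ᵁ ⊤ from le_top)
  have h2 : Function.Surjective (ΓSpecIso (.of (S.integer K))).inv.hom :=
    (ConcreteCategory.bijective_of_isIso (ΓSpecIso (.of (S.integer K))).inv).2
  exact h.comp (RingHom.FiniteType.of_surjective _ h2)

variable (f : Y ⟶ X) (hf : f ≫ strX = strY)

include hf in
/-- Almost everywhere, `f` is compatible with given affine charts of the models. -/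
theorem eventually_closedPt_map_mem {U : MY.total.Opens} (hU : IsAffineOpen U)
    {V : MX.total.Opens} (hV : IsAffineOpen V) (hUV : MY.gen ⁻¹ᵁ U ≤ f ⁻¹ᵁ (MX.gen ⁻¹ᵁ V)) :
    ∀ᶠ v : HeightOneSpectrum (𝓞 K) in Filter.cofinite,
      ∀ (hv : v ∉ S) (Q : Point strY (v.adicCompletion K)), MY.closedPt hv Q ∈ U →
        MX.closedPt hv (Q.map f hf) ∈ V := by
  -- `θ` is `f` in coordinates, and its values may have denominators. The algebra of the chart `V`
  -- has finitely many generators over `𝒪_S`, so at almost all `v` all values at `Q` are integral.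
  -- They then define an `𝒪_v`-point of `V`, which is the one extending `f(Q)` by uniqueness.
  let θ : Γ(MX.total, V) →+* Γ(Y, MY.gen ⁻¹ᵁ U) :=
    (f.appLE (MX.gen ⁻¹ᵁ V) (MY.gen ⁻¹ᵁ U) hUV).hom.comp (MX.gen.app V).hom
  have hθ : ∀ r, θ (scalar MX.str V r) = scalar strY (MY.gen ⁻¹ᵁ U) (r : K) := by
    intro r
    change (f.appLE _ _ hUV).hom ((MX.gen.app V).hom _) = _
    rw [app_scalar, appLE_scalar, hf]
  let _ := (scalar MX.str V).toAlgebra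
  have : Algebra.FiniteType (S.integer K) Γ(MX.total, V) := finiteType_scalar hV
  obtain ⟨G, hG⟩ := this.out
  have h1 : ∀ᶠ v : HeightOneSpectrum (𝓞 K) in Filter.cofinite, ∀ c ∈ G,
      ∀ (hv : v ∉ S) (Q : Point strY (v.adicCompletion K)) (h : MY.closedPt hv Q ∈ U),
        eval Q.1 (top_le_preimage_of_closedPt_mem h) (θ c) ∈ v.adicCompletionIntegers K :=
    (Filter.eventually_all_finset G).2 fun c _ => eventually_eval_mem hU (θ c)
  filter_upwards [h1] with v hvG hv Q h
  let ev : Γ(MX.total, V) →+* v.adicCompletion K :=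
    (eval Q.1 (top_le_preimage_of_closedPt_mem h)).comp θ
  have hmem : ∀ c, ev c ∈ (v.adicCompletionIntegers K).toSubring := by
    intro c
    have hc : c ∈ Algebra.adjoin (S.integer K) (G : Set Γ(MX.total, V)) := by
      rw [hG]; trivial
    induction hc using Algebra.adjoin_induction with
    | mem x hx => exact hvG x hx hv Q h
    | algebraMap r =>
      change eval Q.1 _ (θ (scalar MX.str V r)) ∈ _
      rw [hθ, eval_scalar_eq hv]
      exact Subtype.prop _
    | add x y _ _ hx hy => rw [map_add]; exact add_mem hx hy
    | mul x y _ _ hx hy => rw [map_mul]; exact mul_mem hx hy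
  let φ : Γ(MX.total, V) →+* v.adicCompletionIntegers K :=
    RingHom.codRestrict ev (v.adicCompletionIntegers K) hmem
  let alg := algebraMap (v.adicCompletionIntegers K) (v.adicCompletion K)
  have hφ : alg.comp φ = ev := rfl
  let p : Spec (.of (v.adicCompletionIntegers K)) ⟶ MX.total :=
    Spec.map (CommRingCat.ofHom φ) ≫ hV.fromSpec
  have hP : ⊤ ≤ ((Q.map f hf).1 ≫ MX.gen) ⁻¹ᵁ V := by
    intro x hx
    exact hUV (top_le_preimage_of_closedPt_mem h hx)
  have hP' : ⊤ ≤ (Q.map f hf).1 ⁻¹ᵁ (MX.gen ⁻¹ᵁ V) := by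
    intro x hx
    exact hUV (top_le_preimage_of_closedPt_mem h hx)
  have hev : eval ((Q.map f hf).1 ≫ MX.gen) hP = ev := by
    refine RingHom.ext fun c => ?_
    rw [eval_comp _ _ le_rfl hP' hP, ← Scheme.Hom.app_eq_appLE]
    exact eval_comp Q.1 f hUV (top_le_preimage_of_closedPt_mem h) hP' _
  have hfac : Spec.map (CommRingCat.ofHom alg) ≫ p = (Q.map f hf).1 ≫ MX.gen := by
    rw [← eq_SpecMap_eval_comp_fromSpec _ hV hP, hev, ← hφ]
    simp only [p]
    rw [← Category.assoc, ← Spec.map_comp]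
    rfl
  -- Both sides are given by ring maps `𝒪_S → 𝒪_v`, which can be compared after the injection `𝒪_v →
  -- K_v`.
  have hstr : p ≫ MX.str = Spec.map (CommRingCat.ofHom (toLocal hv)) := by
    obtain ⟨m, hm⟩ := Spec.map_surjective (p ≫ MX.str)
    have h2 : Spec.map (CommRingCat.ofHom alg) ≫ Spec.map m =
        Spec.map (CommRingCat.ofHom alg) ≫ Spec.map (CommRingCat.ofHom (toLocal hv)) := by
      rw [hm, ← Category.assoc, hfac, Category.assoc, MX.isPullback.w, ← Category.assoc,
        (Q.map f hf).2, ← Spec.map_comp, ← Spec.map_comp]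
      rfl
    rw [← Spec.map_comp, ← Spec.map_comp] at h2
    have h3 := Spec.map_injective h2
    rw [← hm]
    exact congrArg Spec.map (CommRingCat.hom_ext (RingHom.ext fun r => Subtype.ext congr($h3 r)))
  have hpV : p (IsLocalRing.closedPoint (v.adicCompletionIntegers K)) ∈ V := by
    have : p (IsLocalRing.closedPoint (v.adicCompletionIntegers K)) ∈ Set.range hV.fromSpec :=
      ⟨_, rfl⟩
    rwa [hV.range_fromSpec] at this
  rw [closedPt, ← eq_localPoint hv (Q.map f hf) hfac hstr]
  exact hpV

end Model

end SemiIntegral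

/-! ### From inclusions of ideals to inequalities of multiplicities, near one point. -/

namespace SemiIntegral

open Scheme Scheme.IdealSheafData

variable {K : Type u} [Field K] [NumberField K]

namespace Model

variable {S : Set (HeightOneSpectrum (𝓞 K))} {X : Scheme.{u}} {strX : X ⟶ Spec (.of K)}
  (M : Model S strX)

theorem gen_mem_closure {Z : Set X} {x : X} (hx : x ∈ Z) : M.gen x ∈ M.closure Z :=
  subset_closure (Set.mem_image_of_mem _ hx)

/-- The affine open subset of the generic fibre defined by an affine open subset of the model. -/
def genericOpen (U : M.total.affineOpens) : X.affineOpens :=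
  ⟨M.gen ⁻¹ᵁ U.1, U.2.preimage M.gen⟩

/-- Affine open subsets of the model induce a basis of the topology of the generic fibre. -/
theorem exists_genericOpen_le {x : X} {O : X.Opens} (hx : x ∈ O) :
    ∃ U : M.total.affineOpens, M.gen x ∈ U.1 ∧ (M.genericOpen U).1 ≤ O := by
  have h := M.gen.isEmbedding.isInducing
  obtain ⟨O', hO', hOO'⟩ := h.isOpen_iff.1 O.2
  have hx' : M.gen x ∈ (⟨O', hO'⟩ : M.total.Opens) := by
    have : x ∈ M.gen ⁻¹' O' := by rw [hOO']; exact hx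
    exact this
  obtain ⟨U, hU, hxU, hle⟩ := exists_isAffineOpen_mem_and_subset hx'
  refine ⟨⟨U, hU⟩, hxU, fun z hz => ?_⟩
  have : z ∈ M.gen ⁻¹' O' := hle hz
  rw [hOO'] at this
  exact this

theorem app_mem_vanishingIdeal {Z : Closeds X} {V : M.total.affineOpens} {d : Γ(M.total, V.1)}
    (hd : d ∈ (vanishingIdeal (M.closure Z)).ideal V) :
    (M.gen.app V.1).hom d ∈ (vanishingIdeal Z).ideal (M.genericOpen V) := by
  rw [mem_vanishingIdeal_iff] at hd
  refine (mem_vanishingIdeal_iff Z (M.genericOpen V) _).2 fun x hx hxV hxd => ?_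
  refine hd (M.gen x) (M.gen_mem_closure hx) hxV ?_
  have := Scheme.preimage_basicOpen M.gen d
  exact this.ge hxd

/-- A basic open set meeting the closure of `Z` already meets `Z`, so vanishing can be checked on
the generic fibre. -/
theorem mem_vanishingIdeal_closure {Z : Closeds X} {V : M.total.affineOpens} {d : Γ(M.total, V.1)}
    (hd : (M.gen.app V.1).hom d ∈ (vanishingIdeal Z).ideal (M.genericOpen V)) :
    d ∈ (vanishingIdeal (M.closure Z)).ideal V := by
  replace hd := (mem_vanishingIdeal_iff Z (M.genericOpen V) _).1 hd
  rw [mem_vanishingIdeal_iff]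
  intro x hx hxV hxd
  obtain ⟨_, hz, z, hzZ, rfl⟩ := mem_closure_iff.1 hx _ (M.total.basicOpen d).2 hxd
  refine hd z hzZ ?_ ?_
  · exact M.total.basicOpen_le d hz
  · exact (Scheme.preimage_basicOpen M.gen d).le hz

theorem isUnit_scalar {R : Type u} [Field R] {W : Scheme.{u}} (a : W ⟶ Spec (.of R)) (U : W.Opens)
    {r : R} (hr : r ≠ 0) : IsUnit (scalar a U r) :=
  (IsUnit.mk0 r hr).map _

/-- Clearing denominators multiplies a section by a unit of the generic fibre, which affects neither
its vanishing on `Z` nor its membership in an ideal. -/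
theorem vanishingIdeal_genericOpen_le (Z : Closeds X) (V : M.total.affineOpens) :
    (vanishingIdeal Z).ideal (M.genericOpen V) ≤
      ((vanishingIdeal (M.closure Z)).ideal V).map (M.gen.app V.1).hom := by
  intro s hs
  obtain ⟨a, ha, b, hb⟩ := M.exists_scalar_mul_eq V.2 s
  have h1 : b ∈ (vanishingIdeal (M.closure Z)).ideal V := by
    apply M.mem_vanishingIdeal_closure
    rw [hb]
    exact Ideal.mul_mem_left _ _ hs
  have h2 := Ideal.mem_map_of_mem (M.gen.app V.1).hom h1
  rw [hb] at h2
  exact (Ideal.unit_mul_mem_iff_mem _ (isUnit_scalar strX _ (by simpa using ha))).1 h2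

theorem isNoetherianRing_section (hS : S.Finite) {V : M.total.Opens} (hV : IsAffineOpen V) :
    IsNoetherianRing Γ(M.total, V) := by
  have := Set.isNoetherianRing_integer (K := K) hS
  let _ := (scalar M.str V).toAlgebra
  have : Algebra.FiniteType (S.integer K) Γ(M.total, V) := finiteType_scalar hV
  exact Algebra.FiniteType.isNoetherianRing (S.integer K) _

theorem isNoetherian_total (hS : S.Finite) : IsNoetherian M.total := by
  have := Set.isNoetherianRing_integer (K := K) hS
  have : IsNoetherianRing (CommRingCat.of (S.integer K)) := this
  have : IsLocallyNoetherian M.total := LocallyOfFiniteType.isLocallyNoetherian M.str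
  have : CompactSpace M.total := QuasiCompact.compactSpace_of_compactSpace M.str
  exact {}

section Comparison

variable {Y X' : Scheme.{u}} {strY : Y ⟶ Spec (.of K)} {strX' : X' ⟶ Spec (.of K)}
  {MY : Model S strY} {MX : Model S strX} {MX' : Model S strX'}

theorem natCast_le_multiplicity {v : HeightOneSpectrum (𝓞 K)} {hv : v ∉ S}
    {P : Point strX (v.adicCompletion K)} (Z : Closeds MX.total) (V : MX.total.affineOpens)
    (h : MX.closedPt hv P ∈ V.1) (n : ℕ) :
    (n : ℕ∞) ≤ MX.multiplicity hv Z P ↔ ∀ d ∈ (vanishingIdeal Z).ideal V,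
      eval (MX.localPoint hv P) (top_le_preimage_of_closedPoint_mem _ h) d ∈
        IsLocalRing.maximalIdeal (v.adicCompletionIntegers K) ^ n :=
  natCast_le_pullbackOrder_closedPoint _ Z V _ n

/-- Only `a = ⊤` needs an argument: for `t > 0` the hypothesis makes `b` larger than every integer.
-/
theorem _root_.ENat.natCast_mul_le_of_forall {t : ℕ} {a b : ℕ∞}
    (h : ∀ n : ℕ, (n : ℕ∞) ≤ a → ((t * n : ℕ) : ℕ∞) ≤ b) : (t : ℕ∞) * a ≤ b := by
  rcases Nat.eq_zero_or_pos t with rfl | ht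
  · simp
  induction a with
  | top =>
    have : b = ⊤ := by
      rw [ENat.eq_top_iff_forall_ge]
      intro m
      refine le_trans ?_ (h m le_top)
      exact_mod_cast Nat.le_mul_of_pos_left m ht
    simp [this]
  | coe a => exact_mod_cast h a le_rfl

variable (hS : S.Finite) (f : Y ⟶ X) (hf : f ≫ strX = strY) (g : Y ⟶ X') (hg : g ≫ strX' = strY)

omit [NumberField K] in
theorem eval_map {L : Type u} [Field L] [Algebra K L] (Q : Point strY L) {U : Y.Opens}
    {V : X.Opens} (h : U ≤ f ⁻¹ᵁ V) (hU : ⊤ ≤ Q.1 ⁻¹ᵁ U) (hV : ⊤ ≤ (Q.map f hf).1 ⁻¹ᵁ V)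
    (s : Γ(X, V)) : eval (Q.map f hf).1 hV s = eval Q.1 hU ((f.appLE V U h).hom s) :=
  eval_comp Q.1 f h hU hV s

include hf hg hS in
/-- If the inverse image of `Z` is contained, near `y`, in the `t`-th power of the inverse image of
`W`, then the same holds for the multiplicities of almost all local points near `y`. -/
theorem exists_eventually_mul_multiplicity_le (Z : Closeds X) (W : Closeds X') (t : ℕ) (y : Y)
    (h : ∃ U' : Y.affineOpens, y ∈ U'.1 ∧ ((vanishingIdeal Z).comap f).ideal U' ≤
      ((vanishingIdeal W).comap g).ideal U' ^ t) :
    ∃ U : MY.total.Opens, MY.gen y ∈ U ∧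
      ∀ᶠ v : HeightOneSpectrum (𝓞 K) in Filter.cofinite,
        ∀ (hv : v ∉ S) (Q : Point strY (v.adicCompletion K)), MY.closedPt hv Q ∈ U →
          (t : ℕ∞) * MX'.multiplicity hv (MX'.closure W) (Q.map g hg) ≤
            MX.multiplicity hv (MX.closure Z) (Q.map f hf) := by
  obtain ⟨U', hyU', hU'⟩ := h
  obtain ⟨V, hyV, -⟩ := MX.exists_genericOpen_le (x := f y) (O := ⊤) trivial
  obtain ⟨V', hyV', -⟩ := MX'.exists_genericOpen_le (x := g y) (O := ⊤) trivial
  obtain ⟨U, hyU, hU⟩ := MY.exists_genericOpen_le (x := y)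
    (O := U'.1 ⊓ (f ⁻¹ᵁ (MX.genericOpen V).1 ⊓ g ⁻¹ᵁ (MX'.genericOpen V').1))
    ⟨hyU', hyV, hyV'⟩
  have hUU' : MY.genericOpen U ≤ U' := hU.trans inf_le_left
  have hUV : (MY.genericOpen U).1 ≤ f ⁻¹ᵁ (MX.genericOpen V).1 :=
    hU.trans (inf_le_right.trans inf_le_left)
  have hUV' : (MY.genericOpen U).1 ≤ g ⁻¹ᵁ (MX'.genericOpen V').1 :=
    hU.trans (inf_le_right.trans inf_le_right)
  refine ⟨U.1, hyU, ?_⟩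
  -- the inclusion of ideals on the chart
  have hI : ((vanishingIdeal Z).comap f).ideal (MY.genericOpen U) ≤
      ((vanishingIdeal W).comap g).ideal (MY.genericOpen U) ^ t := by
    rw [← map_ideal ((vanishingIdeal Z).comap f) hUU',
      ← map_ideal ((vanishingIdeal W).comap g) hUU', ← Ideal.map_pow]
    exact Ideal.map_mono hU'
  let θ : Γ(MX.total, V.1) →+* Γ(Y, (MY.genericOpen U).1) :=
    (f.appLE _ _ hUV).hom.comp (MX.gen.app V.1).hom
  let θ' : Γ(MX'.total, V'.1) →+* Γ(Y, (MY.genericOpen U).1) :=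
    (g.appLE _ _ hUV').hom.comp (MX'.gen.app V'.1).hom
  let IZ := (vanishingIdeal (MX.closure Z)).ideal V
  let IW := (vanishingIdeal (MX'.closure W)).ideal V'
  -- The ideal of the closure of `W` in the model generates that of `W` on the generic fibre. The
  -- hypothesis thus writes each element of `IZ` as a finite combination of elements of `IW ^ t`,
  -- with coefficients on the generic chart that are integral at almost all places.
  have hθ : IZ.map θ ≤ (IW ^ t).map θ' := by
    have h1 : IZ.map θ ≤ ((vanishingIdeal Z).comap f).ideal (MY.genericOpen U) := by
      rw [ideal_comap f _ _ (MX.genericOpen V) hUV]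
      refine (Ideal.map_map (I := IZ) (MX.gen.app V.1).hom (f.appLE _ _ hUV).hom).ge.trans
        (Ideal.map_mono ?_)
      exact Ideal.map_le_iff_le_comap.2 fun d hd => MX.app_mem_vanishingIdeal hd
    have h2 : ((vanishingIdeal W).comap g).ideal (MY.genericOpen U) ≤ IW.map θ' := by
      rw [ideal_comap g _ _ (MX'.genericOpen V') hUV']
      exact (Ideal.map_mono (MX'.vanishingIdeal_genericOpen_le W V')).trans
        (Ideal.map_map (I := IW) (MX'.gen.app V'.1).hom (g.appLE _ _ hUV').hom).le
    rw [Ideal.map_pow]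
    exact h1.trans (hI.trans (Ideal.pow_right_mono h2 t))
  have hfV := eventually_closedPt_map_mem (MX := MX) f hf U.2 V.2 hUV
  have hgV' := eventually_closedPt_map_mem (MX := MX') g hg U.2 V'.2 hUV'
  -- the integrality of elements of the ideal generated by `IW ^ t`
  have hmem : ∀ c ∈ (IW ^ t).map θ', ∀ᶠ v : HeightOneSpectrum (𝓞 K) in Filter.cofinite,
      ∀ (hv : v ∉ S) (Q : Point strY (v.adicCompletion K)) (hQ : MY.closedPt hv Q ∈ U.1) (n : ℕ),
        (n : ℕ∞) ≤ MX'.multiplicity hv (MX'.closure W) (Q.map g hg) →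
          ∃ e ∈ IsLocalRing.maximalIdeal (v.adicCompletionIntegers K) ^ (t * n),
            algebraMap (v.adicCompletionIntegers K) (v.adicCompletion K) e =
              eval Q.1 (top_le_preimage_of_closedPt_mem hQ) c := by
    intro c hc
    induction hc using Submodule.span_induction with
    | zero =>
      refine Filter.Eventually.of_forall fun v hv Q hQ n _ => ⟨0, zero_mem _, ?_⟩
      rw [map_zero]
      exact (map_zero (eval Q.1 _)).symm
    | add x y _ _ hx hy =>
      filter_upwards [hx, hy] with v hx hy hv Q hQ n hn
      obtain ⟨e, he, h⟩ := hx hv Q hQ n hn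
      obtain ⟨e', he', h'⟩ := hy hv Q hQ n hn
      exact ⟨e + e', add_mem he he', by
        rw [map_add, h, h']
        exact (map_add (eval Q.1 _) x y).symm⟩
    | smul a x _ hx =>
      filter_upwards [hx, eventually_eval_mem U.2 a] with v hx ha hv Q hQ n hn
      obtain ⟨e, he, h⟩ := hx hv Q hQ n hn
      refine ⟨⟨_, ha hv Q hQ⟩ * e, Ideal.mul_mem_left _ _ he, ?_⟩
      rw [map_mul, h]
      exact (map_mul (eval Q.1 _) a x).symm
    | mem x hx =>
      obtain ⟨d, hd, rfl⟩ := hx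
      filter_upwards [hgV'] with v hgV' hv Q hQ n hn
      have hP := hgV' hv Q hQ
      rw [natCast_le_multiplicity _ V' hP] at hn
      refine ⟨eval (MX'.localPoint hv (Q.map g hg)) (top_le_preimage_of_closedPoint_mem _ hP) d,
        ?_, ?_⟩
      -- A product of `t` elements with values in `𝔪ⁿ` has its value in `𝔪ᵗⁿ`.
      · have h1 : IW ≤ (IsLocalRing.maximalIdeal (v.adicCompletionIntegers K) ^ n).comap
            (eval (MX'.localPoint hv (Q.map g hg)) (top_le_preimage_of_closedPoint_mem _ hP)) := hn
        have h2 := (Ideal.pow_right_mono h1 t).trans (Ideal.le_comap_pow _ t) hd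
        rw [Ideal.mem_comap, ← pow_mul, mul_comm n t] at h2
        exact h2
      · rw [algebraMap_eval_localPoint hP]
        exact (eval_map g hg Q hUV' (top_le_preimage_of_closedPt_mem hQ)
          (top_le_preimage_of_closedPt_mem hP) ((MX'.gen.app V'.1).hom d))
  -- finitely many generators of `IZ`
  have : IsNoetherianRing Γ(MX.total, V.1) := MX.isNoetherianRing_section hS V.2
  obtain ⟨G, hG⟩ : IZ.FG := IsNoetherian.noetherian IZ
  have hall : ∀ᶠ v : HeightOneSpectrum (𝓞 K) in Filter.cofinite, ∀ d ∈ G,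
      ∀ (hv : v ∉ S) (Q : Point strY (v.adicCompletion K)) (hQ : MY.closedPt hv Q ∈ U.1) (n : ℕ),
        (n : ℕ∞) ≤ MX'.multiplicity hv (MX'.closure W) (Q.map g hg) →
          ∃ e ∈ IsLocalRing.maximalIdeal (v.adicCompletionIntegers K) ^ (t * n),
            algebraMap (v.adicCompletionIntegers K) (v.adicCompletion K) e =
              eval Q.1 (top_le_preimage_of_closedPt_mem hQ) (θ d) :=
    (Filter.eventually_all_finset G).2 fun d hd =>
      hmem _ (hθ (Ideal.mem_map_of_mem _ (hG ▸ Ideal.subset_span hd)))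
  filter_upwards [hfV, hall] with v hfV hall hv Q hQ
  refine ENat.natCast_mul_le_of_forall fun n hn => ?_
  have hP := hfV hv Q hQ
  rw [natCast_le_multiplicity _ V hP]
  have h1 : IZ ≤ (IsLocalRing.maximalIdeal (v.adicCompletionIntegers K) ^ (t * n)).comap
      (eval (MX.localPoint hv (Q.map f hf)) (top_le_preimage_of_closedPoint_mem _ hP)) := by
    rw [← hG]
    refine Ideal.span_le.2 fun d hd => ?_
    obtain ⟨e, he, h⟩ := hall d hd hv Q hQ n hn
    have h2 : eval (MX.localPoint hv (Q.map f hf)) (top_le_preimage_of_closedPoint_mem _ hP) d =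
        e := by
      apply FaithfulSMul.algebraMap_injective (v.adicCompletionIntegers K) (v.adicCompletion K)
      rw [h, algebraMap_eval_localPoint hP]
      exact (eval_map f hf Q hUV (top_le_preimage_of_closedPt_mem hQ)
        (top_le_preimage_of_closedPt_mem hP) ((MX.gen.app V.1).hom d))
    rw [SetLike.mem_coe, Ideal.mem_comap, h2]
    exact he
  exact h1

end Comparison

end Model

end SemiIntegral

/-! ### From neighbourhoods of points of the generic fibre to almost all places. -/

theorem AlgebraicGeometry.Scheme.IdealSheafData.ideal_eq_top_of_disjoint {X : Scheme.{u}}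
    (J : X.IdealSheafData) {U : X.affineOpens} (h : ∀ x ∈ U.1, x ∉ J.support) :
    J.ideal U = ⊤ := by
  rw [← PrimeSpectrum.zeroLocus_empty_iff_eq_top, ← U.2.fromSpec_preimage_zeroLocus]
  refine Set.eq_empty_of_forall_notMem fun p hp => ?_
  have hpU : U.2.fromSpec p ∈ U.1 := by
    have : U.2.fromSpec p ∈ Set.range U.2.fromSpec := ⟨p, rfl⟩
    rwa [U.2.range_fromSpec] at this
  exact h _ hpU ((mem_support_iff_of_mem hpU).2 hp)

namespace SemiIntegral

open Scheme Scheme.IdealSheafData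

variable {K : Type u} [Field K] [NumberField K]

namespace Model

variable {S : Set (HeightOneSpectrum (𝓞 K))} {X : Scheme.{u}} {strX : X ⟶ Spec (.of K)}
  (M : Model S strX)

/-- A closed subset of an affine open subset of the model which does not meet the generic fibre lies
over finitely many places. -/
theorem exists_scalar_mem_vanishingIdeal (U : M.total.affineOpens) (C : Closeds M.total)
    (h : ∀ x ∈ (M.genericOpen U).1, M.gen x ∉ C) :
    ∃ a : S.integer K, a ≠ 0 ∧ scalar M.str U.1 a ∈ (vanishingIdeal C).ideal U := by
  let _ := (M.gen.app U.1).hom.toAlgebra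
  have hloc := M.isLocalization_app U.2
  have h1 : ((vanishingIdeal C).comap M.gen).ideal (M.genericOpen U) =
      ((vanishingIdeal C).ideal U).map (M.gen.app U.1).hom := by
    rw [ideal_comap M.gen _ _ U le_rfl, Scheme.Hom.app_eq_appLE]
    rfl
  have h2 : ((vanishingIdeal C).comap M.gen).ideal (M.genericOpen U) = ⊤ := by
    refine ideal_eq_top_of_disjoint _ fun x hx hxC => h x hx ?_
    rw [support_comap] at hxC
    have : M.gen x ∈ ((vanishingIdeal C).support : Set M.total) := hxC
    rwa [coe_support_vanishingIdeal] at this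
  rw [h1] at h2
  -- An ideal that becomes the unit ideal after inverting the non-zero scalars contains one of them.
  have h3 : ¬ Disjoint _ _ := fun hd => (IsLocalization.map_algebraMap_ne_top_iff_disjoint
    ((nonZeroDivisors (S.integer K)).map (scalar M.str U.1)) Γ(X, M.gen ⁻¹ᵁ U.1)
    ((vanishingIdeal C).ideal U)).2 hd h2
  obtain ⟨_, ⟨a, ha, rfl⟩, hI⟩ := Set.not_disjoint_iff.1 h3
  exact ⟨a, nonZeroDivisors.ne_zero ha, hI⟩

/-- A property of local points which holds for almost all points near each point of `X ∖ N` holds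
for almost all points outside the closure of `N`. -/
theorem eventually_of_forall_exists (hS : S.Finite) (N : Closeds X)
    (p : ∀ v : HeightOneSpectrum (𝓞 K), v ∉ S → Point strX (v.adicCompletion K) → Prop)
    (h : ∀ x ∉ N, ∃ U : M.total.Opens, M.gen x ∈ U ∧
      ∀ᶠ v : HeightOneSpectrum (𝓞 K) in Filter.cofinite, ∀ (hv : v ∉ S)
        (Q : Point strX (v.adicCompletion K)), M.closedPt hv Q ∈ U → p v hv Q) :
    ∀ᶠ v : HeightOneSpectrum (𝓞 K) in Filter.cofinite, ∀ (hv : v ∉ S)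
      (Q : Point strX (v.adicCompletion K)), M.closedPt hv Q ∉ M.closure N → p v hv Q := by
  have := M.isNoetherian_total hS
  let good (O : M.total.Opens) : Prop :=
    ∀ᶠ v : HeightOneSpectrum (𝓞 K) in Filter.cofinite, ∀ (hv : v ∉ S)
      (Q : Point strX (v.adicCompletion K)), M.closedPt hv Q ∈ O → p v hv Q
  -- by quasi-compactness, an open subset covered by good ones is good
  have hgood : ∀ O : M.total.Opens, (∀ x ∈ O, ∃ U : M.total.Opens, x ∈ U ∧ good U) → good O := by
    intro O hO
    choose! U hxU hU using hO
    obtain ⟨s, hs⟩ := (NoetherianSpace.isCompact (O : Set M.total)).elim_nhds_subcover'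
      (fun x hx => (U x : Set M.total)) fun x hx => (U x).2.mem_nhds (hxU x hx)
    have h1 : ∀ᶠ v : HeightOneSpectrum (𝓞 K) in Filter.cofinite, ∀ x ∈ s, ∀ (hv : v ∉ S)
        (Q : Point strX (v.adicCompletion K)), M.closedPt hv Q ∈ U x.1 → p v hv Q :=
      (Filter.eventually_all_finset s).2 fun x _ => hU x x.2
    filter_upwards [h1] with v h1 hv Q hQ
    obtain ⟨x, hx, hxQ⟩ := Set.mem_iUnion₂.1 (hs hQ)
    exact h1 x hx hv Q hxQ
  -- `𝒰` is the largest good open set, and it contains the image of `X ∖ N`. In an affine open set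
  -- disjoint from the closure of `N`, what `𝒰` misses lies off the generic fibre, so a non-zero
  -- scalar vanishes there. Where that scalar is a unit, no local point reduces to the missing part.
  let 𝒰 : M.total.Opens := sSup {U | good U}
  have h𝒰 : good 𝒰 := hgood _ fun x hx => by
    obtain ⟨U, hU, hxU⟩ := Opens.mem_sSup.1 hx
    exact ⟨U, hxU, hU⟩
  have hmain : good (M.closure N).compl := by
    refine hgood _ fun x hx => ?_
    obtain ⟨U, hU, hxU, hle⟩ := exists_isAffineOpen_mem_and_subset hx
    refine ⟨U, hxU, ?_⟩
    obtain ⟨a, ha, haC⟩ := M.exists_scalar_mem_vanishingIdeal ⟨U, hU⟩ 𝒰.compl (by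
      intro y hy hyC
      have hyN : y ∉ N := fun hyN => hle hy (M.gen_mem_closure hyN)
      obtain ⟨U', hyU', hU'⟩ := h y hyN
      exact hyC (Opens.mem_sSup.2 ⟨U', hU', hyU'⟩))
    filter_upwards [h𝒰, eventually_isUnit_toLocal ha] with v h1 h2 hv Q hQ
    refine h1 hv Q ?_
    by_contra hC
    rw [mem_vanishingIdeal_iff] at haC
    refine haC _ hC hQ ?_
    refine (closedPoint_mem_basicOpen_iff (M.localPoint hv Q)
      (top_le_preimage_of_closedPoint_mem _ hQ) _).2 ?_
    rw [eval_scalar _ M.str _ (localPoint_str hv Q)]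
    exact h2 hv
  filter_upwards [hmain] with v h hv Q hQ
  exact h hv Q hQ

end Model

end SemiIntegral

/-! ### Comparison of multiplicities at almost all places. -/

namespace SemiIntegral

open Scheme Scheme.IdealSheafData

variable {K : Type u} [Field K] [NumberField K]

namespace Model

variable {S : Set (HeightOneSpectrum (𝓞 K))} {X X' Y : Scheme.{u}} {strX : X ⟶ Spec (.of K)}
  {strX' : X' ⟶ Spec (.of K)} {strY : Y ⟶ Spec (.of K)}
  {MX : Model S strX} {MX' : Model S strX'} {MY : Model S strY}

/-- Multiplicity at least one means that sections vanishing on `Z` take non-unit values, which says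
that they vanish at the image of the closed point. -/
theorem one_le_multiplicity_iff {v : HeightOneSpectrum (𝓞 K)} {hv : v ∉ S}
    {P : Point strX (v.adicCompletion K)} {Z : Closeds MX.total} :
    1 ≤ MX.multiplicity hv Z P ↔ MX.closedPt hv P ∈ Z := by
  obtain ⟨V, hV, hPV, -⟩ := exists_isAffineOpen_mem_and_subset (x := MX.closedPt hv P) (U := ⊤)
    trivial
  have h := natCast_le_multiplicity Z ⟨V, hV⟩ hPV 1
  rw [Nat.cast_one] at h
  rw [h]
  have hsupp : MX.closedPt hv P ∈ Z ↔ MX.closedPt hv P ∈ (vanishingIdeal Z).support := by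
    change _ ↔ _ ∈ ((vanishingIdeal Z).support : Set MX.total)
    rw [coe_support_vanishingIdeal]
    rfl
  rw [hsupp, mem_support_iff_of_mem (U := ⟨V, hV⟩) hPV, Scheme.mem_zeroLocus_iff]
  refine forall₂_congr fun c _ => ?_
  rw [pow_one]
  have := closedPoint_mem_basicOpen_iff (MX.localPoint hv P)
    (top_le_preimage_of_closedPoint_mem _ hPV) c
  rw [← IsLocalRing.notMem_maximalIdeal] at this
  exact (not_iff_comm.1 this.symm).symm.trans Iff.rfl

theorem multiplicity_eq_zero_iff {v : HeightOneSpectrum (𝓞 K)} {hv : v ∉ S}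
    {P : Point strX (v.adicCompletion K)} {Z : Closeds MX.total} :
    MX.multiplicity hv Z P = 0 ↔ MX.closedPt hv P ∉ Z := by
  rw [← one_le_multiplicity_iff, Order.one_le_iff_ne_zero, not_not]

theorem mem_closedPt_of_range {v : HeightOneSpectrum (𝓞 K)} {hv : v ∉ S}
    {P : Point strX (v.adicCompletion K)} {Z : Set MX.total} (hZ : IsClosed Z) :
    Disjoint (Set.range (MX.localPoint hv P)) Z ↔ MX.closedPt hv P ∉ Z := by
  constructor
  · intro h hP
    exact Set.disjoint_left.1 h ⟨_, rfl⟩ hP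
  · intro h
    rw [Set.disjoint_left]
    rintro _ ⟨x, rfl⟩ hx
    have : x ⤳ IsLocalRing.closedPoint (v.adicCompletionIntegers K) :=
      IsLocalRing.specializes_closedPoint x
    exact h ((this.map (MX.localPoint hv P).continuous).mem_closed hZ hx)

variable (hS : S.Finite) (f : Y ⟶ X) (hf : f ≫ strX = strY) (g : Y ⟶ X') (hg : g ≫ strX' = strY)

include hS in
/-- Comparison of multiplicities at almost all places: if locally on `Y ∖ N` the inverse image of
`Z` is contained in the `t`-th power of the inverse image of `W`, then the multiplicity of `Z` is at
least `t` times that of `W` at local points outside the closure of `N`. -/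
theorem eventually_mul_multiplicity_le (N : Closeds Y) (Z : Closeds X) (W : Closeds X') (t : ℕ)
    (h : ∀ y ∉ N, ∃ U' : Y.affineOpens, y ∈ U'.1 ∧ ((vanishingIdeal Z).comap f).ideal U' ≤
      ((vanishingIdeal W).comap g).ideal U' ^ t) :
    ∀ᶠ v : HeightOneSpectrum (𝓞 K) in Filter.cofinite,
      ∀ (hv : v ∉ S) (Q : Point strY (v.adicCompletion K)), MY.closedPt hv Q ∉ MY.closure N →
        (t : ℕ∞) * MX'.multiplicity hv (MX'.closure W) (Q.map g hg) ≤
          MX.multiplicity hv (MX.closure Z) (Q.map f hf) :=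
  MY.eventually_of_forall_exists hS N _ fun y hy =>
    exists_eventually_mul_multiplicity_le hS f hf g hg Z W t y (h y hy)

theorem closedPt_notMem_closure_bot {v : HeightOneSpectrum (𝓞 K)} {hv : v ∉ S}
    {P : Point strX (v.adicCompletion K)} :
    MX.closedPt hv P ∉ MX.closure ((⊥ : Closeds X) : Set X) := by
  intro h
  simp [Model.closure] at h

include hS in
/-- The inequality of multiplicities given by an inclusion `f⁻¹(Z) ⊆ W` to the order `t`. -/
theorem eventually_mul_multiplicity_le_map (Z : Closeds X) (W : Closeds Y) (t : ℕ)
    (h : ∀ y, ∃ U' : Y.affineOpens, y ∈ U'.1 ∧ ((vanishingIdeal Z).comap f).ideal U' ≤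
      (vanishingIdeal W).ideal U' ^ t) :
    ∀ᶠ v : HeightOneSpectrum (𝓞 K) in Filter.cofinite,
      ∀ (hv : v ∉ S) (Q : Point strY (v.adicCompletion K)),
        (t : ℕ∞) * MY.multiplicity hv (MY.closure W) Q ≤
          MX.multiplicity hv (MX.closure Z) (Q.map f hf) := by
  have h1 := eventually_mul_multiplicity_le (MY := MY) (MX := MX) (MX' := MY) hS f hf (𝟙 Y)
    (Category.id_comp _) ⊥ Z W t (by simpa only [comap_id] using fun y _ => h y)
  filter_upwards [h1] with v h1 hv Q
  have h2 := h1 hv Q closedPt_notMem_closure_bot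
  rwa [show Q.map (𝟙 Y) (Category.id_comp _) = Q from Subtype.ext (Category.comp_id _)] at h2

-- The general comparison with the identity in the role of `f` and `f` in the role of `g`: the
-- opposite inclusion of ideals bounds multiplicities downstairs from above.
include hS in
theorem eventually_multiplicity_map_le (N : Closeds Y) (Z : Closeds X) (W : Closeds Y)
    (h : ∀ y ∉ N, ∃ U' : Y.affineOpens, y ∈ U'.1 ∧ (vanishingIdeal W).ideal U' ≤
      ((vanishingIdeal Z).comap f).ideal U') :
    ∀ᶠ v : HeightOneSpectrum (𝓞 K) in Filter.cofinite,
      ∀ (hv : v ∉ S) (Q : Point strY (v.adicCompletion K)), MY.closedPt hv Q ∉ MY.closure N →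
        MX.multiplicity hv (MX.closure Z) (Q.map f hf) ≤
          MY.multiplicity hv (MY.closure W) Q := by
  have h1 := eventually_mul_multiplicity_le (MY := MY) (MX := MY) (MX' := MX) hS (𝟙 Y)
    (Category.id_comp _) f hf N W Z 1 (by simpa only [comap_id, pow_one] using h)
  filter_upwards [h1] with v h1 hv Q hQ
  have h2 := h1 hv Q hQ
  rwa [show Q.map (𝟙 Y) (Category.id_comp _) = Q from Subtype.ext (Category.comp_id _),
    Nat.cast_one, one_mul] at h2

theorem _root_.AlgebraicGeometry.Scheme.exists_affineOpens_le {y : Y} {O : Y.Opens} (hy : y ∈ O) :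
    ∃ U : Y.affineOpens, y ∈ U.1 ∧ U.1 ≤ O := by
  obtain ⟨U, hU, hyU, hle⟩ := exists_isAffineOpen_mem_and_subset hy
  exact ⟨⟨U, hU⟩, hyU, hle⟩

theorem _root_.AlgebraicGeometry.Scheme.IdealSheafData.exists_ideal_comap_eq_top (Z : Closeds X)
    {y : Y} (hy : f y ∉ Z) {O : Y.Opens} (hyO : y ∈ O) :
    ∃ U' : Y.affineOpens, y ∈ U'.1 ∧ U'.1 ≤ O ∧ ((vanishingIdeal Z).comap f).ideal U' = ⊤ := by
  obtain ⟨U, hyU, hU⟩ := exists_affineOpens_le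
    (show y ∈ (Z.preimage f.continuous).compl ⊓ O from ⟨hy, hyO⟩)
  refine ⟨U, hyU, hU.trans inf_le_right, ideal_eq_top_of_disjoint _ fun x hx hxZ => ?_⟩
  rw [support_comap] at hxZ
  have h1 : f x ∈ ((vanishingIdeal Z).support : Set X) := hxZ
  rw [coe_support_vanishingIdeal] at h1
  exact (hU hx).1 h1

include hS in
/-- Almost everywhere, local points meeting `Z` come from local points meeting `f⁻¹(Z)`. -/
theorem eventually_multiplicity_map_eq_zero (N : Closeds Y) (Z : Closeds X)
    (h : ∀ y, f y ∈ Z → y ∈ N) :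
    ∀ᶠ v : HeightOneSpectrum (𝓞 K) in Filter.cofinite,
      ∀ (hv : v ∉ S) (Q : Point strY (v.adicCompletion K)), MY.closedPt hv Q ∉ MY.closure N →
        MX.multiplicity hv (MX.closure Z) (Q.map f hf) = 0 := by
  have h1 := eventually_multiplicity_map_le (MY := MY) (MX := MX) hS f hf N Z ⊥ (by
    intro y hy
    obtain ⟨U, hyU, -, hU⟩ := exists_ideal_comap_eq_top f Z (fun hZ => hy (h y hZ))
      (O := ⊤) trivial
    exact ⟨U, hyU, hU ▸ le_top⟩)
  filter_upwards [h1] with v h1 hv Q hQ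
  have h2 := h1 hv Q hQ
  rw [multiplicity_eq_zero_iff.2 closedPt_notMem_closure_bot] at h2
  exact nonpos_iff_eq_zero.1 h2

-- As `W` carries its reduced structure, the set-theoretic inclusion `f(W) ⊆ Z` already puts the
-- ideal of `f⁻¹(Z)` in that of `W`. No open subset of `Y` has to be removed.
include hS in
theorem eventually_multiplicity_le_map (Z : Closeds X) (W : Closeds Y) (h : ∀ y ∈ W, f y ∈ Z) :
    ∀ᶠ v : HeightOneSpectrum (𝓞 K) in Filter.cofinite,
      ∀ (hv : v ∉ S) (Q : Point strY (v.adicCompletion K)),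
        MY.multiplicity hv (MY.closure W) Q ≤
          MX.multiplicity hv (MX.closure Z) (Q.map f hf) := by
  have hle : (vanishingIdeal Z).comap f ≤ vanishingIdeal W := by
    rw [← le_support_iff_le_vanishingIdeal, support_comap]
    intro y hy
    change f y ∈ ((vanishingIdeal Z).support : Set X)
    rw [coe_support_vanishingIdeal]
    exact h y hy
  have h1 := eventually_mul_multiplicity_le_map (MY := MY) (MX := MX) hS f hf Z W 1 (by
    intro y
    obtain ⟨U, hyU, -⟩ := exists_affineOpens_le (show y ∈ (⊤ : Y.Opens) from trivial)
    exact ⟨U, hyU, by rw [pow_one]; exact hle U⟩)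
  filter_upwards [h1] with v h1 hv Q
  simpa using h1 hv Q

end Model

end SemiIntegral

/-! ### Prime divisors are locally principal. -/

/-- A generator of the localized ideal can be chosen in `P`. As `P` is finitely generated, one
common denominator `s ∉ Q` suffices, so the ideal is principal already on the neighbourhood where
`s` is invertible. -/
theorem Ideal.exists_mul_mem_span_singleton_of_isPrincipal_map {A : Type*} [CommRing A]
    [IsNoetherianRing A] (Q : Ideal A) [Q.IsPrime] (B : Type*) [CommRing B] [Algebra A B]
    [IsLocalization Q.primeCompl B] (P : Ideal A) (hP : (P.map (algebraMap A B)).IsPrincipal) :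
    ∃ h ∈ P, ∃ s ∉ Q, ∀ c ∈ P, s * c ∈ Ideal.span {h} := by
  obtain ⟨x, hx⟩ := hP
  have hxP : x ∈ P.map (algebraMap A B) := by
    rw [hx]; exact Submodule.mem_span_singleton_self x
  obtain ⟨⟨⟨h, hhP⟩, m⟩, hm⟩ := (IsLocalization.mem_map_algebraMap_iff Q.primeCompl B).1 hxP
  have h1 : ∀ c ∈ P, ∃ s ∉ Q, s * c ∈ Ideal.span {h} := by
    intro c hc
    have hcx : algebraMap A B c ∈ Ideal.span {x} := by
      rw [← Ideal.submodule_span_eq, ← hx]; exact Ideal.mem_map_of_mem _ hc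
    obtain ⟨y, hy⟩ := Ideal.mem_span_singleton'.1 hcx
    have h2 : algebraMap A B (m * c) ∈ (Ideal.span {h}).map (algebraMap A B) := by
      rw [Ideal.map_span, Set.image_singleton, map_mul, ← hy, ← hm]
      exact Ideal.mem_span_singleton'.2 ⟨y, by ring⟩
    obtain ⟨s, hs, hsc⟩ := (IsLocalization.algebraMap_mem_map_algebraMap_iff Q.primeCompl B _ _).1 h2
    exact ⟨s * m, Q.primeCompl.mul_mem hs m.2, by rwa [mul_assoc]⟩
  choose! g hgQ hg using h1
  obtain ⟨G, hG⟩ : P.FG := IsNoetherian.noetherian P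
  have hGP : ∀ c ∈ G, c ∈ P := fun c hc => hG ▸ Ideal.subset_span hc
  refine ⟨h, hhP, ∏ c ∈ G, g c, ?_, ?_⟩
  · exact Q.primeCompl.prod_mem fun c hc => hgQ c (hGP c hc)
  · intro c hc
    rw [← hG] at hc
    induction hc using Submodule.span_induction with
    | zero => simp
    | add x y _ _ hx hy => rw [mul_add]; exact add_mem hx hy
    | smul a x _ hx => rw [smul_eq_mul, mul_left_comm]; exact Ideal.mul_mem_left _ _ hx
    | mem x hxG =>
      classical
      rw [← Finset.mul_prod_erase G g hxG, mul_right_comm, mul_comm]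
      exact Ideal.mul_mem_left _ _ (hg x (hGP x hxG))

namespace AlgebraicGeometry

open Scheme Scheme.IdealSheafData

variable {X : Scheme.{u}}

theorem IsAffineOpen.mem_primeIdealOf_iff {U : X.Opens} (hU : IsAffineOpen U) {x : X} (hx : x ∈ U)
    (c : Γ(X, U)) : c ∈ (hU.primeIdealOf ⟨x, hx⟩).asIdeal ↔ x ∉ X.basicOpen c := by
  have h1 : hU.primeIdealOf ⟨x, hx⟩ ∈ hU.fromSpec ⁻¹ᵁ X.basicOpen c ↔ x ∈ X.basicOpen c := by
    change hU.fromSpec (hU.primeIdealOf ⟨x, hx⟩) ∈ X.basicOpen c ↔ _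
    rw [hU.fromSpec_primeIdealOf]
  rw [hU.fromSpec_preimage_basicOpen] at h1
  rw [← h1]
  exact not_not.symm

theorem Scheme.IdealSheafData.mem_vanishingIdeal_closure_singleton_iff (η : X) (V : X.affineOpens)
    (c : Γ(X, V.1)) :
    c ∈ (vanishingIdeal (Closeds.closure {η})).ideal V ↔ η ∉ X.basicOpen c := by
  rw [mem_vanishingIdeal_iff]
  constructor
  · intro h hη
    exact h η (subset_closure rfl) (X.basicOpen_le c hη) hη
  · intro h x hx _ hxc
    exact h ((specializes_iff_mem_closure.2 hx).mem_open (X.basicOpen c).2 hxc)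

theorem Scheme.IdealSheafData.vanishingIdeal_closure_singleton (η : X) (V : X.affineOpens)
    (hη : η ∈ V.1) :
    (vanishingIdeal (Closeds.closure {η})).ideal V = (V.2.primeIdealOf ⟨η, hη⟩).asIdeal := by
  ext c
  rw [mem_vanishingIdeal_closure_singleton_iff, V.2.mem_primeIdealOf_iff]

theorem IsAffineOpen.height_primeIdealOf {U : X.Opens} (hU : IsAffineOpen U) {x : X} (hx : x ∈ U) :
    (hU.primeIdealOf ⟨x, hx⟩).asIdeal.height = Order.coheight x := by
  let _ := X.presheaf.algebra_section_stalk ⟨x, hx⟩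
  have := hU.isLocalization_stalk ⟨x, hx⟩
  have h := IsLocalization.AtPrime.ringKrullDim_eq_height (hU.primeIdealOf ⟨x, hx⟩).asIdeal
    (X.presheaf.stalk x)
  rw [ringKrullDim_stalk_eq_coheight] at h
  exact (WithBot.coe_injective h).symm

/-- Locally `X` is the spectrum of a standard smooth `k`-algebra, since the only neighbourhood of
the point of `Spec k` is everything; its stalks are localizations of a regular ring. -/
theorem isRegularRing_stalk_of_smooth {k : Type u} [Field k] (a : X ⟶ Spec (.of k)) [Smooth a]
    (x : X) : IsRegularRing (X.presheaf.stalk x) := by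
  obtain ⟨U, hU, V, hV, hxV, e, h⟩ := Smooth.exists_isStandardSmooth a x
  have hfield : IsField Γ(Spec (.of k), U) := by
    have hU : U = ⊤ := by
      ext y
      simp only [Opens.coe_top, Set.mem_univ, iff_true]
      have : y = a x := Subsingleton.elim (α := PrimeSpectrum k) _ _
      exact this ▸ e hxV
    subst hU
    exact (ΓSpecIso (.of k)).commRingCatIsoToRingEquiv.toMulEquiv.isField (Field.toIsField k)
  let _ := hfield.toField
  have hreg : IsRegularRing Γ(X, V) := h.isRegularRing
  let _ := X.presheaf.algebra_section_stalk ⟨x, hxV⟩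
  have := hV.isLocalization_stalk ⟨x, hxV⟩
  exact IsRegularRing.of_isLocalization (hV.primeIdealOf ⟨x, hxV⟩).asIdeal.primeCompl _

/-- Schemes on which the prime divisors are Cartier. -/
class IsLocallyFactorial (X : Scheme.{u}) : Prop extends IsLocallyNoetherian X, IsIntegral X where
  isPrincipal_stalk (x : X) (p : Ideal (X.presheaf.stalk x)) [p.IsPrime] (hp : p.height = 1) :
    p.IsPrincipal

/-- Prime divisors are locally principal. -/
theorem IsLocallyFactorial.exists_isPrincipal [IsLocallyFactorial X] {η : X}
    (hη : Order.coheight η = 1) (x : X) {O : X.Opens} (hx : x ∈ O) :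
    ∃ U : X.affineOpens, x ∈ U.1 ∧ U.1 ≤ O ∧
      ((vanishingIdeal (Closeds.closure {η})).ideal U).IsPrincipal := by
  obtain ⟨U, hxU, hUO⟩ := exists_affineOpens_le hx
  by_cases hηx : η ⤳ x
  · have hηU : η ∈ U.1 := hηx.mem_open U.1.2 hxU
    let P := (vanishingIdeal (Closeds.closure {η})).ideal U
    have hP : P = (U.2.primeIdealOf ⟨η, hηU⟩).asIdeal := vanishingIdeal_closure_singleton η U hηU
    have hPprime : P.IsPrime := hP ▸ inferInstance
    have hPh : P.height = 1 := by rw [hP, U.2.height_primeIdealOf, hη]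
    let _ := X.presheaf.algebra_section_stalk ⟨x, hxU⟩
    let Q := (U.2.primeIdealOf ⟨x, hxU⟩).asIdeal
    have hloc : IsLocalization Q.primeCompl (X.presheaf.stalk x) :=
      U.2.isLocalization_stalk ⟨x, hxU⟩
    have hPQ : P ≤ Q := by
      intro c hc
      rw [U.2.mem_primeIdealOf_iff]
      intro hxc
      exact (mem_vanishingIdeal_closure_singleton_iff η U c).1 hc
        (hηx.mem_open (X.basicOpen c).2 hxc)
    have hdisj : Disjoint (Q.primeCompl : Set Γ(X, U.1)) P := by
      rw [Set.disjoint_left]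
      exact fun c hc hcP => hc (hPQ hcP)
    have := IsLocalization.isPrime_of_isPrime_disjoint Q.primeCompl (X.presheaf.stalk x) P
      hPprime hdisj
    have hprin := IsLocallyFactorial.isPrincipal_stalk x
      (P.map (algebraMap _ (X.presheaf.stalk x)))
      (by rw [IsLocalization.height_map_of_disjoint Q.primeCompl P hdisj, hPh])
    have hnoeth : IsNoetherianRing Γ(X, U.1) := IsLocallyNoetherian.component_noetherian U
    obtain ⟨h, hhP, s, hs, hsP⟩ : ∃ h ∈ P, ∃ s ∉ Q, ∀ c ∈ P, ∃ d, s * c = d * h := by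
      obtain ⟨h, hh, s, hs, H⟩ := Ideal.exists_mul_mem_span_singleton_of_isPrincipal_map Q
        (X.presheaf.stalk x) P hprin
      exact ⟨h, hh, s, hs, fun c hc => Ideal.mem_span_singleton'.1 (H c hc) |>.imp fun _ => Eq.symm⟩
    refine ⟨X.affineBasicOpen s, ?_, (X.basicOpen_le s).trans hUO, ?_⟩
    · have := (U.2.mem_primeIdealOf_iff hxU s).not.1 hs
      rwa [not_not] at this
    · have hle : X.affineBasicOpen s ≤ U := X.basicOpen_le s
      rw [← map_ideal _ hle]
      refine ⟨⟨(X.presheaf.map (homOfLE hle).op).hom h, le_antisymm ?_ ?_⟩⟩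
      · refine Ideal.map_le_iff_le_comap.2 fun c hc => ?_
        obtain ⟨d, hd⟩ := hsP c hc
        have hd' := congrArg (X.presheaf.map (homOfLE hle).op).hom hd
        rw [map_mul, map_mul] at hd'
        have hu : IsUnit ((X.presheaf.map (homOfLE hle).op).hom s) :=
          RingedSpace.isUnit_res_basicOpen _ s
        exact (Ideal.unit_mul_mem_iff_mem (Ideal.span {_}) hu).1
          (Ideal.mem_span_singleton'.2 ⟨_, hd'.symm⟩)
      · rw [Ideal.submodule_span_eq, Ideal.span_singleton_le_iff_mem]
        exact Ideal.mem_map_of_mem _ hhP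
  · have hx' : x ∈ (Closeds.closure {η} : Closeds X).compl ⊓ O :=
      ⟨fun h => hηx (specializes_iff_mem_closure.2 h), hx⟩
    obtain ⟨U, hxU, hU⟩ := exists_affineOpens_le hx'
    refine ⟨U, hxU, hU.trans inf_le_right, ?_⟩
    rw [ideal_eq_top_of_disjoint]
    · infer_instance
    · intro y hy hyη
      have h1 : y ∈ ((vanishingIdeal (Closeds.closure {η})).support : Set X) := hyη
      rw [coe_support_vanishingIdeal] at h1
      exact (hU hy).1 h1

end AlgebraicGeometry

/-! ### Pullbacks of prime divisors. -/

namespace SemiIntegral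

open Scheme Scheme.IdealSheafData

theorem Orbifold.isLocallyNoetherian {k : Type u} [Field k] (D : Orbifold k) :
    IsLocallyNoetherian D.X :=
  have : IsNoetherianRing (CommRingCat.of k) := inferInstanceAs (IsNoetherianRing k)
  LocallyOfFiniteType.isLocallyNoetherian D.str

instance Orbifold.isLocallyFactorial {k : Type u} [Field k] (D : Orbifold k) :
    IsLocallyFactorial D.X := by
  have := D.isLocallyNoetherian
  have : IsIntegral D.X := GeometricallyIntegral.isIntegral_of_subsingleton D.str
  refine { isPrincipal_stalk := fun x p hp h => ?_ }
  have := isRegularRing_stalk_of_smooth D.str x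
  exact IsRegularRing.isPrincipal_of_height_eq_one p h

variable {Y X : Scheme.{u}}

/-- An ideal sheaf of order at least `t` along a prime divisor is contained in the `t`-th power of
its ideal. -/
theorem exists_ideal_le_pow [IsLocallyFactorial Y] (J : Y.IdealSheafData) {η : Y}
    (hη : Order.coheight η = 1) {t : ℕ} (ht : (t : ℕ∞) ≤ orderAt J η) (y : Y) :
    ∃ U : Y.affineOpens, y ∈ U.1 ∧
      J.ideal U ≤ (vanishingIdeal (Closeds.closure {η})).ideal U ^ t := by
  obtain ⟨U, hyU, -, hU⟩ := IsLocallyFactorial.exists_isPrincipal hη y (O := ⊤) trivial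
  refine ⟨U, hyU, ?_⟩
  by_cases hηU : η ∈ U.1
  · rw [natCast_le_orderAt] at ht
    let P := (vanishingIdeal (Closeds.closure {η})).ideal U
    have hP : P = (U.2.primeIdealOf ⟨η, hηU⟩).asIdeal := vanishingIdeal_closure_singleton η U hηU
    have hPprime : P.IsPrime := hP ▸ inferInstance
    obtain ⟨π, hπ⟩ : P.IsPrincipal := hU
    rw [Ideal.submodule_span_eq] at hπ
    let _ := Y.presheaf.algebra_section_stalk ⟨η, hηU⟩
    have hloc : IsLocalization.AtPrime (Y.presheaf.stalk η) P := by
      have h : ∀ (P' : Ideal Γ(Y, U.1)) (_ : P'.IsPrime),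
          P' = (U.2.primeIdealOf ⟨η, hηU⟩).asIdeal →
          IsLocalization.AtPrime (Y.presheaf.stalk η) P' := by
        rintro _ _ rfl
        exact U.2.isLocalization_stalk ⟨η, hηU⟩
      exact h P hPprime hP
    have : Nonempty U.1 := ⟨⟨y, hyU⟩⟩
    have hdom : IsDomain Γ(Y, U.1) := inferInstance
    intro s hs
    have h1 := ht U hηU s hs
    have h2 : algebraMap Γ(Y, U.1) (Y.presheaf.stalk η) s ∈
        (P ^ t).map (algebraMap Γ(Y, U.1) (Y.presheaf.stalk η)) := by
      rw [Ideal.map_pow, IsLocalization.AtPrime.map_eq_maximalIdeal P (Y.presheaf.stalk η)]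
      exact h1
    -- Order at least `t` at `η` means that `m s` is divisible by `πᵗ` for some `m` outside `(π)`.
    -- As `π` is prime, `πᵗ` divides `s` itself, on the whole chart.
    obtain ⟨m, hm, hms⟩ :=
      (IsLocalization.algebraMap_mem_map_algebraMap_iff P.primeCompl _ _ _).1 h2
    change s ∈ P ^ t
    rw [hπ, Ideal.span_singleton_pow, Ideal.mem_span_singleton] at hms ⊢
    have hmπ : ¬ π ∣ m := fun h => hm (by rw [hπ]; exact Ideal.mem_span_singleton.2 h)
    by_cases hπ0 : π = 0
    · exfalso
      have h3 : P.height = 1 := by rw [hP, U.2.height_primeIdealOf, hη]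
      rw [hπ, hπ0, Ideal.span_singleton_zero, Ideal.height_bot] at h3
      exact zero_ne_one h3
    · have hprime : Prime π := (Ideal.span_singleton_prime hπ0).1 (hπ ▸ hPprime)
      exact hprime.pow_dvd_of_dvd_mul_left t hmπ hms
  · rw [ideal_eq_top_of_disjoint (vanishingIdeal (Closeds.closure {η})), Ideal.top_pow]
    · exact le_top
    · intro z hz hzη
      have h1 : z ∈ ((vanishingIdeal (Closeds.closure {η})).support : Set Y) := hzη
      rw [coe_support_vanishingIdeal] at h1
      exact hηU ((specializes_iff_mem_closure.2 h1).mem_open U.1.2 hz)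

/-- The local shape of the pullback of a prime divisor: it is either everything or Cartier. -/
theorem exists_ideal_comap_eq_span [IsLocallyFactorial X] [IsIntegral Y] (f : Y ⟶ X) {ξ : X}
    (hξ : Order.coheight ξ = 1) (hf : ¬ ∀ y, f y ∈ closure {ξ}) (y : Y) :
    ∃ U : Y.affineOpens, y ∈ U.1 ∧ ∃ b ≠ 0,
      ((vanishingIdeal (Closeds.closure {ξ})).comap f).ideal U = Ideal.span {b} := by
  obtain ⟨V, hyV, -, ⟨h, hV⟩⟩ := IsLocallyFactorial.exists_isPrincipal hξ (f y) (O := ⊤) trivial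
  obtain ⟨U, hyU, hUV⟩ := exists_affineOpens_le (show y ∈ f ⁻¹ᵁ V.1 from hyV)
  have hid : ((vanishingIdeal (Closeds.closure {ξ})).comap f).ideal U =
      Ideal.span {(f.appLE V.1 U.1 hUV).hom h} := by
    rw [ideal_comap f _ U V hUV, hV, Ideal.submodule_span_eq, Ideal.map_span, Set.image_singleton]
  refine ⟨U, hyU, _, fun hb => hf ?_, hid⟩
  -- If the local equation pulled back to zero, `f` would map a non-empty open set, which is dense,
  -- into the divisor, and hence all of `Y`.
  have hsub : ∀ z ∈ U.1, f z ∈ closure {ξ} := by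
    intro z hz
    rw [hb, Ideal.span_singleton_zero] at hid
    have h1 : z ∈ ((vanishingIdeal (Closeds.closure {ξ})).comap f).support := by
      rw [mem_support_iff_of_mem hz, hid]
      simp [Scheme.mem_zeroLocus_iff]
    rw [support_comap] at h1
    have h2 : f z ∈ ((vanishingIdeal (Closeds.closure {ξ})).support : Set X) := h1
    rwa [coe_support_vanishingIdeal] at h2
  have hdense : Dense (U.1 : Set Y) := U.1.2.dense ⟨y, hyU⟩
  intro z
  have hcl : IsClosed (f ⁻¹' closure {ξ}) := isClosed_closure.preimage f.continuous
  exact (hcl.closure_subset_iff.2 hsub) (hdense z)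

/-- The inverse image of a prime divisor is a finite union of prime divisors, of finite
multiplicities. -/
theorem exists_finite_components [IsLocallyFactorial X] [IsIntegral Y] [IsLocallyNoetherian Y]
    [CompactSpace Y] (f : Y ⟶ X) {ξ : X}
    (hξ : Order.coheight ξ = 1) (hf : ¬ ∀ y, f y ∈ closure {ξ}) :
    ∃ s : Finset Y, (∀ η ∈ s, Order.coheight η = 1 ∧ f η ∈ closure {ξ}) ∧
      ∀ y, f y ∈ closure {ξ} → ∃ η ∈ s, η ⤳ y := by
  have hloc : ∀ y : Y, ∃ U : Y.affineOpens, y ∈ U.1 ∧ ∃ s : Finset Y,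
      (∀ η ∈ s, Order.coheight η = 1 ∧ f η ∈ closure {ξ}) ∧
        ∀ z ∈ U.1, f z ∈ closure {ξ} → ∃ η ∈ s, η ⤳ z := by
    intro y
    obtain ⟨U, hyU, b, hb, hU⟩ := exists_ideal_comap_eq_span f hξ hf y
    have hnoeth : IsNoetherianRing Γ(Y, U.1) := IsLocallyNoetherian.component_noetherian U
    have : Nonempty U.1 := ⟨⟨y, hyU⟩⟩
    have hdom : IsDomain Γ(Y, U.1) := inferInstance
    have hmem : ∀ (z : Y) (hz : z ∈ U.1),
        b ∈ (U.2.primeIdealOf ⟨z, hz⟩).asIdeal ↔ f z ∈ closure {ξ} := by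
      intro z hz
      have h1 : f z ∈ closure {ξ} ↔
          z ∈ ((vanishingIdeal (Closeds.closure {ξ})).comap f).support := by
        rw [support_comap]
        change _ ↔ f z ∈ ((vanishingIdeal (Closeds.closure {ξ})).support : Set X)
        rw [coe_support_vanishingIdeal]
        rfl
      rw [h1, mem_support_iff_of_mem hz, hU, Scheme.mem_zeroLocus_iff, U.2.mem_primeIdealOf_iff]
      constructor
      · intro h c hc hzc
        obtain ⟨d, rfl⟩ := Ideal.mem_span_singleton'.1 hc
        rw [Scheme.basicOpen_mul] at hzc
        exact h hzc.2
      · intro h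
        exact h b (Ideal.mem_span_singleton_self b)
    -- The components on this chart are the minimal primes over `b`. They are finite in number, of
    -- height at most one by Krull's principal ideal theorem, and of height not zero because `b ≠
    -- 0`.
    have hfin := Ideal.finite_minimalPrimes_of_isNoetherianRing Γ(Y, U.1) (Ideal.span {b})
    have hprime : ∀ p ∈ (Ideal.span {b}).minimalPrimes, p.IsPrime := fun p hp => hp.1.1
    classical
    refine ⟨U, hyU, hfin.toFinset.attach.image fun p => U.2.fromSpec
      ⟨p.1, hprime p.1 (hfin.mem_toFinset.1 p.2)⟩, ?_, ?_⟩
    · intro η hη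
      obtain ⟨⟨p, hp⟩, -, rfl⟩ := Finset.mem_image.1 hη
      replace hp := hfin.mem_toFinset.1 hp
      have hpp := hprime p hp
      have hηU : U.2.fromSpec ⟨p, hpp⟩ ∈ U.1 := by
        have : U.2.fromSpec ⟨p, hpp⟩ ∈ Set.range U.2.fromSpec := ⟨_, rfl⟩
        rwa [U.2.range_fromSpec] at this
      have hpη : U.2.primeIdealOf ⟨_, hηU⟩ = ⟨p, hpp⟩ :=
        have := U.2.isOpenImmersion_fromSpec
        U.2.fromSpec.isOpenEmbedding.injective (U.2.fromSpec_primeIdealOf ⟨_, hηU⟩)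
      have hbp : b ∈ p := hp.1.2 (Ideal.mem_span_singleton_self b)
      constructor
      · change Order.coheight (U.2.fromSpec ⟨p, hpp⟩) = 1
        rw [← U.2.height_primeIdealOf hηU, hpη]
        refine le_antisymm (Ideal.height_le_one_of_isPrincipal_of_mem_minimalPrimes _ p hp) ?_
        rw [Order.one_le_iff_ne_zero]
        intro h0
        rw [Ideal.height_eq_zero_iff_eq_bot] at h0
        replace h0 : p = ⊥ := h0
        rw [h0] at hbp
        exact hb (Ideal.mem_bot.1 hbp)
      · rw [← hmem _ hηU, hpη]
        exact hbp
    · intro z hz hfz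
      have hbz := (hmem z hz).2 hfz
      obtain ⟨p, hp, hpz⟩ := Ideal.exists_minimalPrimes_le
        (show Ideal.span {b} ≤ (U.2.primeIdealOf ⟨z, hz⟩).asIdeal by
          rwa [Ideal.span_singleton_le_iff_mem])
      refine ⟨_, Finset.mem_image.2 ⟨⟨p, hfin.mem_toFinset.2 hp⟩, Finset.mem_attach _ _, rfl⟩, ?_⟩
      have h1 : (⟨p, hprime p hp⟩ : PrimeSpectrum Γ(Y, U.1)) ⤳ U.2.primeIdealOf ⟨z, hz⟩ :=
        (PrimeSpectrum.le_iff_specializes _ _).1 hpz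
      have h2 := h1.map U.2.fromSpec.continuous
      rwa [U.2.fromSpec_primeIdealOf] at h2
  choose U hyU s hs hsU using hloc
  obtain ⟨t, -, ht⟩ := (isCompact_univ (X := Y)).elim_nhds_subcover (fun y => (U y).1.1)
    fun y _ => (U y).1.2.mem_nhds (hyU y)
  classical
  refine ⟨t.biUnion s, ?_, ?_⟩
  · intro η hη
    obtain ⟨y, -, hy⟩ := Finset.mem_biUnion.1 hη
    exact hs y η hy
  · intro z hz
    obtain ⟨y, hy, hzy⟩ := Set.mem_iUnion₂.1 (ht (Set.mem_univ z))
    obtain ⟨η, hη, hηz⟩ := hsU y z hzy hz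
    exact ⟨η, Finset.mem_biUnion.2 ⟨y, hy, hη⟩, hηz⟩

/-- By Krull's intersection theorem, infinite order would make the germ of the local equation zero,
but that equation is non-zero on an integral scheme. -/
theorem pullbackOrder_ne_top [IsLocallyFactorial X] [IsIntegral Y] [IsLocallyNoetherian Y]
    (f : Y ⟶ X) {ξ : X} (hξ : Order.coheight ξ = 1) (hf : ¬ ∀ y, f y ∈ closure {ξ}) (η : Y) :
    pullbackOrder f (Closeds.closure {ξ}) η ≠ ⊤ := by
  intro htop
  obtain ⟨U, hηU, b, hb, hU⟩ := exists_ideal_comap_eq_span f hξ hf η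
  have hbU : b ∈ ((vanishingIdeal (Closeds.closure {ξ})).comap f).ideal U := by
    rw [hU]; exact Ideal.mem_span_singleton_self b
  have h1 : ∀ n, Y.presheaf.germ U.1 η hηU b ∈
      IsLocalRing.maximalIdeal (Y.presheaf.stalk η) ^ n := fun n =>
    (natCast_le_orderAt _ η n).1 (le_top.trans_eq htop.symm) U hηU b hbU
  have h2 := Ideal.iInf_pow_eq_bot_of_isLocalRing (IsLocalRing.maximalIdeal (Y.presheaf.stalk η))
    (IsLocalRing.maximalIdeal.isMaximal _).ne_top
  have h3 : Y.presheaf.germ U.1 η hηU b = 0 := by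
    rw [← Ideal.mem_bot, ← h2]
    exact (Submodule.mem_iInf _).2 h1
  exact hb (germ_injective_of_isIntegral Y η hηU (h3.trans (map_zero _).symm))

end SemiIntegral

/-! ### The centre, and the geometry away from it. -/

namespace SemiIntegral

open Scheme Scheme.IdealSheafData

variable {Y X : Scheme.{u}} (f : Y ⟶ X)

theorem isClosed_centre : IsClosed (centre f) := by
  refine ⟨isOpen_iff_forall_mem_open.2 fun x hx => ?_⟩
  obtain ⟨U, hxU, hU⟩ := not_not.1 hx
  exact ⟨U, fun y hy => not_not.2 ⟨U, hy, hU⟩, U.2, hxU⟩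

/-- The inverse image of the centre. -/
def preimageCentre : Closeds Y := ⟨f ⁻¹' centre f, (isClosed_centre f).preimage f.continuous⟩

variable {f}

theorem exists_isIso_of_notMem_centre {x : X} (hx : x ∉ centre f) :
    ∃ U : X.Opens, x ∈ U ∧ IsIso (f ∣_ U) := not_not.1 hx

theorem isIso_morphismRestrict_of_le {U : X.Opens} [IsIso (f ∣_ U)] {V : X.Opens}
    (hV : V ≤ U) : IsIso (f ∣_ V) := by
  have hle : f ⁻¹ᵁ V ≤ f ⁻¹ᵁ U := fun x hx => hV hx
  have h1 : Y.homOfLE hle ≫ f ∣_ U = f ∣_ V ≫ X.homOfLE hV := by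
    rw [← cancel_mono U.ι]
    simp
  have h2 : IsPullback (f ∣_ V) (Y.homOfLE hle) (X.homOfLE hV) (f ∣_ U) := by
    refine IsPullback.of_bot ?_ h1.symm (isPullback_morphismRestrict f U)
    simpa using isPullback_morphismRestrict f V
  exact MorphismProperty.of_isPullback (P := MorphismProperty.isomorphisms Scheme) h2.flip
    (by assumption)

theorem isIso_app_of_isIso_morphismRestrict {U : X.Opens} [IsIso (f ∣_ U)] {V : X.Opens}
    (hV : V ≤ U) : IsIso (f.app V) := by
  have := isIso_morphismRestrict_of_le (f := f) hV
  have h1 := morphismRestrict_appTop f V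
  have h2 : IsIso (f.app (V.ι ''ᵁ ⊤) ≫
      Y.presheaf.map (eqToHom (image_morphismRestrict_preimage f V ⊤)).op) := by
    rw [← h1]
    exact inferInstanceAs (IsIso ((f ∣_ V).app ⊤))
  have h3 : IsIso (f.app (V.ι ''ᵁ ⊤)) := IsIso.of_isIso_comp_right _
    (Y.presheaf.map (eqToHom (image_morphismRestrict_preimage f V ⊤)).op)
  rwa [Scheme.Opens.ι_image_top] at h3

theorem isAffineOpen_preimage_of_isIso {V : X.Opens} [IsIso (f ∣_ V)] (hV : IsAffineOpen V) :
    IsAffineOpen (f ⁻¹ᵁ V) := by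
  have : IsAffine V := hV
  exact IsAffine.of_isIso (f ∣_ V)

theorem existsUnique_of_isIso_morphismRestrict {U : X.Opens} [IsIso (f ∣_ U)] {x : X}
    (hx : x ∈ U) : ∃! y : Y, f y = x := by
  have hbij : Function.Bijective (f ∣_ U) := (Scheme.homeoOfIso (asIso (f ∣_ U))).bijective
  obtain ⟨y, hy⟩ := hbij.2 ⟨x, hx⟩
  have hval : ∀ z : (f ⁻¹ᵁ U), ((f ∣_ U) z).1 = f z.1 :=
    morphismRestrict_base_coe f U
  refine ⟨y.1, ?_, ?_⟩
  · change f y.1 = x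
    exact (hval y).symm.trans (congrArg Subtype.val hy)
  · intro z hz
    have h1 : (f ∣_ U) ⟨z, by change f z ∈ U; rwa [hz]⟩ = (f ∣_ U) y := by
      rw [hy]
      refine Subtype.ext ?_
      rw [hval]
      exact hz
    exact congrArg Subtype.val (hbij.1 h1)

/-- `f` is an open immersion near `y`, and codimension is local. So a prime divisor whose generic
point maps outside the centre is not contracted. -/
theorem coheight_eq_of_notMem_centre {y : Y} (hy : f y ∉ centre f) :
    Order.coheight (f y) = Order.coheight y := by
  obtain ⟨U, hyU, hU⟩ := exists_isIso_of_notMem_centre hy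
  have h1 := coheight_eq_of_isOpenImmersion (x := (⟨y, hyU⟩ : (f ⁻¹ᵁ U).toScheme)) (f ⁻¹ᵁ U).ι
  have h2 := coheight_eq_of_isOpenImmersion (x := (⟨y, hyU⟩ : (f ⁻¹ᵁ U).toScheme))
    ((f ∣_ U) ≫ U.ι)
  rw [morphismRestrict_ι] at h2
  exact h2.trans h1.symm

/-- Where `f` is an isomorphism, the inverse image of a closed subset is reduced. -/
theorem exists_ideal_comap_eq_of_notMem_centre {Z : Closeds X} {W : Closeds Y} {y : Y}
    (hy : f y ∉ centre f) (hWZ : ∀ z, f z ∉ centre f → (z ∈ W ↔ f z ∈ Z)) :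
    ∃ U' : Y.affineOpens, y ∈ U'.1 ∧
      ((vanishingIdeal Z).comap f).ideal U' = (vanishingIdeal W).ideal U' := by
  obtain ⟨U, hyU, hU⟩ := exists_isIso_of_notMem_centre hy
  obtain ⟨V, hyV, hVU⟩ := exists_affineOpens_le hyU
  have hUC : ∀ x ∈ U, x ∉ centre f := fun x hx h => h ⟨U, hx, hU⟩
  have := isIso_morphismRestrict_of_le (f := f) (U := U) hVU
  have hiso := isIso_app_of_isIso_morphismRestrict (f := f) (U := U) hVU
  let U' : Y.affineOpens := ⟨f ⁻¹ᵁ V.1, isAffineOpen_preimage_of_isIso V.2⟩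
  have hbij : Function.Bijective (f.app V.1).hom := ConcreteCategory.bijective_of_isIso (f.app V.1)
  refine ⟨U', hyV, ?_⟩
  rw [ideal_comap f _ U' V le_rfl, ← Scheme.Hom.app_eq_appLE]
  ext s
  obtain ⟨c, rfl⟩ := hbij.2 s
  have h1 : (f.app V.1).hom c ∈ ((vanishingIdeal Z).ideal V).map (f.app V.1).hom ↔
      c ∈ (vanishingIdeal Z).ideal V := by
    constructor
    · intro h
      obtain ⟨d, hd, hdc⟩ := (Ideal.mem_map_iff_of_surjective _ hbij.2).1 h
      rwa [← hbij.1 hdc]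
    · exact Ideal.mem_map_of_mem _
  refine h1.trans ?_
  have h2 : ∀ z, z ∈ Y.basicOpen ((f.app V.1).hom c) ↔ f z ∈ X.basicOpen c := fun z =>
    (SetLike.ext_iff.1 (Scheme.preimage_basicOpen f c) z).symm
  rw [mem_vanishingIdeal_iff]
  refine Iff.trans ?_ (mem_vanishingIdeal_iff W U' _).symm
  constructor
  · intro H z hz hzU hzc
    have hfz : f z ∈ V.1 := hzU
    exact H (f z) ((hWZ z (hUC _ (hVU hfz))).1 hz) hfz ((h2 z).1 hzc)
  · intro H x hx hxV hxc
    obtain ⟨z, rfl, -⟩ := existsUnique_of_isIso_morphismRestrict (f := f) hxV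
    exact H z ((hWZ z (hUC _ (hVU hxV))).2 hx) hxV ((h2 z).2 hxc)

/-- Strict transforms, outside the inverse image of the centre. -/
theorem mem_closure_iff_of_notMem_centre {η : Y} {ξ : X} (h : f η = ξ) {y : Y}
    (hy : f y ∉ centre f) : y ∈ closure {η} ↔ f y ∈ closure {ξ} := by
  rw [← specializes_iff_mem_closure, ← specializes_iff_mem_closure]
  constructor
  · intro hs
    exact h ▸ hs.map f.continuous
  · intro hs
    obtain ⟨U, hyU, hU⟩ := exists_isIso_of_notMem_centre hy
    have hηU : f η ∈ U := h ▸ hs.mem_open U.2 hyU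
    have hemb : Topology.IsInducing (f ∣_ U) :=
      (Scheme.homeoOfIso (asIso (f ∣_ U))).isInducing
    have hs' : (⟨η, hηU⟩ : f ⁻¹ᵁ U) ⤳ ⟨y, hyU⟩ := by
      refine hemb.specializes_iff.1 (Topology.IsInducing.subtypeVal.specializes_iff.1 ?_)
      exact (congrArg₂ (· ⤳ ·) ((morphismRestrict_base_coe f U _).trans h)
        (morphismRestrict_base_coe f U _)).mpr hs
    exact hs'.map continuous_subtype_val

end SemiIntegral

/-! ### Multiplicity one, weights, and rational points off the centre. -/

theorem ENat.le_of_dvd_of_ne_zero {m n : ℕ∞} (h : m ∣ n) (hn : n ≠ 0) : m ≤ n := by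
  obtain ⟨a, rfl⟩ := h
  exact le_mul_of_one_le_right' (Order.one_le_iff_ne_zero.2 (right_ne_zero_of_mul hn))

theorem Set.Finite.exists_finite_superset_of_eventually_cofinite {α : Type*} {S : Set α}
    (hS : S.Finite) {p : α → Prop} (h : ∀ᶠ x in Filter.cofinite, p x) :
    ∃ T, S ⊆ T ∧ T.Finite ∧ ∀ x ∉ T, p x :=
  ⟨S ∪ {x | ¬ p x}, Set.subset_union_left, hS.union (Filter.eventually_cofinite.1 h),
    fun _ hx => not_not.1 fun h => hx (Or.inr h)⟩

namespace SemiIntegral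

open Scheme Scheme.IdealSheafData

section Geometry

variable {Y X : Scheme.{u}} {f : Y ⟶ X}

/-- A prime divisor occurs with multiplicity one in its own ideal sheaf. -/
theorem orderAt_le_one [IsIntegral Y] [IsLocallyNoetherian Y] {J : Y.IdealSheafData} {η : Y}
    (hη : Order.coheight η = 1) {U : Y.affineOpens} (hηU : η ∈ U.1)
    (hU : (vanishingIdeal (Closeds.closure {η})).ideal U ≤ J.ideal U) : orderAt J η ≤ 1 := by
  by_contra h
  have h2 : ((2 : ℕ) : ℕ∞) ≤ orderAt J η := Order.add_one_le_of_lt (not_le.1 h)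
  rw [natCast_le_orderAt] at h2
  rw [vanishingIdeal_closure_singleton η U hηU] at hU
  let _ := Y.presheaf.algebra_section_stalk ⟨η, hηU⟩
  have := U.2.isLocalization_stalk ⟨η, hηU⟩
  -- Order two would give `𝔪 ⊆ 𝔪²` in the stalk, hence `𝔪 = 0` by Nakayama, against codimension one.
  have hle : IsLocalRing.maximalIdeal (Y.presheaf.stalk η) ≤
      IsLocalRing.maximalIdeal (Y.presheaf.stalk η) •
        IsLocalRing.maximalIdeal (Y.presheaf.stalk η) := by
    have h3 := IsLocalization.AtPrime.map_eq_maximalIdeal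
      (U.2.primeIdealOf ⟨η, hηU⟩).asIdeal (Y.presheaf.stalk η)
    rw [smul_eq_mul, ← sq]
    conv_lhs => rw [← h3]
    exact Ideal.map_le_iff_le_comap.2 fun s hs => h2 U hηU s (hU hs)
  have hbot := Submodule.eq_bot_of_le_smul_of_le_jacobson_bot _ _
    (IsNoetherian.noetherian (IsLocalRing.maximalIdeal (Y.presheaf.stalk η))) hle
    (IsLocalRing.maximalIdeal_le_jacobson _)
  have h4 := IsLocalRing.maximalIdeal_height_eq_ringKrullDim (R := Y.presheaf.stalk η)
  rw [hbot, Ideal.height_bot, ringKrullDim_stalk_eq_coheight, hη] at h4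
  exact zero_ne_one (WithBot.coe_injective h4)

theorem pullbackOrder_le_one_of_notMem_centre [IsIntegral Y] [IsLocallyNoetherian Y] {η : Y}
    (hη : Order.coheight η = 1) (hc : f η ∉ centre f) :
    pullbackOrder f (Closeds.closure {f η}) η ≤ 1 := by
  obtain ⟨U, hηU, hU⟩ := exists_ideal_comap_eq_of_notMem_centre (Z := Closeds.closure {f η})
    (W := Closeds.closure {η}) hc fun z hz => mem_closure_iff_of_notMem_centre rfl hz
  exact orderAt_le_one hη hηU hU.ge

theorem one_le_pullbackOrder {Z : Closeds X} {y : Y} (hy : f y ∈ Z) : 1 ≤ pullbackOrder f Z y := by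
  obtain ⟨V, hyV, -⟩ := exists_affineOpens_le (show f y ∈ (⊤ : X.Opens) from trivial)
  have h := natCast_le_pullbackOrder f Z y V hyV 1
  rw [Nat.cast_one] at h
  refine h.2 fun c hc => ?_
  have h1 := (mem_vanishingIdeal_iff Z V c).1 hc (f y) hy hyV
  rw [pow_one, IsLocalRing.mem_maximalIdeal, mem_nonunits_iff]
  intro hu
  exact h1 ((X.mem_basicOpen c (f y) hyV).2 (isUnit_of_map_unit (f.stalkMap y).hom _ hu))

theorem image_closure_subset {η : Y} {Z : Set X} (hZ : IsClosed Z) (h : f η ∈ Z) {y : Y}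
    (hy : y ∈ closure {η}) : f y ∈ Z :=
  ((specializes_iff_mem_closure.2 hy).map f.continuous).mem_closed hZ h

end Geometry

section Orbifold

variable {k : Type u} [Field k] {F D : Orbifold k} {f : F.X ⟶ D.X}

theorem Orbifold.weightAt_pt (D : Orbifold k) (α : D.index) :
    D.weightAt (D.pt α) = D.weight α := by
  have h : ∃ β, D.pt β = D.pt α := ⟨α, rfl⟩
  rw [Orbifold.weightAt, dif_pos h]
  exact congrArg D.weight (D.pt_injective h.choose_spec)

theorem Orbifold.weightAt_eq_one (D : Orbifold k) {η : D.X} (h : ¬ ∃ α, D.pt α = η) :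
    D.weightAt η = 1 := dif_neg h

theorem Kind.cond_one (star : Kind) (n : ℕ∞) : star.cond 1 n := by
  cases star with
  | campana =>
    rcases eq_or_ne n 0 with h | h
    · exact Or.inl h
    · exact Or.inr (Or.inr (Order.one_le_iff_ne_zero.2 h))
  | darmon => exact one_dvd n

theorem Kind.cond_of_dvd (star : Kind) {m m' n : ℕ∞} (h : m ∣ m') (hm' : m' ≠ 0)
    (hn : star.cond m' n) : star.cond m n := by
  cases star with
  | campana =>
    exact hn.imp_right (Or.imp_right (ENat.le_of_dvd_of_ne_zero h hm').trans)
  | darmon => exact h.trans hn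

theorem Kind.cond_zero (star : Kind) (m : ℕ∞) : star.cond m 0 := by
  cases star with
  | campana => exact Or.inl rfl
  | darmon => exact dvd_zero m

theorem IsOrbifoldMorphism.not_forall_mem_closure (hf : IsOrbifoldMorphism F D f) {α : D.index}
    (hα : D.weight α ≠ 1) : ¬ ∀ y, f y ∈ closure {D.pt α} := fun h => hf.range_not_subset <| by
  rintro _ ⟨y, rfl⟩
  exact Set.mem_biUnion (show α ∈ {α | D.weight α ≠ 1} from hα) (h y)

/-- Off the centre, the strict transform occurs with multiplicity exactly one in the pullback, so
`t` disappears from the divisibility condition. -/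
theorem IsDivisible.weight_dvd (hf : IsDivisible F D f) {α : D.index} {β : F.index}
    (h : f (F.pt β) = D.pt α) (hc : D.pt α ∉ centre f) : D.weight α ∣ F.weight β := by
  have hmem : f (F.pt β) ∈ D.component α := h ▸ subset_closure rfl
  have h1 := hf (F.pt β) (F.coheight_pt β) α hmem
  have := F.isLocallyNoetherian
  have h2 : pullbackOrder f (D.component α) (F.pt β) = 1 := by
    refine le_antisymm ?_ (one_le_pullbackOrder hmem)
    have h3 := pullbackOrder_le_one_of_notMem_centre (f := f) (F.coheight_pt β) (by rwa [h])
    rwa [h] at h3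
  rwa [h2, one_mul, F.weightAt_pt] at h1

end Orbifold

section Points

theorem Point.extend_map {K : Type u} [Field K] {Y X : Scheme.{u}} {strY : Y ⟶ Spec (.of K)} {strX : X ⟶ Spec (.of K)}
    (L : Type u) [Field L] [Algebra K L] (f : Y ⟶ X) (hf : f ≫ strX = strY) (P : Point strY K) :
    (P.map f hf).extend L = (P.extend L).map f hf :=
  Subtype.ext (Category.assoc _ _ _).symm

/-- The image of `Spec K` is a single point, so `P` factors through one open set over which `f` is
invertible. -/
theorem Point.exists_map_eq {K : Type u} [Field K] {Y X : Scheme.{u}} {strY : Y ⟶ Spec (.of K)}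
    {strX : X ⟶ Spec (.of K)} (f : Y ⟶ X) (hf : f ≫ strX = strY) (P : Point strX K)
    (hP : ∀ x, P.1 x ∉ centre f) : ∃ Q : Point strY K, Q.map f hf = P := by
  obtain ⟨U, hxU, hU⟩ := exists_isIso_of_notMem_centre (hP (⊥ : PrimeSpectrum K))
  have hrange : Set.range P.1 ⊆ Set.range U.ι := by
    rintro _ ⟨x, rfl⟩
    rw [Scheme.Opens.range_ι, Subsingleton.elim (α := PrimeSpectrum K) x ⊥]
    exact hxU
  have h : (IsOpenImmersion.lift U.ι P.1 hrange ≫ inv (f ∣_ U) ≫ (f ⁻¹ᵁ U).ι) ≫ f = P.1 := by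
    rw [Category.assoc, Category.assoc, ← morphismRestrict_ι, IsIso.inv_hom_id_assoc,
      IsOpenImmersion.lift_fac]
  exact ⟨⟨_, by rw [← hf, ← Category.assoc, h, P.2]⟩, Subtype.ext h⟩

variable {K : Type u} [Field K] [NumberField K]

variable {S T : Set (HeightOneSpectrum (𝓞 K))} {X : Scheme.{u}} {strX : X ⟶ Spec (.of K)}

theorem Model.gen_mem_partOver (M : Model S strX) (hST : S ⊆ T) (x : X) :
    M.gen x ∈ M.partOver hST := by
  let i : S.integer K →+* T.integer K := (Subalgebra.inclusion
      (show S.integer K ≤ T.integer K from fun _ hx v hv => hx v fun h => hv (hST h))).toRingHom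
  refine ⟨Spec.map (CommRingCat.ofHom (algebraMap (T.integer K) K)) (strX x), ?_⟩
  have h : M.gen ≫ M.str = strX ≫ Spec.map (CommRingCat.ofHom (algebraMap (T.integer K) K)) ≫
      Spec.map (CommRingCat.ofHom i) := by
    rw [M.isPullback.w, ← Spec.map_comp]
    rfl
  exact (congrArg (fun g : X ⟶ Spec (.of (S.integer K)) => g x) h).symm

theorem Model.closedPt_mem_partOver (M : Model S strX) (hST : S ⊆ T)
    {v : HeightOneSpectrum (𝓞 K)} (hv : v ∉ T) (P : Point strX (v.adicCompletion K)) :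
    M.closedPt (fun h => hv (hST h)) P ∈ M.partOver hST := by
  let i : S.integer K →+* T.integer K := (Subalgebra.inclusion
      (show S.integer K ≤ T.integer K from fun _ hx v hv => hx v fun h => hv (hST h))).toRingHom
  refine ⟨Spec.map (CommRingCat.ofHom (toLocal hv))
    (IsLocalRing.closedPoint (v.adicCompletionIntegers K)), ?_⟩
  have h : M.localPoint (fun h => hv (hST h)) P ≫ M.str =
      Spec.map (CommRingCat.ofHom (toLocal hv)) ≫ Spec.map (CommRingCat.ofHom i) := by
    rw [Model.localPoint_str, ← Spec.map_comp]
    rfl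
  exact (congrArg (fun g : Spec (.of (v.adicCompletionIntegers K)) ⟶ Spec (.of (S.integer K)) =>
    g (IsLocalRing.closedPoint (v.adicCompletionIntegers K))) h).symm

/-- The local point carries the generic point of `Spec 𝒪_v` to the image of `P`, and this
specializes to the reduction. -/
theorem Model.closedPt_extend_mem_closure (M : Model S strX) {v : HeightOneSpectrum (𝓞 K)}
    (hv : v ∉ S) (P : Point strX K) :
    M.closedPt hv (P.extend (v.adicCompletion K)) ∈ M.closure (Set.range P.1) := by
  let ξ : Spec (.of (v.adicCompletion K)) := (⊥ : PrimeSpectrum (v.adicCompletion K))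
  let ξ' : Spec (.of (v.adicCompletionIntegers K)) := Spec.map (CommRingCat.ofHom
    (algebraMap (v.adicCompletionIntegers K) (v.adicCompletion K))) ξ
  have h1 : M.localPoint hv (P.extend (v.adicCompletion K)) ξ' =
      M.gen (P.1 (Spec.map (CommRingCat.ofHom (algebraMap K (v.adicCompletion K))) ξ)) :=
    congrArg (fun g : Spec (.of (v.adicCompletion K)) ⟶ M.total => g ξ)
      (Model.localPoint_fac (M := M) hv (P.extend (v.adicCompletion K)))
  have h2 : ξ' ⤳ IsLocalRing.closedPoint (v.adicCompletionIntegers K) :=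
    IsLocalRing.specializes_closedPoint ξ'
  refine (h2.map (M.localPoint hv _).continuous).mem_closed (M.closure _).isClosed ?_
  rw [h1]
  exact M.gen_mem_closure ⟨_, rfl⟩

theorem Model.ClosureAvoids.notMem {M : Model S strX} {hST : S ⊆ T} {P : Point strX K} {Z : Set X}
    (h : M.ClosureAvoids hST P Z) (x : Spec (.of K)) : P.1 x ∉ Z := fun hx =>
  Set.eq_empty_iff_forall_notMem.1 h (M.gen (P.1 x))
    ⟨⟨M.gen_mem_closure ⟨_, rfl⟩, M.gen_mem_closure hx⟩, M.gen_mem_partOver hST _⟩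

theorem Model.ClosureAvoids.closedPt_notMem {M : Model S strX} {hST : S ⊆ T} {P : Point strX K}
    {Z : Set X} (h : M.ClosureAvoids hST P Z) {v : HeightOneSpectrum (𝓞 K)} (hv : v ∉ T) :
    M.closedPt (fun h => hv (hST h)) (P.extend (v.adicCompletion K)) ∉ M.closure Z := fun hx =>
  Set.eq_empty_iff_forall_notMem.1 h _
    ⟨⟨M.closedPt_extend_mem_closure _ P, hx⟩, M.closedPt_mem_partOver hST hv _⟩

end Points

end SemiIntegral

/-! ### Multiplicities along prime divisors and their inverse images. -/

namespace SemiIntegral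

open Scheme Scheme.IdealSheafData

variable {K : Type u} [Field K] [NumberField K] {S : Set (HeightOneSpectrum (𝓞 K))}

namespace Model

section

variable {X Y : Scheme.{u}} {strX : X ⟶ Spec (.of K)} {strY : Y ⟶ Spec (.of K)}
  {MX : Model S strX} {MY : Model S strY}

theorem closure_mono {Z W : Set X} (h : Z ⊆ W) : MX.closure Z ≤ MX.closure W :=
  _root_.closure_mono (Set.image_mono h)

/-- Outside the inverse image of the centre, prime divisors and their strict transforms have the
same multiplicities. -/
theorem eventually_multiplicity_map_eq (hS : S.Finite) (f : Y ⟶ X) (hf : f ≫ strX = strY) {η : Y}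
    {ξ : X} (h : f η = ξ) : ∀ᶠ v : HeightOneSpectrum (𝓞 K) in Filter.cofinite,
      ∀ (hv : v ∉ S) (Q : Point strY (v.adicCompletion K)),
        MY.closedPt hv Q ∉ MY.closure (preimageCentre f : Set Y) →
        MX.multiplicity hv (MX.closure (Closeds.closure {ξ} : Closeds X)) (Q.map f hf) =
          MY.multiplicity hv (MY.closure (Closeds.closure {η} : Closeds Y)) Q := by
  have h1 := eventually_multiplicity_map_le (MY := MY) (MX := MX) hS f hf (preimageCentre f)
    (Closeds.closure {ξ}) (Closeds.closure {η}) (by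
      intro y hy
      obtain ⟨U, hyU, hU⟩ := exists_ideal_comap_eq_of_notMem_centre (Z := Closeds.closure {ξ})
        (W := Closeds.closure {η}) (y := y) hy fun z hz => mem_closure_iff_of_notMem_centre h hz
      exact ⟨U, hyU, hU.ge⟩)
  have h2 := eventually_multiplicity_le_map (MY := MY) (MX := MX) hS f hf
    (Closeds.closure {ξ}) (Closeds.closure {η})
    fun y hy => image_closure_subset isClosed_closure (h ▸ subset_closure rfl) hy
  filter_upwards [h1, h2] with v h1 h2 hv Q hQ
  exact le_antisymm (h1 hv Q hQ) (h2 hv Q)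

/-- Prime divisors which do not meet the centre have the same multiplicities as their strict
transforms. -/
theorem eventually_multiplicity_map_eq_of_disjoint (hS : S.Finite) (f : Y ⟶ X)
    (hf : f ≫ strX = strY) {η : Y} {ξ : X} (h : f η = ξ)
    (hξ : ∀ x ∈ _root_.closure {ξ}, x ∉ centre f) :
    ∀ᶠ v : HeightOneSpectrum (𝓞 K) in Filter.cofinite,
      ∀ (hv : v ∉ S) (Q : Point strY (v.adicCompletion K)),
        MX.multiplicity hv (MX.closure (Closeds.closure {ξ} : Closeds X)) (Q.map f hf) =
          MY.multiplicity hv (MY.closure (Closeds.closure {η} : Closeds Y)) Q := by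
  have h1 := eventually_multiplicity_map_le (MY := MY) (MX := MX) hS f hf ⊥
    (Closeds.closure {ξ}) (Closeds.closure {η}) (by
      intro y _
      by_cases hy : f y ∈ centre f
      · obtain ⟨U, hyU, -, hU⟩ := exists_ideal_comap_eq_top f (Closeds.closure {ξ})
          (fun hZ => hξ _ hZ hy) (O := ⊤) trivial
        exact ⟨U, hyU, hU ▸ le_top⟩
      · obtain ⟨U, hyU, hU⟩ := exists_ideal_comap_eq_of_notMem_centre (Z := Closeds.closure {ξ})
          (W := Closeds.closure {η}) (y := y) hy fun z hz => mem_closure_iff_of_notMem_centre h hz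
        exact ⟨U, hyU, hU.ge⟩)
  have h2 := eventually_multiplicity_le_map (MY := MY) (MX := MX) hS f hf
    (Closeds.closure {ξ}) (Closeds.closure {η})
    fun y hy => image_closure_subset isClosed_closure (h ▸ subset_closure rfl) hy
  filter_upwards [h1, h2] with v h1 h2 hv Q
  exact le_antisymm (h1 hv Q closedPt_notMem_closure_bot) (h2 hv Q)

/-- A local point meeting a prime divisor meets, with the corresponding multiplicity, one of the
components of its inverse image. -/
theorem eventually_eq_zero_or_exists_component [IsLocallyFactorial X] [IsLocallyFactorial Y]
    [CompactSpace Y] (hS : S.Finite) (f : Y ⟶ X) (hf : f ≫ strX = strY) {ξ : X}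
    (hξ : Order.coheight ξ = 1) (hfξ : ¬ ∀ y, f y ∈ _root_.closure {ξ}) :
    ∀ᶠ v : HeightOneSpectrum (𝓞 K) in Filter.cofinite,
      ∀ (hv : v ∉ S) (Q : Point strY (v.adicCompletion K)),
        MX.multiplicity hv (MX.closure (Closeds.closure {ξ} : Closeds X)) (Q.map f hf) = 0 ∨
        ∃ η, Order.coheight η = 1 ∧ f η ∈ _root_.closure {ξ} ∧
          MY.multiplicity hv (MY.closure (Closeds.closure {η} : Closeds Y)) Q ≠ 0 ∧
          pullbackOrder f (Closeds.closure {ξ}) η *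
            MY.multiplicity hv (MY.closure (Closeds.closure {η} : Closeds Y)) Q ≤
          MX.multiplicity hv (MX.closure (Closeds.closure {ξ} : Closeds X)) (Q.map f hf) := by
  obtain ⟨s, hs, hcov⟩ := exists_finite_components f hξ hfξ
  -- The multiplicity of each component is finite, as the comparison with powers of ideals requires,
  -- and there are finitely many components, so the exceptional places remain finite in number.
  have h1 := (Finset.eventually_all s).2 fun η hη => by
    obtain ⟨t, ht⟩ := ENat.ne_top_iff_exists.1 (pullbackOrder_ne_top f hξ hfξ η)
    have h := eventually_mul_multiplicity_le_map (MY := MY) (MX := MX) hS f hf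
      (Closeds.closure {ξ}) (Closeds.closure {η}) t
      (exists_ideal_le_pow _ (hs η hη).1 ht.le)
    rw [ht] at h
    exact h
  let N : Closeds Y := ⟨⋃ η ∈ s, _root_.closure {η}, s.finite_toSet.isClosed_biUnion fun _ _ =>
    isClosed_closure⟩
  have h2 := eventually_multiplicity_map_eq_zero (MY := MY) (MX := MX) hS f hf N
    (Closeds.closure {ξ}) fun y hy => by
      obtain ⟨η, hη, hηy⟩ := hcov y hy
      exact Set.mem_biUnion hη (specializes_iff_mem_closure.1 hηy)
  filter_upwards [h1, h2] with v h1 h2 hv Q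
  by_cases h : ∃ η ∈ s, MY.closedPt hv Q ∈ MY.closure (Closeds.closure {η} : Closeds Y)
  · obtain ⟨η, hη, hQ⟩ := h
    exact Or.inr ⟨η, (hs η hη).1, (hs η hη).2, fun h0 => multiplicity_eq_zero_iff.1 h0 hQ,
      h1 η hη hv Q⟩
  · refine Or.inl (h2 hv Q fun hQ => h ?_)
    have h3 : (MY.closure N : Set MY.total) =
        ⋃ η ∈ s, (MY.closure (Closeds.closure {η} : Closeds Y) : Set MY.total) := by
      change _root_.closure (MY.gen '' ⋃ η ∈ s, _root_.closure {η}) = _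
      rw [Set.image_iUnion₂]
      exact s.closure_biUnion _
    have h4 : MY.closedPt hv Q ∈ (MY.closure N : Set MY.total) := hQ
    rw [h3] at h4
    simpa using h4

end

theorem mem_closure_red_iff {D : Orbifold K} {M : Model S D.str} {x : M.total} :
    x ∈ M.closure D.red ↔ ∃ α, D.weight α ≠ 1 ∧ x ∈ M.closure (D.component α) := by
  have h : (M.closure D.red : Set M.total) =
      ⋃ α ∈ {α | D.weight α ≠ 1}, (M.closure (D.component α) : Set M.total) := by
    change _root_.closure (M.gen '' ⋃ α ∈ {α | D.weight α ≠ 1}, (D.component α : Set D.X)) = _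
    rw [Set.image_iUnion₂]
    exact (Set.toFinite _).closure_biUnion _
  rw [← SetLike.mem_coe, h]
  simp

end Model

end SemiIntegral

/-! ### The local statements and the proposition. -/

namespace SemiIntegral

open Scheme Scheme.IdealSheafData

variable {K : Type u} [Field K] [NumberField K] {S : Set (HeightOneSpectrum (𝓞 K))}
  {F D : Orbifold K} {f : F.X ⟶ D.X} {MY : Model S F.str} {MX : Model S D.str}

/-- A semi-integral point avoiding the centre lifts to a semi-integral point, at almost all places,
if the weights are minimal. -/
theorem IsEBOM.eventually_isLocalSemiIntegral_of_map (hf : IsEBOM F D f) (hS : S.Finite)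
    (hw : ∀ β α, f (F.pt β) = D.pt α → F.weight β = D.weight α) :
    ∀ᶠ v : HeightOneSpectrum (𝓞 K) in Filter.cofinite,
      ∀ (hv : v ∉ S) (star : Kind) (Q : Point F.str (v.adicCompletion K)),
        IsLocalSemiIntegral star MX hv (Q.map f hf.comp_str) →
        MX.closedPt hv (Q.map f hf.comp_str) ∉ MX.closure (centre f) →
        IsLocalSemiIntegral star MY hv Q := by
  have h1 := Model.eventually_multiplicity_le_map (MY := MY) (MX := MX) hS f hf.comp_str
    ⟨centre f, isClosed_centre f⟩ (preimageCentre f) fun y hy => hy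
  have h2 := Filter.eventually_all.2 fun β => Filter.eventually_all.2 fun α =>
    Filter.eventually_imp_distrib_left.2 fun h : f (F.pt β) = D.pt α =>
      Model.eventually_multiplicity_map_eq (MY := MY) (MX := MX) hS f hf.comp_str h
  filter_upwards [h1, h2] with v h1 h2 hv star Q hQ hQC
  -- If `Q` met the closure of the inverse image of the centre, then `f(Q)` would meet the closure
  -- of the centre.
  have hN : MY.closedPt hv Q ∉ MY.closure (preimageCentre f : Set F.X) :=
    Model.multiplicity_eq_zero_iff.1 (nonpos_iff_eq_zero.1
      ((h1 hv Q).trans_eq (Model.multiplicity_eq_zero_iff.2 hQC)))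
  have key : ∀ β, F.weight β ≠ 1 →
      MY.multiplicity hv (MY.closure (F.component β)) Q = 0 ∨
      ∃ α, D.weight α = F.weight β ∧ MX.multiplicity hv (MX.closure (D.component α))
        (Q.map f hf.comp_str) = MY.multiplicity hv (MY.closure (F.component β)) Q := by
    intro β hβ
    -- A component lying over the centre is not met by `Q` at all. Any other one is not contracted,
    -- so it is a strict transform of some `D_α` with the same weight and multiplicity.
    by_cases hc : f (F.pt β) ∈ centre f
    · refine Or.inl (Model.multiplicity_eq_zero_iff.2 fun h => hN (Model.closure_mono ?_ h))
      exact fun y hy => image_closure_subset (isClosed_centre f) hc hy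
    · obtain ⟨α, hα⟩ := hf.map_component β hβ
        (not_not.2 ((coheight_eq_of_notMem_centre hc).trans (F.coheight_pt β)))
      exact Or.inr ⟨α, (hw β α hα).symm, h2 β α hα hv Q hN⟩
  refine ⟨fun β hβ => ?_, fun β hβ => ?_⟩
  · rcases key β (by rw [hβ]; exact ENat.top_ne_one) with h | ⟨α, hα, h⟩
    · exact h
    · rw [← h]
      exact hQ.1 α (hα.trans hβ)
  · by_cases hβ1 : F.weight β = 1
    · rw [hβ1]
      exact star.cond_one _
    · rcases key β hβ1 with h | ⟨α, hα, h⟩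
      · rw [h]
        exact star.cond_zero _
      · rw [← h, ← hα]
        exact hQ.2 α (hα ▸ hβ)

/-- Under a divisible morphism whose centre does not meet `D_red`, the multiplicities with the
components of `D` and with their strict transforms agree at almost all places. -/
theorem IsEBOM.eventually_exists_component (hf : IsEBOM F D f) (hS : S.Finite)
    (hd : IsDivisible F D f) (hZ : centre f ∩ D.red = ∅) :
    ∀ᶠ v : HeightOneSpectrum (𝓞 K) in Filter.cofinite,
      ∀ (hv : v ∉ S) (Q : Point F.str (v.adicCompletion K)) (α), D.weight α ≠ 1 →
        ∃ β, D.weight α ∣ F.weight β ∧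
          MX.multiplicity hv (MX.closure (D.component α)) (Q.map f hf.comp_str) =
            MY.multiplicity hv (MY.closure (F.component β)) Q := by
  have hdisj : ∀ α, D.weight α ≠ 1 → ∀ x ∈ D.component α, x ∉ centre f := fun α hα x hx hxC =>
    Set.eq_empty_iff_forall_notMem.1 hZ x
      ⟨hxC, Set.mem_biUnion (show α ∈ {α | D.weight α ≠ 1} from hα) hx⟩
  have h := Filter.eventually_all.2 fun β => Filter.eventually_all.2 fun α =>
    Filter.eventually_imp_distrib_left.2 fun hα : D.weight α ≠ 1 =>
    Filter.eventually_imp_distrib_left.2 fun h : f (F.pt β) = D.pt α =>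
      Model.eventually_multiplicity_map_eq_of_disjoint (MY := MY) (MX := MX) hS f hf.comp_str h
        (hdisj α hα)
  filter_upwards [h] with v h hv Q α hα
  obtain ⟨β, hβ⟩ := hf.exists_component α hα
  exact ⟨β, hd.weight_dvd hβ (hdisj α hα _ (subset_closure rfl)), h β α hα hβ hv Q⟩

/-- With equal multiplicities, the condition for a weight implies that for any of its divisors. If
`m_α = ∞`, the weight upstairs is a non-zero multiple of it, hence infinite; if only the weight
upstairs is infinite, the multiplicity is zero and satisfies every condition. -/
theorem isLocalSemiIntegral_map_of_forall_exists (hf : f ≫ D.str = F.str)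
    {v : HeightOneSpectrum (𝓞 K)} {hv : v ∉ S} {Q : Point F.str (v.adicCompletion K)}
    (h : ∀ α, D.weight α ≠ 1 → ∃ β, D.weight α ∣ F.weight β ∧
      MX.multiplicity hv (MX.closure (D.component α)) (Q.map f hf) =
        MY.multiplicity hv (MY.closure (F.component β)) Q) {star : Kind}
    (hQ : IsLocalSemiIntegral star MY hv Q) : IsLocalSemiIntegral star MX hv (Q.map f hf) := by
  refine ⟨fun α hα => ?_, fun α hα => ?_⟩
  · obtain ⟨β, hβ, hn⟩ := h α (by rw [hα]; exact ENat.top_ne_one)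
    rw [hn]
    refine hQ.1 β (top_le_iff.1 ?_)
    obtain ⟨a, ha⟩ := hβ
    have ha0 : a ≠ 0 := by
      rintro rfl
      exact one_ne_zero (nonpos_iff_eq_zero.1 ((F.one_le_weight β).trans_eq (ha.trans (mul_zero _))))
    rw [ha, hα, ENat.top_mul ha0]
  · by_cases hα1 : D.weight α = 1
    · rw [hα1]
      exact star.cond_one _
    obtain ⟨β, hβ, hn⟩ := h α hα1
    rw [hn]
    by_cases hβt : F.weight β = ⊤
    · rw [hQ.1 β hβt]
      exact star.cond_zero _
    · exact star.cond_of_dvd hβ (Order.one_le_iff_ne_zero.1 (F.one_le_weight β)) (hQ.2 β hβt)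

/-- Orbifold morphisms preserve local Campana points at almost all places. -/
theorem IsOrbifoldMorphism.eventually_isLocalSemiIntegral_map (hf : IsOrbifoldMorphism F D f)
    (hS : S.Finite) : ∀ᶠ v : HeightOneSpectrum (𝓞 K) in Filter.cofinite,
      ∀ (hv : v ∉ S) (Q : Point F.str (v.adicCompletion K)),
        IsLocalSemiIntegral .campana MY hv Q →
        IsLocalSemiIntegral .campana MX hv (Q.map f hf.comp_str) := by
  have : CompactSpace F.X := QuasiCompact.compactSpace_of_compactSpace F.str
  have h := Filter.eventually_all.2 fun α =>
    Filter.eventually_imp_distrib_left.2 fun hα : D.weight α ≠ 1 =>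
      Model.eventually_eq_zero_or_exists_component (MY := MY) (MX := MX) hS f hf.comp_str
        (D.coheight_pt α) (hf.not_forall_mem_closure hα)
  filter_upwards [h] with v h hv Q hQ
  -- A Campana point that meets a prime divisor does so with multiplicity at least its weight, and
  -- that weight is finite. For a divisor not among the components of `F`, this is the weight `1`.
  have hweight : ∀ η, MY.multiplicity hv (MY.closure (Closeds.closure {η} : Closeds F.X)) Q ≠ 0 →
      F.weightAt η ≠ ⊤ ∧
        F.weightAt η ≤ MY.multiplicity hv (MY.closure (Closeds.closure {η} : Closeds F.X)) Q := by
    intro η hη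
    by_cases hβ : ∃ β, F.pt β = η
    · obtain ⟨β, rfl⟩ := hβ
      rw [F.weightAt_pt]
      have hβt : F.weight β ≠ ⊤ := fun ht => hη (hQ.1 β ht)
      refine ⟨hβt, ?_⟩
      rcases hQ.2 β hβt with h0 | ht | hle
      · exact absurd h0 hη
      · exact le_top.trans_eq ht.symm
      · exact hle
    · rw [F.weightAt_eq_one hβ]
      exact ⟨ENat.one_ne_top, Order.one_le_iff_ne_zero.2 hη⟩
  have key : ∀ α, D.weight α ≠ 1 →
      MX.multiplicity hv (MX.closure (D.component α)) (Q.map f hf.comp_str) = 0 ∨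
      D.weight α ≠ ⊤ ∧
      D.weight α ≤ MX.multiplicity hv (MX.closure (D.component α)) (Q.map f hf.comp_str) := by
    intro α hα
    refine (h α hα hv Q).imp_right fun ⟨η, hη, hηα, hη0, hle⟩ => ?_
    obtain ⟨hwt, hw⟩ := hweight η hη0
    have h1 := hf.weight_le η hη α hηα
    have : IsLocallyNoetherian F.X := F.isLocallyNoetherian
    have ht := pullbackOrder_ne_top f (D.coheight_pt α) (hf.not_forall_mem_closure hα) η
    -- The multiplicity along `D_α` is at least `t` times that along the component met, hence at
    -- least `t n ≥ m_α`. Since `t` and `n` are finite, so is `m_α`: a divisor of infinite weight is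
    -- never met.
    exact ⟨ne_top_of_le_ne_top (WithTop.mul_ne_top ht hwt) h1,
      h1.trans ((mul_le_mul_right hw _).trans hle)⟩
  refine ⟨fun α hα => ?_, fun α hα => ?_⟩
  · exact (key α (by rw [hα]; exact ENat.top_ne_one)).resolve_right fun h => h.1 hα
  · by_cases hα1 : D.weight α = 1
    · rw [hα1]
      exact Kind.cond_one _ _
    · exact (key α hα1).imp_right fun h => Or.inr h.2

end SemiIntegral

theorem proposition4p4 {K : Type u} [Field K] [NumberField K]
    (S : Set (HeightOneSpectrum (𝓞 K))) (hS : S.Finite)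
    (F D : SemiIntegral.Orbifold K) (f : F.X ⟶ D.X) (hf : SemiIntegral.IsEBOM F D f)
    (MY : SemiIntegral.Model S F.str) (MX : SemiIntegral.Model S D.str) :
    ∃ (T : Set (HeightOneSpectrum (𝓞 K))) (hST : S ⊆ T), T.Finite ∧
      -- (i)
      ((∀ β α, f (F.pt β) = D.pt α → F.weight β = D.weight α) →
        ∀ star : SemiIntegral.Kind,
          {x ∈ SemiIntegral.semiIntegralPoints star MX hST |
              MX.ClosureAvoids hST x (SemiIntegral.centre f)} ⊆
            SemiIntegral.Point.map f hf.comp_str '' SemiIntegral.semiIntegralPoints star MY hST) ∧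
      -- (ii)
      (SemiIntegral.IsDivisible F D f → SemiIntegral.centre f ∩ D.red = ∅ →
        (∀ star : SemiIntegral.Kind,
          SemiIntegral.Point.map f hf.comp_str '' SemiIntegral.semiIntegralPoints star MY hST ⊆
            SemiIntegral.semiIntegralPoints star MX hST) ∧
        SemiIntegral.Point.map f hf.comp_str '' SemiIntegral.integralPoints MY hST ⊆
          SemiIntegral.integralPoints MX hST) ∧
      -- (iii)
      ((∀ η ∈ SemiIntegral.exceptionalPts f, ∀ α, D.weight α ≠ 1 →
          f '' closure {η} ∩ D.component α = ∅ ∨ f '' closure {η} ⊆ D.component α) →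
        SemiIntegral.Point.map f hf.comp_str '' SemiIntegral.semiIntegralPoints .campana MY hST ⊆
          SemiIntegral.semiIntegralPoints .campana MX hST) := by
  have h1 :=
    Filter.eventually_imp_distrib_left.2
      (hf.eventually_isLocalSemiIntegral_of_map (MY := MY) (MX := MX) hS)
  have h2 := Filter.eventually_imp_distrib_left.2 fun hd : SemiIntegral.IsDivisible F D f =>
    Filter.eventually_imp_distrib_left.2
      (hf.eventually_exists_component (MY := MY) (MX := MX) hS hd)
  have h3 := hf.toIsOrbifoldMorphism.eventually_isLocalSemiIntegral_map (MY := MY) (MX := MX) hS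
  -- The local statements hold uniformly in the points, so one finite set of exceptional places
  -- serves all points and all three assertions.
  obtain ⟨T, hST, hT, hgood⟩ :=
    hS.exists_finite_superset_of_eventually_cofinite ((h1.and h2).and h3)
  refine ⟨T, hST, hT, fun hw star P hP => ?_, fun hd hZ => ⟨?_, ?_⟩, ?_⟩
  · obtain ⟨Q, rfl⟩ := SemiIntegral.Point.exists_map_eq f hf.comp_str P hP.2.notMem
    refine ⟨Q, fun v hv => ?_, rfl⟩
    have h := hP.1 v hv
    have hC := hP.2.closedPt_notMem hv
    rw [SemiIntegral.Point.extend_map] at h hC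
    exact (hgood v hv).1.1 hw _ star _ h hC
  · rintro star _ ⟨Q, hQ, rfl⟩ v hv
    rw [SemiIntegral.Point.extend_map]
    exact SemiIntegral.isLocalSemiIntegral_map_of_forall_exists hf.comp_str
      ((hgood v hv).1.2 hd hZ _ _) (hQ v hv)
  · rintro _ ⟨Q, hQ, rfl⟩ v hv
    have h := hQ v hv
    rw [SemiIntegral.Model.mem_closedPt_of_range (SemiIntegral.Model.closure _ _).isClosed,
      SetLike.mem_coe, SemiIntegral.Model.mem_closure_red_iff] at h ⊢
    rw [SemiIntegral.Point.extend_map]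
    rintro ⟨α, hα, hm⟩
    obtain ⟨β, hβ, hn⟩ := (hgood v hv).1.2 hd hZ (fun h => hv (hST h))
      (Q.extend (v.adicCompletion K)) α hα
    -- A strict transform of weight `1` would force `m_α ∣ 1`, so components of `D_red` correspond
    -- to components of `F_red`.
    refine h ⟨β, fun hβ1 => hα (le_antisymm (ENat.le_of_dvd_of_ne_zero
      (hβ1 ▸ hβ) one_ne_zero) (D.one_le_weight α)), ?_⟩
    rw [← SemiIntegral.Model.one_le_multiplicity_iff] at hm ⊢
    rwa [← hn]
  · rintro - _ ⟨Q, hQ, rfl⟩ v hv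
    rw [SemiIntegral.Point.extend_map]
    exact (hgood v hv).2 _ _ (hQ v hv)
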